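/- Let $m\ge 3$ and let $W=I_2(m)$ be the dihedral group of order $2m$, acting on $V=\mathbb C^2$ by its reflection representation. Let $\chi_0$ be the trivial character, $\chi_1$ the character of $V$, $\epsilon=\det_V$ the sign character and, if $m$ is even, $\chi_{m/2},\chi'_{m/2}$ the two remaining linear characters. Let $$R(f)=\frac{(q^2-1)(q^m-1)}{2m}\sum_{w\in W}\frac{\det_V(w)f(w)}{\det_V(q-w)},$$ let $b_\chi$ be the largest power of $q$ dividing $R(\chi)$, and let $\Omega=(\omega_{\chi,\chi'})_{\chi,\chi'\in\mathrm{Irr}(W)}$ with $\omega_{\chi,\chi'}=q^{m}R(\chi\otimes\chi'\otimes\overline{\det_V})$. Let $\mathcal H$ be the Iwahori–Hecke algebra of $W$ with the single parameter $q$ and its canonical symmetrizing trace. A character $\chi\in\mathrm{Irr}(W)$ is *special* if $b_\chi$ is the largest power of $q$ dividing its generic degree, and the *families* of characters are the blocks of $\mathcal H$ over the Rouquier ring, which is generated by the algebraic integers, $q^{\pm1}$ and the elements $(q^n-1)^{-1}$, $n\ge1$. A *Lusztig–Shoji datum* is a triple $(X,<,a)$ consisting of a partition $X$ of $\mathrm{Irr}(W)$,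 a total order $<$ on $X$ and a function $a:X\to\mathbb N$ such that $\mathcal C<\mathcal C'$ implies $a_{\mathcal C}\ge a_{\mathcal C'}$. The member of $X$ containing $\chi$ is its support $\mathrm{supp}\,\chi$. A *system of Green functions* for it is a pair of matrices $P,\Lambda$ of rational functions in $q$ over $\mathbb Z$, indexed by $\mathrm{Irr}(W)$, such that $P\Lambda P^t=\Omega$, $P_{\chi,\chi'}=0$ if $\mathrm{supp}\,\chi<\mathrm{supp}\,\chi'$, $P_{\chi,\chi'}=\delta_{\chi,\chi'}q^{a_{\mathcal C}}$ if $\mathrm{supp}\,\chi=\mathrm{supp}\,\chi'=\mathcal C$, and $\Lambda_{\chi,\chi'}=0$ if $\mathrm{supp}\,\chi\ne\mathrm{supp}\,\chi'$. The datum is a *Springer correspondence* for $W$ if 1. for every $\mathcal C\in X$ we have $a_{\mathcal C}=\min_{\chi\in\mathcal C}b_\chi$, and this minimum is attained at exactly one $\chi\in\mathcal C$, called the *Springer representation* of $\mathcal C$; 2. every special character is a Springer representation; 3. if $\chi'$ is nonspecial and lies in the family of the special character $\chi$, then $\mathrm{supp}\,\chi'\le\mathrm{supp}\,\chi$; 4.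 it has a system of Green functions in which the entries of $\Lambda$ are polynomials with integer coefficients and the entries of $P$ are polynomials with nonnegative integer coefficients; 5. in this system, $P_{\chi,\chi'}$ is divisible by $q^{a_{\mathcal C}}$ whenever $\chi\in\mathcal C$. Two classes in Springer correspondences with the same set $\mathcal S$ of Springer representations are identified when they have the same Springer representation. A Springer correspondence $X$ with set of Springer representations $\mathcal S$ is *maximal* if $\mathrm{supp}_X\chi\ge\mathrm{supp}_{X'}\chi$ for all $\chi\in\mathrm{Irr}(W)$ and all Springer correspondences $X'$ with set of Springer representations $\mathcal S$. **Theorem.** For every set $\mathcal S\subseteq\mathrm{Irr}(W)$ with $\chi_0,\chi_1,\epsilon\in\mathcal S$ there is a maximal Springer correspondence $(X,<,a)$ for $W$ whose set of Springer representations is $\mathcal S$. It is unique in the following sense: $X$ and $a$ are uniquely determined, and so is the order of any two classes, except that when $m$ is even and $\chi_{m/2},\chi'_{m/2}\in\mathcal S$ the relative order of the two classes $\{\chi_{m/2}\}$ and $\{\chi'_{m/2}\}$ is not claimed to be unique. -/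

import Mathlib

open Polynomial

namespace DihedralSpringer

noncomputable section

/-! ### The dihedral group as a reflection group -/

/-- The reflection representation of `I₂(m)` on `V = ℂ²`. The rotation `r i` acts by
`diag(ζ^i, ζ^(-i))` with `ζ = exp(2πi/m)`, and `sr 0` interchanges the two coordinates. -/
def reflRep (m : ℕ) [NeZero m] : DihedralGroup m →* Matrix (Fin 2) (Fin 2) ℂ where
  toFun
    | .r i => !![ZMod.stdAddChar i, 0; 0, ZMod.stdAddChar (-i)]
    | .sr i => !![0, ZMod.stdAddChar (-i); ZMod.stdAddChar i, 0]
  map_one' := by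
    rw [DihedralGroup.one_def]
    ext i j
    fin_cases i <;> fin_cases j <;> simp
  map_mul' := by
    rintro (i | i) (j | j) <;>
    · simp only [DihedralGroup.r_mul_r, DihedralGroup.r_mul_sr, DihedralGroup.sr_mul_r,
        DihedralGroup.sr_mul_sr]
      ext a b
      fin_cases a <;> fin_cases b <;>
        simp [Matrix.mul_apply, Fin.sum_univ_two, ← AddChar.map_add_eq_mul, add_comm,
          sub_eq_add_neg]

/-- The trivial character `χ₀`. -/
def trivChar (m : ℕ) : DihedralGroup m → ℂ := fun _ => 1

/-- The character `χ₁` of the reflection representation. -/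
def reflChar (m : ℕ) [NeZero m] : DihedralGroup m → ℂ := fun w => (reflRep m w).trace

/-- The character `det_V`, which is the sign character `ε`. -/
def detChar (m : ℕ) [NeZero m] : DihedralGroup m → ℂ := fun w => (reflRep m w).det

/-- For even `m`, one of the two linear characters of `I₂(m)` other than the trivial and the sign
character; it is `1` on `sr 0` and `-1` on `sr 1`. (For odd `m` this is not a character.) -/
def chiR (m : ℕ) : DihedralGroup m → ℂ
  | .r i => (-1) ^ i.val
  | .sr i => (-1) ^ i.val

/-- For even `m`, the other one; it is `-1` on `sr 0` and `1` on `sr 1`. -/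
def chiR' (m : ℕ) : DihedralGroup m → ℂ
  | .r i => (-1) ^ i.val
  | .sr i => -(-1) ^ i.val

/-- `Irr(W)` for `W = I₂(m)`: the set of irreducible complex characters. -/
def Irr (m : ℕ) : Set (DihedralGroup m → ℂ) :=
  {χ | ∃ (n : ℕ) (ρ : Representation ℂ (DihedralGroup m) (Fin n → ℂ)),
    ρ.IsIrreducible ∧ ρ.character = χ}

theorem finite_Irr (m : ℕ) [NeZero m] : (Irr m).Finite := by
  classical
  have hcard : (Nat.card (DihedralGroup m) : ℂ) ≠ 0 := by
    rw [Nat.cast_ne_zero]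
    exact Nat.card_pos.ne'
  have : Invertible (Nat.card (DihedralGroup m) : ℂ) := invertibleOfNonzero hcard
  have horth : ∀ χ χ' : Irr m, (Nat.card (DihedralGroup m) : ℂ)⁻¹ *
      ∑ w, χ.1 w * χ'.1 w⁻¹ = if χ = χ' then 1 else 0 := by
    rintro ⟨_, n, ρ, hρ, rfl⟩ ⟨_, n', σ, hσ, rfl⟩
    rw [Representation.char_orthonormal]
    by_cases h : Nonempty (Representation.Equiv σ ρ)
    · rw [if_pos h, if_pos]
      exact Subtype.ext (Representation.char_iso h.some).symm
    · rw [if_neg h, if_neg]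
      intro h'
      replace h' : ρ.character = σ.character := congrArg Subtype.val h'
      have h1 := Representation.char_orthonormal ρ σ
      have h2 := Representation.char_orthonormal ρ ρ
      rw [if_neg h, ← h'] at h1
      rw [if_pos ⟨Representation.Equiv.refl ρ⟩] at h2
      exact zero_ne_one (h1.symm.trans h2)
  have hli : LinearIndependent ℂ (Subtype.val : Irr m → (DihedralGroup m → ℂ)) := by
    rw [linearIndependent_iff']
    intro s g hg j hj
    have h3 : ∑ i ∈ s, g i * ((Nat.card (DihedralGroup m) : ℂ)⁻¹ *
        ∑ w, i.1 w * j.1 w⁻¹) = 0 := by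
      have h4 : ∀ w, ∑ i ∈ s, g i * i.1 w = 0 := fun w => by
        simpa using congrFun hg w
      calc _ = ∑ w, (∑ i ∈ s, g i * i.1 w) *
            ((Nat.card (DihedralGroup m) : ℂ)⁻¹ * j.1 w⁻¹) := by
            simp only [Finset.mul_sum, Finset.sum_mul]
            rw [Finset.sum_comm]
            exact Finset.sum_congr rfl fun w _ => Finset.sum_congr rfl fun i _ => by ring
        _ = 0 := by simp [h4]
    simp only [horth] at h3
    simpa [hj] using h3
  have := hli.finite_of_isNoetherian
  exact Set.toFinite _

instance (m : ℕ) [NeZero m] : Fintype (Irr m) := (finite_Irr m).fintype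

/-! ### Fake degrees and the matrix `Ω` -/

/-- A complex polynomial in `q` as an element of `ℂ(q)`. -/
def ofPoly (p : ℂ[X]) : RatFunc ℂ := algebraMap ℂ[X] (RatFunc ℂ) p

/-- The indeterminate `q`. -/
def q : RatFunc ℂ := RatFunc.X

/-- The Poincaré polynomial `P_W(q)`; the degrees of `I₂(m)` are `2` and `m`. -/
def poincare (m : ℕ) : RatFunc ℂ := (q ^ 2 - 1) / (q - 1) * ((q ^ m - 1) / (q - 1))

/-- `R(f) = (q-1)^{dim V} P_W(q) / |W| * ∑_w det_V(w) f(w) / det_V(q - w)`, the fake degree of `f`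
when `f` is an irreducible character. -/
def fakeDegree (m : ℕ) [NeZero m] (f : DihedralGroup m → ℂ) : RatFunc ℂ :=
  (q - 1) ^ 2 * poincare m / (Nat.card (DihedralGroup m) : RatFunc ℂ) *
    ∑ w : DihedralGroup m,
      RatFunc.C ((reflRep m w).det * f w) / ofPoly (reflRep m w).charpoly

/-- For a nonzero polynomial in `q`, the largest power of `q` dividing it. -/
def qOrder (f : RatFunc ℂ) : ℕ := f.num.natTrailingDegree

/-- `b_χ`, the largest power of `q` dividing the fake degree of `χ`. -/
def b {m : ℕ} [NeZero m] (χ : DihedralGroup m → ℂ) : ℕ := qOrder (fakeDegree m χ)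

/-- `Ω_{χ,χ'} = q^{N*} R(χ ⊗ χ' ⊗ conj det_V)`; `I₂(m)` has `N* = m` reflections. -/
def Omega (m : ℕ) [NeZero m] : Matrix (Irr m) (Irr m) (RatFunc ℂ) :=
  fun χ χ' => q ^ m * fakeDegree m fun w =>
    χ.1 w * χ'.1 w * (starRingEnd ℂ) (detChar m w)

/-! ### The Hecke algebra, special characters and families -/

/-- The alternating word of length `n` in the letters `0`, `1`, starting with `i`. -/
def altWord : Fin 2 → ℕ → List (Fin 2)
  | _, 0 => []
  | i, n + 1 => i :: altWord (1 - i) n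

/-- The simple reflections of `I₂(m)`. -/
def simpleRefl (m : ℕ) : Fin 2 → DihedralGroup m := ![.sr 0, .sr 1]

/-- A reduced word for each element of `I₂(m)` with respect to the simple reflections. -/
def redWord (m : ℕ) : DihedralGroup m → List (Fin 2)
  | .r i => if 2 * i.val ≤ m then altWord 0 (2 * i.val) else altWord 1 (2 * (m - i.val))
  | .sr i =>
    if i.val = 0 then altWord 0 1
    else if 2 * i.val ≤ m + 1 then altWord 1 (2 * i.val - 1)
    else altWord 0 (2 * (m - i.val) + 1)

theorem prod_altWord (m n : ℕ) :
    ((altWord 0 (2 * n)).map (simpleRefl m)).prod = .r n ∧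
    ((altWord 1 (2 * n)).map (simpleRefl m)).prod = .r (-n) ∧
    ((altWord 0 (2 * n + 1)).map (simpleRefl m)).prod = .sr (-n) ∧
    ((altWord 1 (2 * n + 1)).map (simpleRefl m)).prod = .sr (n + 1) := by
  induction n with
  | zero => simp [altWord, simpleRefl]
  | succ n ih =>
    obtain ⟨-, -, h3, h4⟩ := ih
    have e0 : ∀ k, altWord 0 (k + 1) = 0 :: altWord 1 k := fun k => rfl
    have e1 : ∀ k, altWord 1 (k + 1) = 1 :: altWord 0 k := fun k => rfl
    have h5 : ((altWord 0 (2 * (n + 1))).map (simpleRefl m)).prod = .r ((n + 1 : ℕ) : ZMod m) := by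
      rw [show 2 * (n + 1) = 2 * n + 1 + 1 by ring, e0, List.map_cons, List.prod_cons, h4]
      simp [simpleRefl]
    have h6 : ((altWord 1 (2 * (n + 1))).map (simpleRefl m)).prod =
        .r (-((n + 1 : ℕ) : ZMod m)) := by
      rw [show 2 * (n + 1) = 2 * n + 1 + 1 by ring, e1, List.map_cons, List.prod_cons, h3]
      simp [simpleRefl, sub_eq_add_neg, add_comm]
    refine ⟨h5, h6, ?_, ?_⟩
    · rw [e0, List.map_cons, List.prod_cons, h6]
      simp [simpleRefl]
    · rw [e1, List.map_cons, List.prod_cons, h5]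
      simp [simpleRefl, add_comm]

/-- The chosen words do represent the given elements. -/
theorem prod_redWord (m : ℕ) [NeZero m] (w : DihedralGroup m) :
    ((redWord m w).map (simpleRefl m)).prod = w := by
  rcases w with i | i
  · have hi := ZMod.val_lt i
    have hc : ((i.val : ℕ) : ZMod m) = i := ZMod.natCast_zmod_val i
    simp only [redWord]
    split_ifs
    · rw [(prod_altWord m _).1, hc]
    · rw [(prod_altWord m _).2.1, Nat.cast_sub hi.le, hc]
      simp
  · have hi := ZMod.val_lt i
    have hc : ((i.val : ℕ) : ZMod m) = i := ZMod.natCast_zmod_val i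
    simp only [redWord]
    split_ifs with h h'
    · rw [show 1 = 2 * 0 + 1 by rfl, (prod_altWord m 0).2.2.1, ← hc, h]
      simp
    · obtain ⟨k, hk⟩ : ∃ k, i.val = k + 1 := ⟨i.val - 1, by omega⟩
      rw [show 2 * i.val - 1 = 2 * k + 1 by omega, (prod_altWord m k).2.2.2, ← hc, hk]
      simp
    · rw [(prod_altWord m _).2.2.1, Nat.cast_sub hi.le, hc]
      simp

/-- The defining relations of the Iwahori–Hecke algebra of `I₂(m)` over `A` with parameter `Q`. -/
inductive HeckeRel (A : Type) [CommRing A] (Q : A) (m : ℕ) :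
    FreeAlgebra A (Fin 2) → FreeAlgebra A (Fin 2) → Prop
  | quadratic (i : Fin 2) : HeckeRel A Q m
      ((FreeAlgebra.ι A i - algebraMap A _ Q) * (FreeAlgebra.ι A i + 1)) 0
  | braid : HeckeRel A Q m
      ((altWord 0 m).map (FreeAlgebra.ι A)).prod ((altWord 1 m).map (FreeAlgebra.ι A)).prod

/-- The (one-parameter) Iwahori–Hecke algebra of `I₂(m)`. -/
abbrev Hecke (A : Type) [CommRing A] (Q : A) (m : ℕ) : Type := RingQuot (HeckeRel A Q m)

/-- The generators of the Hecke algebra. -/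
def heckeGen {A : Type} [CommRing A] (Q : A) (m : ℕ) (i : Fin 2) : Hecke A Q m :=
  RingQuot.mkAlgHom A (HeckeRel A Q m) (FreeAlgebra.ι A i)

/-- The standard basis element `T_w`. -/
def heckeT {A : Type} [CommRing A] (Q : A) {m : ℕ} (w : DihedralGroup m) : Hecke A Q m :=
  ((redWord m w).map (heckeGen Q m)).prod

/-- A matrix representation over `ℂ[q]` of the Hecke algebra with parameter `q`. -/
abbrev HeckeRep (m n : ℕ) : Type :=
  Hecke ℂ[X] (X : ℂ[X]) m →ₐ[ℂ[X]] Matrix (Fin n) (Fin n) ℂ[X]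

/-- `ρ` corresponds to the character `χ` of `I₂(m)` under the specialization `q = 1`. -/
def Deforms {m n : ℕ} (ρ : HeckeRep m n) (χ : DihedralGroup m → ℂ) : Prop :=
  ∀ w, (ρ (heckeT X w)).trace.eval 1 = χ w

/-- The Schur element of `ρ` with respect to the canonical symmetrizing trace `T_w ↦ δ_{w,1}`, for
which the basis dual to `(T_w)` is `(q^{-ℓ(w)} T_{w⁻¹})`. -/
def schurElement {m n : ℕ} [NeZero m] (ρ : HeckeRep m n) : RatFunc ℂ :=
  (n : RatFunc ℂ)⁻¹ * ∑ w : DihedralGroup m, (q ^ (redWord m w).length)⁻¹ *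
    (ofPoly (ρ (heckeT X w)).trace * ofPoly (ρ (heckeT X w⁻¹)).trace)

/-- The generic degree. -/
def genericDegree {m n : ℕ} [NeZero m] (ρ : HeckeRep m n) : RatFunc ℂ :=
  poincare m / schurElement ρ

/-- `χ` is special: the largest power of `q` dividing its generic degree is `b_χ`. -/
def IsSpecial {m : ℕ} [NeZero m] (χ : DihedralGroup m → ℂ) : Prop :=
  ∃ (n : ℕ) (ρ : HeckeRep m n), Deforms ρ χ ∧ qOrder (genericDegree ρ) = b χ

/-- The Rouquier ring: all `a / (q^k ∏ (q^{n_i} - 1))` where `a` is a polynomial in `q` whose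
coefficients are algebraic integers. -/
def rouquierRing : Subring (RatFunc ℂ) :=
  Subring.closure ({f | ∃ z : ℂ, IsIntegral ℤ z ∧ f = RatFunc.C z} ∪ {q, q⁻¹} ∪
    {f | ∃ n : ℕ, 1 ≤ n ∧ f = (q ^ n - 1)⁻¹})

/-- The indeterminate as an element of the Rouquier ring. -/
def rouquierQ : rouquierRing :=
  ⟨q, Subring.subset_closure (Or.inl (Or.inr (Or.inl rfl)))⟩

/-- The Hecke algebra over the Rouquier ring. -/
abbrev RouquierHecke (m : ℕ) : Type := Hecke rouquierRing rouquierQ m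

/-- The element `e` acts as the identity on the representation attached to `χ`, extended to
`ℂ(q)`. -/
def ActsAsOne {m : ℕ} (e : RouquierHecke m) (χ : DihedralGroup m → ℂ) : Prop :=
  ∃ (n : ℕ) (ρ : HeckeRep m n)
    (φ : RouquierHecke m →ₐ[rouquierRing] Matrix (Fin n) (Fin n) (RatFunc ℂ)),
    Deforms ρ χ ∧ (∀ i, φ (heckeGen rouquierQ m i) = (ρ (heckeGen X m i)).map ofPoly) ∧ φ e = 1

/-- `χ` and `χ'` are in the same family, i.e. in the same block of the Hecke algebra over the
Rouquier ring: no central idempotent separates them. -/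
def SameFamily {m : ℕ} (χ χ' : DihedralGroup m → ℂ) : Prop :=
  ∀ e : RouquierHecke m, e ∈ Subalgebra.center rouquierRing (RouquierHecke m) →
    IsIdempotentElem e → (ActsAsOne e χ ↔ ActsAsOne e χ')

/-! ### Lusztig–Shoji data and Green functions -/

/-- A Lusztig–Shoji datum `(X, <, a)`: a partition of `Irr(W)`, a total order on it and a weakly
order-reversing function to `ℕ`. Only the values of `lt` and `a` on `parts` carry meaning. -/
structure LSDatum (m : ℕ) where
  parts : Set (Set (DihedralGroup m → ℂ))
  nonempty : ∀ C ∈ parts, C.Nonempty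
  sUnion_parts : ⋃₀ parts = Irr m
  disjoint : parts.PairwiseDisjoint id
  lt : Set (DihedralGroup m → ℂ) → Set (DihedralGroup m → ℂ) → Prop
  lt_irrefl : ∀ C ∈ parts, ¬ lt C C
  lt_trans : ∀ C ∈ parts, ∀ C' ∈ parts, ∀ C'' ∈ parts, lt C C' → lt C' C'' → lt C C''
  lt_total : ∀ C ∈ parts, ∀ C' ∈ parts, C ≠ C' → lt C C' ∨ lt C' C
  a : Set (DihedralGroup m → ℂ) → ℕ
  a_antitone : ∀ C ∈ parts, ∀ C' ∈ parts, lt C C' → a C' ≤ a C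

namespace LSDatum

variable {m : ℕ}

/-- The relation `≤` on the parts. -/
def le (D : LSDatum m) (C C' : Set (DihedralGroup m → ℂ)) : Prop := C = C' ∨ D.lt C C'

/-- The support of `χ`: the part that contains `χ`. -/
def supp (D : LSDatum m) (χ : DihedralGroup m → ℂ) : Set (DihedralGroup m → ℂ) :=
  {χ' | ∃ C ∈ D.parts, χ ∈ C ∧ χ' ∈ C}

theorem supp_eq (D : LSDatum m) {C : Set (DihedralGroup m → ℂ)} (hC : C ∈ D.parts)
    {χ : DihedralGroup m → ℂ} (hχ : χ ∈ C) : D.supp χ = C := by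
  ext χ'
  constructor
  · rintro ⟨C', hC', h, h'⟩
    rwa [D.disjoint.elim_set hC hC' χ hχ h]
  · exact fun h => ⟨C, hC, hχ, h⟩

end LSDatum

/-- `f` is a quotient of two polynomials with integer coefficients. -/
def IsRationalOverZ (f : RatFunc ℂ) : Prop :=
  ∃ p d : ℤ[X], d ≠ 0 ∧
    f = ofPoly (p.map (Int.castRingHom ℂ)) / ofPoly (d.map (Int.castRingHom ℂ))

/-- `(P, Λ)` is a system of Green functions with respect to `D`. -/
structure IsGreenSystem {m : ℕ} [NeZero m] (D : LSDatum m)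
    (P Λ : Matrix (Irr m) (Irr m) (RatFunc ℂ)) : Prop where
  P_rational : ∀ χ χ', IsRationalOverZ (P χ χ')
  Λ_rational : ∀ χ χ', IsRationalOverZ (Λ χ χ')
  equation : P * Λ * P.transpose = Omega m
  P_of_lt : ∀ χ χ' : Irr m, D.lt (D.supp χ.1) (D.supp χ'.1) → P χ χ' = 0
  P_self : ∀ χ : Irr m, P χ χ = q ^ D.a (D.supp χ.1)
  P_of_eq : ∀ χ χ' : Irr m, χ ≠ χ' → D.supp χ.1 = D.supp χ'.1 → P χ χ' = 0
  Λ_of_ne : ∀ χ χ' : Irr m, D.supp χ.1 ≠ D.supp χ'.1 → Λ χ χ' = 0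

/-! ### Springer correspondences -/

namespace LSDatum

variable {m : ℕ} [NeZero m]

/-- The set of Springer representations: the characters on which `b` attains its minimum over
their part. -/
def springerReps (D : LSDatum m) : Set (DihedralGroup m → ℂ) :=
  {χ | χ ∈ Irr m ∧ ∀ χ' ∈ D.supp χ, b χ ≤ b χ'}

/-- `D` is a Springer correspondence for `I₂(m)`. -/
structure IsSpringer (D : LSDatum m) : Prop where
  /-- `a` is the minimum of `b` on each part, and the minimum is attained exactly once. -/
  min_b : ∀ C ∈ D.parts, ∃ σ ∈ C, D.a C = b σ ∧ ∀ χ ∈ C, χ ≠ σ → b σ < b χ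
  special_mem : ∀ χ ∈ Irr m, IsSpecial χ → χ ∈ D.springerReps
  family : ∀ χ ∈ Irr m, ∀ χ' ∈ Irr m, IsSpecial χ → ¬ IsSpecial χ' → SameFamily χ χ' →
    D.le (D.supp χ') (D.supp χ)
  /-- The Green functions are polynomials with integer coefficients (`Λ`) and with nonnegative
  integer coefficients (`P`), and the row of `χ` in `P` is divisible by `q ^ a (supp χ)`. -/
  green : ∃ P Λ : Matrix (Irr m) (Irr m) (RatFunc ℂ), IsGreenSystem D P Λ ∧
    (∀ χ χ' : Irr m, ∃ p : ℤ[X], Λ χ χ' = ofPoly (p.map (Int.castRingHom ℂ))) ∧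
    (∀ χ χ' : Irr m, ∃ p : ℕ[X], P χ χ' = ofPoly (p.map (Nat.castRingHom ℂ)) ∧
      X ^ D.a (D.supp χ.1) ∣ p)

/-- `D` is a Springer correspondence whose set of Springer representations is `S`. -/
def IsSpringerFor (D : LSDatum m) (S : Set (DihedralGroup m → ℂ)) : Prop :=
  D.IsSpringer ∧ D.springerReps = S

/-- `D` is a maximal Springer correspondence for `S`: `supp_D χ ≥ supp_D' χ` for every `χ` and
every Springer correspondence `D'` for `S`. Classes of `D` and `D'` are identified when they have
the same Springer representation, so `supp_D' χ`, with Springer representation `σ`, is identified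
with the class `supp_D σ`. -/
def IsMaximalFor (D : LSDatum m) (S : Set (DihedralGroup m → ℂ)) : Prop :=
  D.IsSpringerFor S ∧ ∀ D' : LSDatum m, D'.IsSpringerFor S →
    ∀ χ ∈ Irr m, ∀ σ ∈ S, σ ∈ D'.supp χ → D.le (D.supp σ) (D.supp χ)

end LSDatum

end

end DihedralSpringer

open DihedralSpringer

/-! The irreducible characters are the "lines" χ_j with 0 ≤ 2j < m (χ_0 trivial), for even m two
linear "middle" characters at position m/2, and ε at position m. Evaluating the sums over rotations
and reflections gives the fake degrees R, the equality of b with the position, and Ω = R Rᵗ + (q^m -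
1) K, where K vanishes on ε and K(χ_i, χ_j) = q^min(i,j) R(χ_max(i,j)) for max(i,j) > 0. As R(χ_j) =
q^j + q^m q^(-j), the rows of Ω satisfy many linear relations on suitable sets of columns.

Little is needed from the Hecke algebra. The traces of T_w on deformations of the other lines and of
the middle characters are divisible by q^⌊ℓ(w)/2⌋, so their generic degrees have q-order at most 1
and only χ_0, χ_1, ε can be special. The normalized antisymmetrizer is a central idempotent over the
Rouquier ring, so ε is alone in its family. For even m, χ_1 is special and its family contains the
middle characters: a central idempotent acts by 0 or 1 in the model with parameter 2cos(2πi/m),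
these values are congruent modulo differences of parameters, and such a difference is not a unit
when the indices differ by an element of prime power order; chains of such steps join i = 1 to i =
m/2.

The bounds on supports rest on `green_regression`: a relation between rows of Ω on a set L of
columns closed under passing to smaller supports also holds for the rows of P on L. Interpolating a
row between its neighbours in L (`between_lines`, `below_mids`, `top_line`, `top_mid`) gives
coefficients with roots of unity as poles, so an entry of P would not be a polynomial. One case
survives, with exactly one middle character in L (`one_mid`); there positivity and divisibility by
q^a give an inequality. Hence a(supp χ) is at least the largest Springer line below χ, except when
exactly one middle character is in S and χ lies beyond a threshold; then only the bound 1 from the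
family of χ_1 remains (`pos_springerRep_le`).

These bounds are attained. The candidate puts χ ∉ S into the class of the preceding line of S, or
into that of χ_1 beyond the threshold. Its matrix P has at most one nonzero entry per row and class,
and all entries other than those in the column of ε are zero or powers of q. The class of ε accounts
for R Rᵗ; the other classes add up to (q^m - 1) K, by a telescoping sum for the lines below the
threshold and by a direct balance beyond it (`classSum_eq`).

A class with smaller a is larger in the order, so attaining the lower bound on a means having the
largest supports: the candidate is maximal. Any other maximal datum dominates it and obeys the same
bounds, so it has the same values of a on supports. Elements of S have different positions apart
from the two middle characters, whose classes are singletons, so classes, a and order are determined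
up to that pair. -/

namespace DihedralSpringer

noncomputable section

variable {m : ℕ} [NeZero m]

/-! ### The irreducible characters of the dihedral group -/

/-- Labels of the irreducible characters: `line 0` is the trivial character, `line j` the
two-dimensional character `χ_j`, `mid` one of the two remaining linear characters for even `m`,
and `sgn` the sign character. -/
inductive Lab where
  | line (j : ℕ)
  | mid (s : Bool)
  | sgn
  deriving DecidableEq

/-- The labels which occur for `I₂(m)`. -/
def Lab.Valid (m : ℕ) : Lab → Prop
  | .line j => 2 * j < m
  | .mid _ => Even m
  | .sgn => True

/-- The sum of two conjugate characters of the rotation subgroup, extended by zero. -/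
def dih (m : ℕ) [NeZero m] (j : ℕ) : DihedralGroup m → ℂ
  | .r i => ZMod.stdAddChar ((j : ZMod m) * i) + ZMod.stdAddChar (-((j : ZMod m) * i))
  | .sr _ => 0

/-- The character with a given label. -/
def chr (m : ℕ) [NeZero m] : Lab → DihedralGroup m → ℂ
  | .line j => if j = 0 then trivChar m else dih m j
  | .mid true => chiR m
  | .mid false => chiR' m
  | .sgn => detChar m

variable {m : ℕ} [NeZero m]

theorem detChar_r (i : ZMod m) : detChar m (.r i) = 1 := by
  simp [detChar, reflRep, Matrix.det_fin_two, ← AddChar.map_add_eq_mul]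

theorem detChar_sr (i : ZMod m) : detChar m (.sr i) = -1 := by
  simp [detChar, reflRep, Matrix.det_fin_two, ← AddChar.map_add_eq_mul]

theorem reflChar_eq_dih : reflChar m = dih m 1 := by
  ext (i | i) <;> simp [reflChar, reflRep, dih, Matrix.trace_fin_two]

theorem sum_dihedral {M : Type*} [AddCommMonoid M] (f : DihedralGroup m → M) :
    ∑ w, f w = ∑ i, f (.r i) + ∑ i, f (.sr i) := by
  rw [← Equiv.sum_comp DihedralGroup.equivSum.symm f, Fintype.sum_sum_type]
  rfl

theorem stdAddChar_half (hm : Even m) (i : ZMod m) :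
    (ZMod.stdAddChar (((m / 2 : ℕ) : ZMod m) * i) : ℂ) = (-1) ^ i.val := by
  obtain ⟨h, hh⟩ := hm
  have hm0 : m ≠ 0 := NeZero.ne m
  have h2 : m / 2 = h := by omega
  have h0 : (h : ℂ) ≠ 0 := by
    rw [Nat.cast_ne_zero]; omega
  have e1 : (ZMod.stdAddChar ((h : ℕ) : ZMod m) : ℂ) = -1 := by
    have := ZMod.stdAddChar_coe (N := m) (h : ℤ)
    push_cast at this
    rw [this, ← Complex.exp_pi_mul_I]
    congr 1
    have : (m : ℂ) = h + h := by exact_mod_cast hh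
    rw [this]
    field_simp
    ring
  rw [h2, ← ZMod.natCast_zmod_val i, mul_comm, ← nsmul_eq_mul, AddChar.map_nsmul_eq_pow, e1,
    ZMod.natCast_zmod_val]

theorem chiR_r (hm : Even m) (i : ZMod m) :
    chiR m (.r i) = ZMod.stdAddChar (((m / 2 : ℕ) : ZMod m) * i) := (stdAddChar_half hm i).symm
theorem chiR_sr (hm : Even m) (i : ZMod m) :
    chiR m (.sr i) = ZMod.stdAddChar (((m / 2 : ℕ) : ZMod m) * i) := (stdAddChar_half hm i).symm
theorem chiR'_r (hm : Even m) (i : ZMod m) :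
    chiR' m (.r i) = ZMod.stdAddChar (((m / 2 : ℕ) : ZMod m) * i) := (stdAddChar_half hm i).symm
theorem chiR'_sr (hm : Even m) (i : ZMod m) :
    chiR' m (.sr i) = -ZMod.stdAddChar (((m / 2 : ℕ) : ZMod m) * i) := by
  rw [stdAddChar_half hm]; rfl

theorem half_add_half (hm : Even m) : ((m / 2 : ℕ) : ZMod m) + ((m / 2 : ℕ) : ZMod m) = 0 := by
  have : m / 2 + m / 2 = m := by
    obtain ⟨h, hh⟩ := hm; omega
  rw [← Nat.cast_add, this, ZMod.natCast_self]

theorem neg_half (hm : Even m) : -((m / 2 : ℕ) : ZMod m) = ((m / 2 : ℕ) : ZMod m) :=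
  neg_eq_of_add_eq_zero_left (half_add_half hm)

/-- The two-dimensional representation with character `χ_j`. -/
def dihRep (m : ℕ) [NeZero m] (j : ℕ) : DihedralGroup m →* Matrix (Fin 2) (Fin 2) ℂ where
  toFun
    | .r i => !![ZMod.stdAddChar ((j : ZMod m) * i), 0; 0, ZMod.stdAddChar (-((j : ZMod m) * i))]
    | .sr i => !![0, ZMod.stdAddChar (-((j : ZMod m) * i)); ZMod.stdAddChar ((j : ZMod m) * i), 0]
  map_one' := by
    rw [DihedralGroup.one_def]
    ext i j
    fin_cases i <;> fin_cases j <;> simp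
  map_mul' := by
    rintro (i | i) (k | k) <;>
    · simp only [DihedralGroup.r_mul_r, DihedralGroup.r_mul_sr, DihedralGroup.sr_mul_r,
        DihedralGroup.sr_mul_sr]
      ext a b
      fin_cases a <;> fin_cases b <;>
        simp [Matrix.mul_apply, Fin.sum_univ_two, ← AddChar.map_add_eq_mul, add_comm,
          sub_eq_add_neg, mul_add]

/-- A matrix representation as a representation. -/
def ofMatrix {n : ℕ} (f : DihedralGroup m →* Matrix (Fin n) (Fin n) ℂ) :
    Representation ℂ (DihedralGroup m) (Fin n → ℂ) :=
  ((Matrix.toLinAlgEquiv' : Matrix (Fin n) (Fin n) ℂ ≃ₐ[ℂ] _) :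
    Matrix (Fin n) (Fin n) ℂ →* ((Fin n → ℂ) →ₗ[ℂ] (Fin n → ℂ))).comp f

theorem ofMatrix_apply {n : ℕ} (f : DihedralGroup m →* Matrix (Fin n) (Fin n) ℂ)
    (w : DihedralGroup m) (v : Fin n → ℂ) : ofMatrix f w v = (f w).mulVec v := rfl

theorem character_ofMatrix {n : ℕ} (f : DihedralGroup m →* Matrix (Fin n) (Fin n) ℂ) :
    (ofMatrix f).character = fun w => (f w).trace := by
  ext w
  exact Matrix.trace_toLin'_eq (f w)

theorem two_mul_natCast_ne_zero {j : ℕ} (h0 : j ≠ 0) (hj : 2 * j < m) :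
    (j : ZMod m) + j ≠ 0 := by
  rw [← Nat.cast_add, Ne, ZMod.natCast_eq_zero_iff]
  intro h
  have := Nat.le_of_dvd (by omega) h
  omega

/-- The rotation by one step is diagonal with two distinct eigenvalues, since 2j is nonzero modulo
m, and the reflection interchanges the eigenlines. A nonzero invariant subspace therefore contains
one eigenvector and its mirror image. -/
theorem isIrreducible_dihRep {j : ℕ} (h0 : j ≠ 0) (hj : 2 * j < m) :
    (ofMatrix (dihRep m j)).IsIrreducible := by
  have key : ∀ W : Subrepresentation (ofMatrix (dihRep m j)), W ≠ ⊥ → W = ⊤ := by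
    intro W hW
    have hex : ∃ v ∈ W.toSubmodule, v ≠ 0 := by
      by_contra! hcon
      apply hW
      apply Subrepresentation.toSubmodule_injective
      exact (Submodule.eq_bot_iff _).2 hcon
    obtain ⟨v, hv, hv0⟩ := hex
    have hr := W.apply_mem_toSubmodule (.r 1) hv
    have hs : ∀ u ∈ W.toSubmodule, ![u 1, u 0] ∈ W.toSubmodule := by
      intro u hu
      convert W.apply_mem_toSubmodule (.sr 0) hu using 1
      ext a
      fin_cases a <;> simp [ofMatrix_apply, dihRep, Matrix.mulVec, dotProduct]
    set z : ℂ := ZMod.stdAddChar (j : ZMod m) with hz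
    set z' : ℂ := ZMod.stdAddChar (-(j : ZMod m)) with hz'
    have hzz : z ≠ z' := by
      intro h
      have := ZMod.injective_stdAddChar h
      exact two_mul_natCast_ne_zero h0 hj (by nth_rewrite 1 [this]; simp)
    have hrv : ofMatrix (dihRep m j) (.r 1) v = ![z * v 0, z' * v 1] := by
      ext a
      fin_cases a <;> simp [ofMatrix_apply, dihRep, Matrix.mulVec, dotProduct, hz, hz']
    rw [hrv] at hr
    have h1 : ∃ u ∈ W.toSubmodule, u 0 ≠ 0 ∧ u 1 = 0 := by
      by_cases hv1 : v 0 = 0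
      · have hv1' : v 1 ≠ 0 := by
          intro h
          apply hv0
          ext a
          fin_cases a <;> simp [hv1, h]
        exact ⟨_, hs v hv, by simpa using hv1', by simpa using hv1⟩
      · refine ⟨![z * v 0, z' * v 1] - z' • v,
          Submodule.sub_mem _ hr (Submodule.smul_mem _ _ hv), ?_, by simp⟩
        simp only [Pi.sub_apply, Matrix.cons_val_zero, Pi.smul_apply, smul_eq_mul, ← sub_mul]
        exact mul_ne_zero (sub_ne_zero.2 hzz) hv1
    obtain ⟨u, hu, hu0, hu1⟩ := h1
    have hu' := hs u hu
    apply Subrepresentation.toSubmodule_injective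
    rw [show (⊤ : Subrepresentation (ofMatrix (dihRep m j))).toSubmodule = ⊤ from rfl]
    rw [Submodule.eq_top_iff']
    intro x
    have : x = (x 0 / u 0) • u + (x 1 / u 0) • ![u 1, u 0] := by
      ext a
      fin_cases a <;> simp [hu1] <;> field_simp
    rw [this]
    exact Submodule.add_mem _ (Submodule.smul_mem _ _ hu) (Submodule.smul_mem _ _ hu')
  exact { exists_pair_ne := ⟨⊥, ⊤, fun h => by
            have h' := congrArg Subrepresentation.toSubmodule h
            exact bot_ne_top (α := Submodule ℂ (Fin 2 → ℂ)) h'⟩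
          eq_bot_or_eq_top := fun W => or_iff_not_imp_left.2 (key W) }

theorem dih_mem_Irr {j : ℕ} (h0 : j ≠ 0) (hj : 2 * j < m) : dih m j ∈ Irr m := by
  refine ⟨2, ofMatrix (dihRep m j), isIrreducible_dihRep h0 hj, ?_⟩
  rw [character_ofMatrix]
  ext (i | i) <;> simp [dihRep, dih, Matrix.trace_fin_two]

theorem linear_mem_Irr (f : DihedralGroup m →* ℂ) : (f : DihedralGroup m → ℂ) ∈ Irr m := by
  let g : DihedralGroup m →* Matrix (Fin 1) (Fin 1) ℂ :=
    ((Matrix.scalar (Fin 1) : ℂ →+* Matrix (Fin 1) (Fin 1) ℂ) : ℂ →* _).comp f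
  refine ⟨1, ofMatrix g, ?_, ?_⟩
  · have key : ∀ W : Subrepresentation (ofMatrix g), W ≠ ⊥ → W = ⊤ := by
      intro W hW
      have hex : ∃ v ∈ W.toSubmodule, v ≠ 0 := by
        by_contra! hcon
        apply hW
        apply Subrepresentation.toSubmodule_injective
        exact (Submodule.eq_bot_iff _).2 hcon
      obtain ⟨v, hv, hv0⟩ := hex
      have hv1 : v 0 ≠ 0 := by
        intro h
        apply hv0
        ext a
        fin_cases a
        simpa using h
      apply Subrepresentation.toSubmodule_injective
      rw [show (⊤ : Subrepresentation (ofMatrix g)).toSubmodule = ⊤ from rfl]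
      rw [Submodule.eq_top_iff']
      intro x
      have : x = (x 0 / v 0) • v := by
        ext a
        fin_cases a
        simp [hv1]
      rw [this]
      exact Submodule.smul_mem _ _ hv
    exact { exists_pair_ne := ⟨⊥, ⊤, fun h => by
              have h' := congrArg Subrepresentation.toSubmodule h
              exact bot_ne_top (α := Submodule ℂ (Fin 1 → ℂ)) h'⟩
            eq_bot_or_eq_top := fun W => or_iff_not_imp_left.2 (key W) }
  · rw [character_ofMatrix]
    ext w
    simp [g, Matrix.trace]

theorem chr_mem_Irr {a : Lab} (ha : a.Valid m) : chr m a ∈ Irr m := by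
  cases a with
  | line j =>
    by_cases h : j = 0
    · subst h
      exact linear_mem_Irr 1
    · simpa [chr, h] using dih_mem_Irr h ha
  | sgn => exact linear_mem_Irr ((Matrix.detMonoidHom).comp (reflRep m))
  | mid s =>
    have hm : Even m := ha
    have hh : ∀ x, -(((m / 2 : ℕ) : ZMod m) * x) = ((m / 2 : ℕ) : ZMod m) * x := fun x => by
      rw [← neg_mul, neg_half hm]
    cases s
    · refine linear_mem_Irr (m := m) { toFun := chiR' m, map_one' := ?_, map_mul' := ?_ }
      · rw [DihedralGroup.one_def, chiR'_r hm]; simp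
      · rintro (i | i) (k | k) <;>
          simp only [DihedralGroup.r_mul_r, DihedralGroup.r_mul_sr, DihedralGroup.sr_mul_r,
            DihedralGroup.sr_mul_sr, chiR'_r hm, chiR'_sr hm, mul_add, mul_neg,
            AddChar.map_add_eq_mul, sub_eq_add_neg, hh] <;> ring
    · refine linear_mem_Irr (m := m) { toFun := chiR m, map_one' := ?_, map_mul' := ?_ }
      · rw [DihedralGroup.one_def, chiR_r hm]; simp
      · rintro (i | i) (k | k) <;>
          simp only [DihedralGroup.r_mul_r, DihedralGroup.r_mul_sr, DihedralGroup.sr_mul_r,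
            DihedralGroup.sr_mul_sr, chiR_r hm, chiR_sr hm, mul_add, mul_neg,
            AddChar.map_add_eq_mul, sub_eq_add_neg, hh] <;> ring

theorem sum_mul_inv_of_ne {χ χ' : DihedralGroup m → ℂ} (hχ : χ ∈ Irr m) (hχ' : χ' ∈ Irr m)
    (hne : χ ≠ χ') : ∑ w, χ w * χ' w⁻¹ = 0 := by
  classical
  have hcard : (Nat.card (DihedralGroup m) : ℂ) ≠ 0 := by
    rw [Nat.cast_ne_zero]
    exact Nat.card_pos.ne'
  have : Invertible (Nat.card (DihedralGroup m) : ℂ) := invertibleOfNonzero hcard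
  obtain ⟨n, ρ, hρ, rfl⟩ := hχ
  obtain ⟨n', σ, hσ, rfl⟩ := hχ'
  have h := Representation.char_orthonormal ρ σ
  rw [if_neg (fun h' => hne (Representation.char_iso h'.some).symm)] at h
  exact (mul_eq_zero.1 h).resolve_left (inv_ne_zero hcard)

/-- Completeness by Fourier inversion. The functions `dih m j` with j = 0 and j = m/2 are sums of
two linear characters, so an unlabelled irreducible character is orthogonal to all `dih m j`. Its
restriction to the rotations is even, hence has zero Fourier transform, and its degree would be 0.
-/
theorem exists_label {χ : DihedralGroup m → ℂ} (hχ : χ ∈ Irr m) :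
    ∃ a : Lab, a.Valid m ∧ chr m a = χ := by
  by_contra! hcon
  have horth : ∀ a : Lab, a.Valid m → ∑ w, χ w * chr m a w⁻¹ = 0 := fun a ha =>
    sum_mul_inv_of_ne hχ (chr_mem_Irr ha) (hcon a ha).symm
  have hm0 : 0 < m := Nat.pos_of_ne_zero (NeZero.ne m)
  -- orthogonality to all `dih m j`
  have hd : ∀ j : ℕ, 2 * j ≤ m → ∑ w, χ w * dih m j w⁻¹ = 0 := by
    intro j hj
    by_cases h0 : j = 0
    · subst h0
      have e : ∀ w, dih m 0 w = chr m (.line 0) w + chr m .sgn w := by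
        rintro (i | i)
        · simp [dih, chr, detChar_r, trivChar]
        · simp [dih, chr, detChar_sr, trivChar]
      simp only [e, mul_add, Finset.sum_add_distrib]
      rw [horth (.line 0) hm0, horth .sgn trivial, add_zero]
    rcases hj.lt_or_eq with hj | hj
    · simpa [chr, h0] using horth (.line j) hj
    · have hev : Even m := ⟨j, by omega⟩
      have hj' : m / 2 = j := by omega
      have e : ∀ w, dih m j w = chr m (.mid true) w + chr m (.mid false) w := by
        rintro (i | i)
        · simp only [dih, chr, chiR_r hev, chiR'_r hev]
          rw [hj', ← neg_mul, ← hj', neg_half hev]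
        · simp only [dih, chr, chiR_sr hev, chiR'_sr hev]; ring
      simp only [e, mul_add, Finset.sum_add_distrib]
      rw [horth (.mid true) hev, horth (.mid false) hev, add_zero]
  obtain ⟨n, ρ, hρ, rfl⟩ := hχ
  have hn : ρ.character 1 ≠ 0 := by
    rw [Representation.char_one]
    simp only [Module.finrank_fintype_fun_eq_card, Fintype.card_fin, ne_eq, Nat.cast_eq_zero]
    rintro rfl
    have : (⊥ : Subrepresentation ρ) = ⊤ := by
      apply Subrepresentation.toSubmodule_injective
      exact Subsingleton.elim _ _
    exact bot_ne_top this
  have hsymm : ∀ i : ZMod m, ρ.character (.r (-i)) = ρ.character (.r i) := by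
    intro i
    have := Representation.char_conj ρ (.r i) (.sr 0)
    simpa using this
  have hF : ∀ k : ZMod m, ∑ i, ρ.character (.r i) * ZMod.stdAddChar (k * i) = 0 := by
    have hF' : ∀ j : ℕ, 2 * j ≤ m →
        ∑ i, ρ.character (.r i) * ZMod.stdAddChar ((j : ZMod m) * i) = 0 := by
      intro j hj
      have h := hd j hj
      rw [sum_dihedral] at h
      simp only [DihedralGroup.inv_r, DihedralGroup.inv_sr, dih, mul_zero, Finset.sum_const_zero,
        add_zero, mul_add, Finset.sum_add_distrib, mul_neg, neg_neg] at h
      rw [← Equiv.sum_comp (Equiv.neg _)] at h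
      simp only [Equiv.neg_apply, hsymm, mul_neg, neg_neg] at h
      linear_combination h / 2
    intro k
    by_cases hk : 2 * k.val ≤ m
    · simpa using hF' k.val hk
    · have h := hF' (m - k.val) (by omega)
      rw [Nat.cast_sub (ZMod.val_lt k).le, ZMod.natCast_self, ZMod.natCast_zmod_val, zero_sub,
        ← Equiv.sum_comp (Equiv.neg _)] at h
      simpa [hsymm] using h
  have hz : ∑ k : ZMod m, ∑ i : ZMod m, ρ.character (.r i) * ZMod.stdAddChar (k * i) =
      m * ρ.character (.r 0) := by
    rw [Finset.sum_comm]
    simp_rw [← Finset.mul_sum]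
    simp_rw [AddChar.sum_mulShift _ (ZMod.isPrimitive_stdAddChar m)]
    simp [mul_comm]
  simp only [hF, Finset.sum_const_zero] at hz
  have := hz.symm
  rw [mul_eq_zero] at this
  rcases this with h | h
  · exact (Nat.cast_ne_zero.2 hm0.ne') h
  · exact hn h

/-! ### Fake degrees -/

theorem ofPoly_X : ofPoly X = q := RatFunc.algebraMap_X

theorem ofPoly_C (z : ℂ) : ofPoly (C z) = RatFunc.C z := RatFunc.algebraMap_C z

theorem ofPoly_mul (a b : ℂ[X]) : ofPoly (a * b) = ofPoly a * ofPoly b := map_mul _ _ _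
theorem ofPoly_add (a b : ℂ[X]) : ofPoly (a + b) = ofPoly a + ofPoly b := map_add _ _ _
theorem ofPoly_sub (a b : ℂ[X]) : ofPoly (a - b) = ofPoly a - ofPoly b := map_sub _ _ _
theorem ofPoly_neg (a : ℂ[X]) : ofPoly (-a) = -ofPoly a := map_neg _ _
theorem ofPoly_pow (a : ℂ[X]) (n : ℕ) : ofPoly (a ^ n) = ofPoly a ^ n := map_pow _ _ _
theorem ofPoly_one : ofPoly 1 = 1 := map_one _
theorem ofPoly_zero : ofPoly 0 = 0 := map_zero _
theorem ofPoly_injective : Function.Injective ofPoly :=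
  IsFractionRing.injective ℂ[X] (RatFunc ℂ)

theorem q_ne_zero : q ≠ 0 := RatFunc.X_ne_zero

theorem q_sub_C_ne_zero (z : ℂ) : q - RatFunc.C z ≠ 0 := by
  rw [← ofPoly_X, ← ofPoly_C, ← ofPoly_sub]
  intro h
  exact X_sub_C_ne_zero z (ofPoly_injective (h.trans ofPoly_zero.symm))

theorem q_pow_sub_one_ne_zero {n : ℕ} (hn : n ≠ 0) : q ^ n - 1 ≠ 0 := by
  rw [← ofPoly_X, ← ofPoly_pow, ← ofPoly_one, ← ofPoly_sub]
  intro h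
  exact X_pow_sub_C_ne_zero (Nat.pos_of_ne_zero hn) (1 : ℂ)
    (by simpa using ofPoly_injective (h.trans ofPoly_zero.symm))

/-- The values of the characters of the rotation subgroup as constants of `ℂ(q)`. -/
def ev (i : ZMod m) : RatFunc ℂ := RatFunc.C (ZMod.stdAddChar i)

theorem ev_add (i j : ZMod m) : ev (i + j) = ev i * ev j := by
  simp [ev, AddChar.map_add_eq_mul]

theorem ev_zero : ev (0 : ZMod m) = 1 := by simp [ev]

theorem ev_mul_ev_neg (i : ZMod m) : ev i * ev (-i) = 1 := by
  rw [← ev_add, add_neg_cancel, ev_zero]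

theorem ev_natCast_mul (n : ℕ) (i : ZMod m) : ev ((n : ZMod m) * i) = ev i ^ n := by
  induction n with
  | zero => simp [ev_zero]
  | succ n ih => rw [pow_succ, ← ih, ← ev_add]; congr 1; push_cast; ring

theorem ev_pow (i : ZMod m) : ev i ^ m = 1 := by
  rw [← ev_natCast_mul, ZMod.natCast_self, zero_mul, ev_zero]

theorem q_sub_ev_ne_zero (i : ZMod m) : q - ev i ≠ 0 := q_sub_C_ne_zero _

theorem sum_ev_mul (k : ZMod m) : ∑ i, ev (k * i) = if k = 0 then (m : RatFunc ℂ) else 0 := by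
  have := AddChar.sum_mulShift k (ZMod.isPrimitive_stdAddChar m)
  simp only [ev]
  rw [← map_sum, show ∑ i, ZMod.stdAddChar (k * i) = ∑ i, (ZMod.stdAddChar (i * k) : ℂ) by
    simp [mul_comm], this]
  split_ifs <;> simp

/-- ζ^i is an m-th root of unity, so the cofactor of q - ζ^i in q^m - 1 is a geometric sum. -/
theorem inv_q_sub_ev (i : ZMod m) :
    (q - ev i)⁻¹ = (∑ s ∈ Finset.range m, q ^ s * ev (-(((s + 1 : ℕ) : ZMod m) * i))) / (q ^ m - 1) := by
  have hq : q ^ m - 1 ≠ 0 := q_pow_sub_one_ne_zero (NeZero.ne m)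
  rw [inv_eq_one_div, div_eq_div_iff (q_sub_ev_ne_zero i) hq, one_mul]
  have hg := (Commute.all q (ev i)).geom_sum₂_mul m
  rw [ev_pow] at hg
  rw [← hg]
  congr 1
  refine Finset.sum_congr rfl fun s hs => ?_
  rw [Finset.mem_range] at hs
  congr 1
  have h1 : ev i ^ (m - 1 - s) * ev i ^ (s + 1) = 1 := by
    rw [← pow_add, show m - 1 - s + (s + 1) = m by omega, ev_pow]
  have h2 := ev_mul_ev_neg (((s + 1 : ℕ) : ZMod m) * i)
  rw [ev_natCast_mul] at h2
  have h3 : ev i ^ (s + 1) ≠ 0 := right_ne_zero_of_mul_eq_one h1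
  exact mul_right_cancel₀ h3 (by rw [h1, mul_comm, h2])

theorem sum_ev_div (k : ℕ) (hk : k < m) :
    ∑ i : ZMod m, ev (((k + 1 : ℕ) : ZMod m) * i) / (q - ev i) = m * q ^ k / (q ^ m - 1) := by
  simp only [div_eq_mul_inv (ev _), inv_q_sub_ev]
  simp only [mul_div_assoc', ← Finset.sum_div]
  congr 1
  simp only [Finset.mul_sum]
  rw [Finset.sum_comm, Finset.sum_eq_single k]
  · have : ∀ i : ZMod m, ev (((k + 1 : ℕ) : ZMod m) * i) * (q ^ k * ev (-(((k + 1 : ℕ) : ZMod m) * i))) = q ^ k := by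
      intro i
      linear_combination q ^ k * ev_mul_ev_neg (((k + 1 : ℕ) : ZMod m) * i)
    rw [Finset.sum_congr rfl fun i _ => this i]
    simp
  · intro s hs hsk
    rw [Finset.mem_range] at hs
    have : ∀ i : ZMod m, ev (((k + 1 : ℕ) : ZMod m) * i) * (q ^ s * ev (-(((s + 1 : ℕ) : ZMod m) * i))) =
        q ^ s * ev (((k : ZMod m) - (s : ZMod m)) * i) := by
      intro i
      rw [mul_left_comm, ← ev_add]
      congr 2
      push_cast; ring
    rw [Finset.sum_congr rfl fun i _ => this i, ← Finset.mul_sum, sum_ev_mul, if_neg, mul_zero]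
    rw [sub_eq_zero]
    intro h
    rw [ZMod.natCast_eq_natCast_iff'] at h
    rw [Nat.mod_eq_of_lt hk, Nat.mod_eq_of_lt hs] at h
    exact hsk h.symm
  · intro h; exact absurd (Finset.mem_range.2 hk) h

/-- Partial fractions: (q² - 1)/((q - z)(q - z⁻¹)) = 1 + z/(q - z) + z⁻¹/(q - z⁻¹), after which
orthogonality of the characters of the rotation subgroup evaluates each sum. -/
theorem sum_ev_div_charpoly (hm : 3 ≤ m) (j : ℕ) (hj : j < m) :
    ∑ i : ZMod m, ev ((j : ZMod m) * i) / ((q - ev i) * (q - ev (-i))) =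
      m * (q ^ j + q ^ (m - j)) / ((q ^ 2 - 1) * (q ^ m - 1)) := by
  have hq : q ^ m - 1 ≠ 0 := q_pow_sub_one_ne_zero (NeZero.ne m)
  have hq2 : q ^ 2 - 1 ≠ 0 := q_pow_sub_one_ne_zero two_ne_zero
  have key : ∀ i : ZMod m, (q ^ 2 - 1) * (ev ((j : ZMod m) * i) / ((q - ev i) * (q - ev (-i)))) =
      ev ((j : ZMod m) * i) + ev (((j + 1 : ℕ) : ZMod m) * i) / (q - ev i) +
        ev ((1 - (j : ZMod m)) * (-i)) / (q - ev (-i)) := by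
    intro i
    have h1 := q_sub_ev_ne_zero i
    have h2 := q_sub_ev_ne_zero (-i)
    have h3 := ev_mul_ev_neg i
    rw [show ((j + 1 : ℕ) : ZMod m) * i = (j : ZMod m) * i + i by push_cast; ring,
      show (1 - (j : ZMod m)) * (-i) = (j : ZMod m) * i + (-i) by ring, ev_add, ev_add]
    field_simp
    linear_combination ev ((j : ZMod m) * i) * h3
  have hS : (q ^ 2 - 1) * ∑ i : ZMod m, ev ((j : ZMod m) * i) / ((q - ev i) * (q - ev (-i))) =
      m * (q ^ j + q ^ (m - j)) / (q ^ m - 1) := by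
    rw [Finset.mul_sum, Finset.sum_congr rfl fun i _ => key i, Finset.sum_add_distrib,
      Finset.sum_add_distrib, sum_ev_mul, sum_ev_div j hj]
    have hneg := Equiv.sum_comp (Equiv.neg (ZMod m))
      fun i => ev ((1 - (j : ZMod m)) * i) / (q - ev i)
    simp only [Equiv.neg_apply] at hneg
    rw [hneg]
    -- For j = 0 the first sum equals m and both fractions carry exponent 1. Otherwise the first sum
    -- vanishes and the exponent 1 - j is represented by m - j + 1.
    by_cases h0 : j = 0
    · subst h0
      have := sum_ev_div (m := m) 0 (by omega)
      simp only [zero_add, Nat.cast_one, one_mul, pow_zero, mul_one] at this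
      simp only [Nat.cast_zero, if_true, pow_zero, mul_one, sub_zero, one_mul, this, Nat.sub_zero]
      field_simp
      ring
    · rw [if_neg]
      · have := sum_ev_div (m := m) (m - j) (by omega)
        have hc : ((m - j + 1 : ℕ) : ZMod m) = 1 - (j : ZMod m) := by
          rw [Nat.cast_add, Nat.cast_sub hj.le]; simp; ring
        rw [hc] at this
        rw [this]
        field_simp
        ring
      · rw [ZMod.natCast_eq_zero_iff]
        exact Nat.not_dvd_of_pos_of_lt (by omega) hj
  rw [eq_div_iff (mul_ne_zero hq2 hq)]
  rw [eq_div_iff hq] at hS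
  linear_combination hS

theorem ofPoly_charpoly_r (i : ZMod m) :
    ofPoly (reflRep m (.r i)).charpoly = (q - ev i) * (q - ev (-i)) := by
  rw [show reflRep m (.r i) = !![ZMod.stdAddChar i, 0; 0, ZMod.stdAddChar (-i)] from rfl,
    Matrix.charpoly_fin_two]
  simp only [Matrix.trace_fin_two, Matrix.det_fin_two, Matrix.of_apply, Matrix.cons_val',
    Matrix.cons_val_zero, Matrix.cons_val_one, Matrix.cons_val_fin_one, ofPoly_add, ofPoly_sub,
    ofPoly_mul, ofPoly_C, ofPoly_pow, ofPoly_X, ev, map_add, map_sub, map_mul, map_zero, ofPoly_zero, mul_zero, sub_zero]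
  ring

theorem ofPoly_charpoly_sr (i : ZMod m) : ofPoly (reflRep m (.sr i)).charpoly = q ^ 2 - 1 := by
  rw [Matrix.charpoly_fin_two,
    show (reflRep m (.sr i)).det = -1 from detChar_sr i]
  simp [Matrix.trace_fin_two, reflRep, ofPoly_add, ofPoly_sub, ofPoly_pow, ofPoly_X, ofPoly_C,
    ofPoly_zero, ofPoly_one, ofPoly_neg]
  ring

/-- The function `i ↦ ζ^(ij) + ζ^(-ij)`. -/
def cosSum (j : ℕ) (i : ZMod m) : ℂ :=
  ZMod.stdAddChar ((j : ZMod m) * i) + ZMod.stdAddChar (-((j : ZMod m) * i))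

theorem sum_cosSum (hm : 3 ≤ m) (j : ℕ) (hj : j < m) :
    ∑ i : ZMod m, RatFunc.C (cosSum j i) / ((q - ev i) * (q - ev (-i))) =
      2 * m * (q ^ j + q ^ (m - j)) / ((q ^ 2 - 1) * (q ^ m - 1)) := by
  have h := sum_ev_div_charpoly hm j hj
  have h' := h
  rw [← Equiv.sum_comp (Equiv.neg (ZMod m))] at h'
  simp only [Equiv.neg_apply, neg_neg, mul_neg] at h'
  simp only [cosSum, map_add, add_div, Finset.sum_add_distrib]
  simp only [ev] at h h' ⊢
  rw [h]
  simp only [mul_comm (q - RatFunc.C (ZMod.stdAddChar (-_)))] at h'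
  rw [h']
  ring

/-- All reflections have characteristic polynomial q² - 1, so only the sum of f over them matters.
Every product of characters needed below restricts to the rotations as a combination of at most two
cosine sums. -/
theorem fakeDegree_eq (hm : 3 ≤ m) {f : DihedralGroup m → ℂ} {x y t : ℂ} {j k : ℕ} (hj : j < m)
    (hk : k < m) (hr : ∀ i, f (.r i) = x * cosSum j i + y * cosSum k i)
    (hs : ∑ i, f (.sr i) = t * m) :
    fakeDegree m f = RatFunc.C x * (q ^ j + q ^ (m - j)) + RatFunc.C y * (q ^ k + q ^ (m - k)) -
      RatFunc.C t * (q ^ m - 1) / 2 := by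
  have hq : q ^ m - 1 ≠ 0 := q_pow_sub_one_ne_zero (NeZero.ne m)
  have hq2 : q ^ 2 - 1 ≠ 0 := q_pow_sub_one_ne_zero two_ne_zero
  have hq1 : q - 1 ≠ 0 := by simpa using q_pow_sub_one_ne_zero one_ne_zero
  have hm0 : (m : RatFunc ℂ) ≠ 0 := Nat.cast_ne_zero.2 (NeZero.ne m)
  have hrot : ∑ i : ZMod m, RatFunc.C ((reflRep m (.r i)).det * f (.r i)) /
      ofPoly (reflRep m (.r i)).charpoly =
      RatFunc.C x * (2 * m * (q ^ j + q ^ (m - j)) / ((q ^ 2 - 1) * (q ^ m - 1))) +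
      RatFunc.C y * (2 * m * (q ^ k + q ^ (m - k)) / ((q ^ 2 - 1) * (q ^ m - 1))) := by
    rw [← sum_cosSum hm j hj, ← sum_cosSum hm k hk, Finset.mul_sum, Finset.mul_sum,
      ← Finset.sum_add_distrib]
    refine Finset.sum_congr rfl fun i _ => ?_
    rw [ofPoly_charpoly_r, show (reflRep m (.r i)).det = 1 from detChar_r i, hr]
    simp only [map_add, map_mul, one_mul]
    ring
  have href : ∑ i : ZMod m, RatFunc.C ((reflRep m (.sr i)).det * f (.sr i)) /
      ofPoly (reflRep m (.sr i)).charpoly = -(RatFunc.C t * m) / (q ^ 2 - 1) := by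
    simp only [ofPoly_charpoly_sr, show ∀ i, (reflRep m (.sr i)).det = -1 from detChar_sr]
    rw [← Finset.sum_div, ← map_sum, ← Finset.mul_sum, hs]
    simp
  have hcard : (Nat.card (DihedralGroup m) : RatFunc ℂ) = 2 * m := by
    rw [DihedralGroup.nat_card]; push_cast; ring
  rw [fakeDegree, sum_dihedral, hrot, href, hcard, poincare]
  field_simp
  ring

/-- The fake degree of the character with a given label. -/
def Rdeg (m : ℕ) : Lab → RatFunc ℂ
  | .line j => if j = 0 then 1 else q ^ j + q ^ (m - j)
  | .mid _ => q ^ (m / 2)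
  | .sgn => q ^ m

/-- The value of `b`. -/
def Lab.pos (m : ℕ) : Lab → ℕ
  | .line j => j
  | .mid _ => m / 2
  | .sgn => m

/-- The kernel with `Ω = R Rᵗ + (q^m - 1) K`. -/
def Ker (m : ℕ) : Lab → Lab → RatFunc ℂ
  | .line i, .line j => q ^ (i + j) + q ^ (m - (max i j - min i j))
  | .line i, .mid _ => q ^ (i + m / 2)
  | .mid _, .line i => q ^ (i + m / 2)
  | .mid s, .mid t => if s = t then q ^ m else 0
  | .sgn, _ => 0
  | .mid _, .sgn => 0
  | .line _, .sgn => 0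

theorem cosSum_zero (i : ZMod m) : cosSum 0 i = 2 := by
  simp [cosSum]; norm_num

theorem cosSum_half (hm : Even m) (i : ZMod m) : cosSum (m / 2) i =
    2 * ZMod.stdAddChar (((m / 2 : ℕ) : ZMod m) * i) := by
  rw [cosSum, ← neg_mul, neg_half hm, two_mul]

theorem cosSum_mul (j k : ℕ) (i : ZMod m) : cosSum j i * cosSum k i =
    cosSum (j + k) i + cosSum (max j k - min j k) i := by
  have key : ∀ j k : ℕ, k ≤ j → cosSum j i * cosSum k i =
      cosSum (j + k) i + cosSum (j - k) i := by
    intro j k h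
    simp only [cosSum]
    rw [Nat.cast_add, Nat.cast_sub h]
    simp only [add_mul, sub_mul, neg_add, neg_sub, mul_add, ← AddChar.map_add_eq_mul,
      sub_eq_add_neg]
    rw [add_comm (-(↑j * i)) (↑k * i)]
    ring
  rcases le_total k j with h | h
  · rw [max_eq_left h, min_eq_right h, key j k h]
  · rw [max_eq_right h, min_eq_left h, mul_comm, key k j h, add_comm j k]

theorem half_mul_cosSum (hm : Even m) (j : ℕ) (i : ZMod m) :
    ZMod.stdAddChar (((m / 2 : ℕ) : ZMod m) * i) * cosSum j i = cosSum (j + m / 2) i := by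
  simp only [cosSum, Nat.cast_add, add_mul, neg_add, mul_add, AddChar.map_add_eq_mul]
  rw [show -(((m / 2 : ℕ) : ZMod m) * i) = ((m / 2 : ℕ) : ZMod m) * i by
    rw [← neg_mul, neg_half hm]]
  ring

theorem sum_half (hm : 3 ≤ m) (he : Even m) :
    ∑ i : ZMod m, (ZMod.stdAddChar (((m / 2 : ℕ) : ZMod m) * i) : ℂ) = 0 := by
  have := AddChar.sum_mulShift (((m / 2 : ℕ) : ZMod m)) (ZMod.isPrimitive_stdAddChar m)
  rw [if_neg] at this
  · simpa [mul_comm] using this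
  · rw [ZMod.natCast_eq_zero_iff]
    exact Nat.not_dvd_of_pos_of_lt (by omega) (by omega)

theorem dih_r (j : ℕ) (i : ZMod m) : dih m j (.r i) = cosSum j i := rfl
theorem dih_sr (j : ℕ) (i : ZMod m) : dih m j (.sr i) = 0 := rfl

theorem C_half : RatFunc.C (1 / 2 : ℂ) = 1 / 2 := by
  rw [map_div₀, map_one, show (2 : ℂ) = ((2 : ℕ) : ℂ) by norm_num, map_natCast]
  norm_num

theorem sub_half (he : Even m) : m - m / 2 = m / 2 := by
  obtain ⟨h, hh⟩ := he; omega

theorem fakeDegree_chr (hm : 3 ≤ m) {a : Lab} (ha : a.Valid m) :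
    fakeDegree m (chr m a) = Rdeg m a := by
  cases a with
  | line j =>
    have hj : 2 * j < m := ha
    by_cases h0 : j = 0
    · subst h0
      rw [fakeDegree_eq hm (x := 1 / 2) (y := 0) (t := 1) (j := 0) (k := 0) (by omega) (by omega)]
      · simp only [C_half, map_zero, map_one, Rdeg, if_true]; simp; ring
      · intro i; simp [chr, trivChar, cosSum_zero]
      · simp [chr, trivChar]
    · rw [fakeDegree_eq hm (x := 1) (y := 0) (t := 0) (j := j) (k := 0) (by omega) (by omega)]
      · simp [Rdeg, h0]
      · intro i; simp [chr, h0, dih_r]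
      · simp [chr, h0, dih_sr]
  | mid s =>
    have he : Even m := ha
    have h1 : m - m / 2 = m / 2 := sub_half he
    rw [fakeDegree_eq hm (x := 1 / 2) (y := 0) (t := 0) (j := m / 2) (k := 0) (by omega)
      (by omega)]
    · simp only [C_half, map_zero, Rdeg, h1]; simp; ring
    · intro i; cases s <;> simp [chr, chiR_r he, chiR'_r he, cosSum_half he]
    · cases s <;> simp [chr, chiR_sr he, chiR'_sr he, sum_half hm he]
  | sgn =>
    rw [fakeDegree_eq hm (x := 1 / 2) (y := 0) (t := -1) (j := 0) (k := 0) (by omega) (by omega)]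
    · simp only [C_half, map_zero, map_one, map_neg, Rdeg]; simp; ring
    · intro i; simp [chr, detChar_r, cosSum_zero]
    · simp [chr, detChar_sr]

theorem natTrailingDegree_X_pow_add {i j : ℕ} (h : i < j) :
    (X ^ i + X ^ j : ℂ[X]).natTrailingDegree = i := by
  have hc : (X ^ i + X ^ j : ℂ[X]).coeff i ≠ 0 := by
    simp [coeff_X_pow, h.ne]
  refine le_antisymm (natTrailingDegree_le_of_ne_zero hc) ?_
  refine le_natTrailingDegree (fun h0 => hc (by rw [h0]; simp)) ?_
  intro n hn
  simp [coeff_X_pow, hn.ne, (hn.trans h).ne]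

theorem qOrder_ofPoly (p : ℂ[X]) : qOrder (ofPoly p) = p.natTrailingDegree := by
  rw [qOrder, ofPoly, RatFunc.num_algebraMap]

theorem b_chr (hm : 3 ≤ m) {a : Lab} (ha : a.Valid m) : b (chr m a) = a.pos m := by
  rw [b, fakeDegree_chr hm ha]
  cases a with
  | line j =>
    have hj : 2 * j < m := ha
    simp only [Rdeg, Lab.pos]
    split_ifs with h
    · rw [← ofPoly_one, qOrder_ofPoly, natTrailingDegree_one, h]
    · rw [← ofPoly_X, ← ofPoly_pow, ← ofPoly_pow, ← ofPoly_add, qOrder_ofPoly,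
        natTrailingDegree_X_pow_add (by omega)]
  | mid s => simp only [Rdeg, Lab.pos, ← ofPoly_X, ← ofPoly_pow, qOrder_ofPoly,
      natTrailingDegree_X_pow]
  | sgn => simp only [Rdeg, Lab.pos, ← ofPoly_X, ← ofPoly_pow, qOrder_ofPoly,
      natTrailingDegree_X_pow]

/-- The value of b separates all labels except the two middle ones, which differ at a simple
reflection. -/
theorem chr_injective (hm : 3 ≤ m) {a a' : Lab} (ha : a.Valid m) (ha' : a'.Valid m)
    (h : chr m a = chr m a') : a = a' := by
  have hb : a.pos m = a'.pos m := by rw [← b_chr hm ha, h, b_chr hm ha']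
  cases a <;> cases a' <;> simp only [Lab.pos, Lab.Valid] at hb ha ha'
  case mid.mid s t =>
    have h1 := congrFun h (.sr 0)
    rcases s <;> rcases t <;> first
      | rfl
      | (exfalso
         simp only [chr, chiR_sr ha, chiR'_sr ha, mul_zero, AddChar.map_zero_eq_one] at h1
         norm_num at h1)
  all_goals first
    | (rw [hb]; done)
    | (exfalso; simp only [Nat.even_iff] at ha ha'; omega)
    | (exfalso; omega)
    | rfl

/-- Tensor products are decomposed on the rotations by 2cos·2cos = sum of two cosine terms; what
remains is an identity between powers of q. The rank one part R Rᵗ is later the contribution of the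
class of ε. -/
theorem Omega_chr (hm : 3 ≤ m) {a a' : Lab} (ha : a.Valid m) (ha' : a'.Valid m) :
    Omega m ⟨chr m a, chr_mem_Irr ha⟩ ⟨chr m a', chr_mem_Irr ha'⟩ =
      Rdeg m a * Rdeg m a' + (q ^ m - 1) * Ker m a a' := by
  -- it is enough to treat ordered pairs
  have key : ∀ a a' : Lab, a.Valid m → a'.Valid m → (∀ i s, a = .mid s → a' ≠ .line i) →
      (a = .sgn → a' = .sgn) →
      q ^ m * fakeDegree m (fun w => chr m a w * chr m a' w * (starRingEnd ℂ) (detChar m w)) =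
      Rdeg m a * Rdeg m a' + (q ^ m - 1) * Ker m a a' := by
    intro a a' ha ha' hml hsg
    have hpow : ∀ j, j ≤ m → q ^ m = q ^ j * q ^ (m - j) := fun j hj => by
      rw [← pow_add]; congr 1; omega
    rcases a with i | s | _ <;> rcases a' with j | t | _
    · have hi : 2 * i < m := ha
      have hj : 2 * j < m := ha'
      by_cases h0 : i = 0
      · by_cases h0' : j = 0
        · rw [fakeDegree_eq hm (x := 1 / 2) (y := 0) (t := -1) (j := 0) (k := 0) (by omega)
            (by omega)]
          · simp only [C_half, map_zero, map_neg, map_one, Rdeg, Ker, h0, h0', if_true]; simp; ring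
          · intro i'; simp [h0, h0', chr, trivChar, detChar_r, cosSum_zero]
          · simp [h0, h0', chr, trivChar, detChar_sr]
        · rw [fakeDegree_eq hm (x := 1) (y := 0) (t := 0) (j := j) (k := 0) (by omega) (by omega)]
          · simp only [map_zero, map_one, Rdeg, Ker, h0, h0', if_true, if_false]; simp; ring
          · intro i'; simp [h0, h0', chr, trivChar, detChar_r, dih_r]
          · simp [h0, h0', chr, trivChar, detChar_sr, dih_sr]
      · by_cases h0' : j = 0
        · rw [fakeDegree_eq hm (x := 1) (y := 0) (t := 0) (j := i) (k := 0) (by omega) (by omega)]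
          · simp only [map_zero, map_one, Rdeg, Ker, h0, h0', if_true, if_false]; simp; ring
          · intro i'; simp [h0, h0', chr, trivChar, detChar_r, dih_r]
          · simp [h0, h0', chr, trivChar, detChar_sr, dih_sr]
        · rw [fakeDegree_eq hm (x := 1) (y := 1) (t := 0) (j := i + j) (k := max i j - min i j)
            (by omega) (by omega)]
          · have key : ∀ i j, i ≤ j → 2 * j < m →
                q ^ m * ((q ^ (i + j) + q ^ (m - (i + j))) + (q ^ (j - i) + q ^ (m - (j - i)))) =
                (q ^ i + q ^ (m - i)) * (q ^ j + q ^ (m - j)) +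
                  (q ^ m - 1) * (q ^ (i + j) + q ^ (m - (j - i))) := by
              intro i j hij hj
              obtain ⟨d, rfl⟩ := Nat.exists_eq_add_of_le hij
              obtain ⟨e, he⟩ := Nat.exists_eq_add_of_le hj.le
              have e1 : m - (i + (i + d)) = d + e := by omega
              have e2 : i + d - i = d := by omega
              have e3 : m - d = 2 * i + d + e := by omega
              have e4 : m - i = i + 2 * d + e := by omega
              have e5 : m - (i + d) = i + d + e := by omega
              rw [e1, e2, e3, e4, e5, he]
              ring
            simp only [map_zero, map_one, Rdeg, Ker, h0, h0', if_false, zero_mul, zero_div,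
              sub_zero, one_mul]
            rcases le_total i j with h | h
            · rw [max_eq_right h, min_eq_left h]; exact key i j h hj
            · rw [max_eq_left h, min_eq_right h, add_comm i j]
              linear_combination key j i h hi
          · intro i'; simp [h0, h0', chr, detChar_r, dih_r, cosSum_mul]
          · simp [h0, h0', chr, detChar_sr, dih_sr]
    · have hi : 2 * i < m := ha
      have he : Even m := ha'
      obtain ⟨h, hh⟩ := id he
      have h2 : m / 2 = h := by omega
      by_cases h0 : i = 0
      · rw [fakeDegree_eq hm (x := 1 / 2) (y := 0) (t := 0) (j := m / 2) (k := 0) (by omega)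
          (by omega)]
        · simp only [C_half, map_zero, Rdeg, Ker, h0, if_true, sub_half he, zero_add]; simp; ring
        · intro i'
          cases t <;> simp [h0, chr, trivChar, detChar_r, chiR_r he, chiR'_r he, cosSum_half he]
        · cases t <;> simp [h0, chr, trivChar, detChar_sr, chiR_sr he, chiR'_sr he, sum_half hm he]
      · rw [fakeDegree_eq hm (x := 1) (y := 0) (t := 0) (j := i + m / 2) (k := 0) (by omega)
          (by omega)]
        · simp only [map_zero, map_one, Rdeg, Ker, h0, if_false, h2]
          obtain ⟨e, rfl⟩ := Nat.exists_eq_add_of_le (show i ≤ h by omega)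
          rw [show m - (i + (i + e)) = e by omega, show m - i = i + 2 * e by omega,
            show m = 2 * i + 2 * e by omega]
          ring
        · intro i'
          cases t <;> simp [h0, chr, detChar_r, dih_r, chiR_r he, chiR'_r he,
            ← half_mul_cosSum he, mul_comm]
        · simp [h0, chr, detChar_sr, dih_sr]
    · have hi : 2 * i < m := ha
      by_cases h0 : i = 0
      · rw [fakeDegree_eq hm (x := 1 / 2) (y := 0) (t := 1) (j := 0) (k := 0) (by omega) (by omega)]
        · simp only [C_half, map_zero, map_one, Rdeg, Ker, h0, if_true]; simp; ring
        · intro i'; simp [h0, chr, trivChar, detChar_r, cosSum_zero]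
        · simp [h0, chr, trivChar, detChar_sr]
      · rw [fakeDegree_eq hm (x := 1) (y := 0) (t := 0) (j := i) (k := 0) (by omega) (by omega)]
        · simp only [map_zero, map_one, Rdeg, Ker, h0, if_false]; simp; ring
        · intro i'; simp [h0, chr, detChar_r, dih_r]
        · simp [h0, chr, detChar_sr, dih_sr]
    · exact absurd rfl (hml j s rfl)
    · have he : Even m := ha
      have hmm : q ^ m = q ^ (m / 2) * q ^ (m / 2) := by
        have h := hpow (m / 2) (by omega)
        rwa [sub_half he] at h
      have hsq : ∀ x : ZMod m, (ZMod.stdAddChar (((m / 2 : ℕ) : ZMod m) * x) : ℂ) *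
          ZMod.stdAddChar (((m / 2 : ℕ) : ZMod m) * x) = 1 := by
        intro x
        rw [← AddChar.map_add_eq_mul, ← add_mul, half_add_half he, zero_mul,
          AddChar.map_zero_eq_one]
      by_cases hst : s = t
      · subst hst
        rw [fakeDegree_eq hm (x := 1 / 2) (y := 0) (t := -1) (j := 0) (k := 0) (by omega)
          (by omega)]
        · simp only [C_half, map_zero, map_neg, map_one, Rdeg, Ker, if_true, ← hmm]; simp; ring
        · intro i'
          cases s <;> simp [chr, chiR_r he, chiR'_r he, detChar_r, cosSum_zero, hsq]
        · cases s <;> simp [chr, chiR_sr he, chiR'_sr he, detChar_sr, hsq]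
      · rw [fakeDegree_eq hm (x := 1 / 2) (y := 0) (t := 1) (j := 0) (k := 0) (by omega)
          (by omega)]
        · simp only [C_half, map_zero, map_one, Rdeg, Ker, hst, if_false, ← hmm]; simp; ring
        · intro i'
          cases s <;> cases t <;>
            simp [chr, chiR_r he, chiR'_r he, detChar_r, cosSum_zero, hsq]
        · cases s <;> cases t <;> first
            | exact absurd rfl hst
            | simp [chr, chiR_sr he, chiR'_sr he, detChar_sr, hsq]
    · have he : Even m := ha
      rw [fakeDegree_eq hm (x := 1 / 2) (y := 0) (t := 0) (j := m / 2) (k := 0) (by omega)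
          (by omega)]
      · simp only [C_half, map_zero, Rdeg, Ker, sub_half he]; simp; ring
      · intro i'
        cases s <;> simp [chr, detChar_r, chiR_r he, chiR'_r he, cosSum_half he]
      · cases s <;> simp [chr, detChar_sr, chiR_sr he, chiR'_sr he, sum_half hm he]
    · exact absurd (hsg rfl) (by simp)
    · exact absurd (hsg rfl) (by simp)
    · rw [fakeDegree_eq hm (x := 1 / 2) (y := 0) (t := -1) (j := 0) (k := 0) (by omega) (by omega)]
      · simp only [C_half, map_zero, map_neg, map_one, Rdeg, Ker, zero_mul, mul_zero, add_zero,
          pow_zero, Nat.sub_zero]; ring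
      · intro i'; simp [chr, detChar_r, cosSum_zero]
      · simp [chr, detChar_sr]
  rw [Omega]
  by_cases hord : (∀ i s, a = .mid s → a' ≠ .line i) ∧ (a = .sgn → a' = .sgn)
  · exact key a a' ha ha' hord.1 hord.2
  · have h := key a' a ha' ha
      (by rintro i s rfl rfl; exact hord ⟨by simp, by simp⟩)
      (by rintro rfl; exact by_contra fun h => hord ⟨by simp, fun h' => absurd h' h⟩)
    simp only [mul_comm (chr m a' _)] at h
    rw [h, mul_comm (Rdeg m a')]
    congr 2
    cases a <;> cases a' <;> simp [Ker, add_comm, max_comm, min_comm, eq_comm]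

/-! ### Alternating products -/

section altProd

variable {M : Type*} [Monoid M]

/-- The alternating product of length `n` in `g 0`, `g 1`, starting with `g i`. -/
def altProd (g : Fin 2 → M) (i : Fin 2) (n : ℕ) : M := ((altWord i n).map g).prod

theorem altProd_zero (g : Fin 2 → M) (i : Fin 2) : altProd g i 0 = 1 := rfl

theorem altProd_succ (g : Fin 2 → M) (i : Fin 2) (n : ℕ) :
    altProd g i (n + 1) = g i * altProd g (1 - i) n := by
  simp [altProd, altWord]

theorem altProd_two_mul (g : Fin 2 → M) (i : Fin 2) (k : ℕ) :
    altProd g i (2 * k) = (g i * g (1 - i)) ^ k := by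
  induction k with
  | zero => simp [altProd_zero]
  | succ k ih =>
    rw [mul_add, altProd_succ, altProd_succ, sub_sub_cancel, ih, pow_succ', mul_assoc]

theorem altProd_two_mul_add_one (g : Fin 2 → M) (i : Fin 2) (k : ℕ) :
    altProd g i (2 * k + 1) = (g i * g (1 - i)) ^ k * g i := by
  induction k with
  | zero => simp [altProd_succ, altProd_zero]
  | succ k ih =>
    rw [show 2 * (k + 1) + 1 = (2 * k + 1) + 1 + 1 by ring, altProd_succ, altProd_succ,
      sub_sub_cancel, ih, pow_succ']
    simp only [mul_assoc]

theorem map_altProd {N F : Type*} [Monoid N] [FunLike F M N] [MonoidHomClass F M N] (f : F)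
    (g : Fin 2 → M) (i : Fin 2) (n : ℕ) : f (altProd g i n) = altProd (fun j => f (g j)) i n := by
  simp [altProd, map_list_prod, Function.comp_def]

end altProd

theorem length_altWord (i : Fin 2) (n : ℕ) : (altWord i n).length = n := by
  induction n generalizing i with
  | zero => rfl
  | succ n ih => simp [altWord, ih]

theorem exists_redWord_eq (w : DihedralGroup m) :
    ∃ i, redWord m w = altWord i (redWord m w).length := by
  rcases w with k | k
  · simp only [redWord]
    split_ifs
    · exact ⟨0, by rw [length_altWord]⟩
    · exact ⟨1, by rw [length_altWord]⟩
  · simp only [redWord]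
    split_ifs
    · exact ⟨0, by rw [length_altWord]⟩
    · exact ⟨1, by rw [length_altWord]⟩
    · exact ⟨0, by rw [length_altWord]⟩

theorem length_redWord_inv (w : DihedralGroup m) :
    (redWord m w⁻¹).length = (redWord m w).length := by
  rcases w with k | k
  · rw [DihedralGroup.inv_r]
    simp only [redWord]
    have hk := ZMod.val_lt k
    by_cases h0 : k = 0
    · simp [h0]
    · have : NeZero k := ⟨h0⟩
      have h0' : k.val ≠ 0 := by rwa [Ne, ZMod.val_eq_zero]
      rw [ZMod.val_neg_of_ne_zero]
      split_ifs <;> simp only [length_altWord] <;> omega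
  · rw [DihedralGroup.inv_sr]

theorem redWord_one : redWord m 1 = [] := by
  rw [DihedralGroup.one_def]
  simp [redWord, altWord]

theorem redWord_sr_zero : redWord m (.sr 0) = [0] := by
  simp [redWord, altWord]

theorem redWord_sr_one (hm : 3 ≤ m) : redWord m (.sr 1) = [1] := by
  have : Fact (1 < m) := ⟨by omega⟩
  simp [redWord, altWord, ZMod.val_one]
  omega

theorem redWord_r_one (hm : 3 ≤ m) : redWord m (.r 1) = [0, 1] := by
  have : Fact (1 < m) := ⟨by omega⟩
  simp [redWord, altWord, ZMod.val_one]
  omega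

theorem redWord_r_two (hm : 4 ≤ m) : redWord m (.r 2) = [0, 1, 0, 1] := by
  have : (2 : ZMod m).val = 2 := by
    have := ZMod.val_natCast_of_lt (n := m) (a := 2) (by omega)
    simpa using this
  simp [redWord, altWord, this]
  omega

/-! ### Representations of the Hecke algebra -/

section generators

variable {A : Type} [CommRing A] (Q : A) (m : ℕ)

theorem heckeGen_quadratic (i : Fin 2) :
    heckeGen Q m i * heckeGen Q m i = algebraMap A _ (Q - 1) * heckeGen Q m i + algebraMap A _ Q := by
  have h := RingQuot.mkAlgHom_rel A (HeckeRel.quadratic (A := A) (Q := Q) (m := m) i)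
  simp only [map_mul, map_sub, map_add, map_one, map_zero, AlgHom.commutes] at h
  change (heckeGen Q m i - algebraMap A _ Q) * (heckeGen Q m i + 1) = 0 at h
  rw [map_sub, map_one]
  have h2 : (heckeGen Q m i - algebraMap A _ Q) * (heckeGen Q m i + 1) =
    heckeGen Q m i * heckeGen Q m i -
      ((algebraMap A _ Q - 1) * heckeGen Q m i + algebraMap A _ Q) := by
    rw [mul_add, mul_one, sub_mul, sub_mul, one_mul]; abel
  rw [h2] at h
  exact sub_eq_zero.1 h

theorem heckeGen_braid : altProd (heckeGen Q m) 0 m = altProd (heckeGen Q m) 1 m := by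
  have h := RingQuot.mkAlgHom_rel A (HeckeRel.braid (A := A) (Q := Q) (m := m))
  have e : ∀ i, RingQuot.mkAlgHom A (HeckeRel A Q m) (((altWord i m).map (FreeAlgebra.ι A)).prod) =
      altProd (heckeGen Q m) i m := fun i => map_altProd _ (FreeAlgebra.ι A) i m
  rwa [e, e] at h

/-- An algebra homomorphism from the Hecke algebra is given by two elements which satisfy the
relations. -/
def heckeLift {B : Type*} [Ring B] [Algebra A B] (g : Fin 2 → B)
    (hg : ∀ i, g i * g i = algebraMap A B (Q - 1) * g i + algebraMap A B Q)
    (hb : altProd g 0 m = altProd g 1 m) : Hecke A Q m →ₐ[A] B :=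
  RingQuot.liftAlgHom A ⟨FreeAlgebra.lift A g, by
    intro x y hxy
    cases hxy with
    | quadratic i =>
      have h := hg i
      simp only [map_mul, map_sub, map_add, map_one, map_zero, AlgHom.commutes,
        FreeAlgebra.lift_ι_apply] at h ⊢
      have h2 : (g i - algebraMap A B Q) * (g i + 1) = g i * g i -
        ((algebraMap A B Q - 1) * g i + algebraMap A B Q) := by
        rw [mul_add, mul_one, sub_mul, sub_mul, one_mul]; abel
      rw [h2, h, sub_self]
    | braid =>
      have e : ∀ i, FreeAlgebra.lift A g (((altWord i m).map (FreeAlgebra.ι A)).prod) =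
          altProd g i m := fun i => by
        rw [show ((altWord i m).map (FreeAlgebra.ι A)).prod = altProd (FreeAlgebra.ι A) i m from rfl,
          map_altProd]
        simp
      rw [e, e, hb]⟩

theorem heckeLift_heckeGen {B : Type*} [Ring B] [Algebra A B] (g : Fin 2 → B)
    (hg : ∀ i, g i * g i = algebraMap A B (Q - 1) * g i + algebraMap A B Q)
    (hb : altProd g 0 m = altProd g 1 m) (i : Fin 2) :
    heckeLift Q m g hg hb (heckeGen Q m i) = g i := by
  rw [heckeLift, heckeGen, RingQuot.liftAlgHom_mkAlgHom_apply, FreeAlgebra.lift_ι_apply]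

theorem map_heckeT {B : Type*} [Ring B] [Algebra A B] (f : Hecke A Q m →ₐ[A] B)
    (w : DihedralGroup m) :
    f (heckeT Q w) = ((redWord m w).map fun i => f (heckeGen Q m i)).prod := by
  simp [heckeT, map_list_prod, Function.comp_def]

end generators

/-! ### Two by two matrices -/

section matrices

variable {R : Type*} [CommRing R]

/-- The Chebyshev-like sequence with `U₀ = 0`, `U₁ = 1`, `Uₙ₊₂ = t Uₙ₊₁ - d Uₙ`. -/
def cheb (t d : R) : ℕ → R
  | 0 => 0
  | 1 => 1
  | n + 2 => t * cheb t d (n + 1) - d * cheb t d n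

theorem map_cheb {S : Type*} [CommRing S] (f : R →+* S) (t d : R) (n : ℕ) :
    f (cheb t d n) = cheb (f t) (f d) n := by
  induction n using Nat.twoStepInduction with
  | zero => simp [cheb]
  | one => simp [cheb]
  | more n h1 h2 => simp [cheb, h1, h2]

theorem cheb_zero_right (t : R) (n : ℕ) : cheb t 0 (n + 1) = t ^ n := by
  induction n with
  | zero => simp [cheb]
  | succ n ih => rw [cheb, ih]; ring

theorem mat_sq (A : Matrix (Fin 2) (Fin 2) R) :
    A * A = A.trace • A - A.det • (1 : Matrix (Fin 2) (Fin 2) R) := by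
  ext i j
  fin_cases i <;> fin_cases j <;>
    simp [Matrix.mul_apply, Fin.sum_univ_two, Matrix.trace_fin_two, Matrix.det_fin_two] <;> ring

theorem mat_pow (A : Matrix (Fin 2) (Fin 2) R) (n : ℕ) :
    A ^ (n + 1) = cheb A.trace A.det (n + 1) • A - (A.det * cheb A.trace A.det n) • 1 := by
  induction n with
  | zero => simp [cheb]
  | succ n ih =>
    rw [pow_succ, ih, sub_mul, smul_mul_assoc, mat_sq, smul_mul_assoc, one_mul, cheb]
    module

/-- Polarized Cayley–Hamilton. It rewrites BA through 1, A, B, AB with coefficients that depend on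
tr(AB) only. -/
theorem mat_anticomm {x : R} {A B : Matrix (Fin 2) (Fin 2) R} (hA : A.trace = x - 1)
    (hB : B.trace = x - 1) : A * B + B * A =
      ((A * B).trace - (x - 1) ^ 2) • (1 : Matrix (Fin 2) (Fin 2) R) + (x - 1) • (A + B) := by
  rw [Matrix.trace_fin_two] at hA hB
  have hA' : A 1 1 = x - 1 - A 0 0 := by linear_combination hA
  have hB' : B 1 1 = x - 1 - B 0 0 := by linear_combination hB
  ext i j
  fin_cases i <;> fin_cases j <;>
    simp [Matrix.mul_apply, Fin.sum_univ_two, Matrix.trace_fin_two, hA', hB'] <;> ring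

/-- Reduces the braid relation of odd length to a multiple of A - B. -/
theorem mat_braid_three {x : R} {A B : Matrix (Fin 2) (Fin 2) R} (hA : A.trace = x - 1)
    (hB : B.trace = x - 1) (hA2 : A * A = (x - 1) • A + x • 1) (hB2 : B * B = (x - 1) • B + x • 1) :
    A * B * A - B * A * B = ((A * B).trace + x) • (A - B) := by
  have h := mat_anticomm hA hB
  have h1 : A * B = ((A * B).trace - (x - 1) ^ 2) • (1 : Matrix (Fin 2) (Fin 2) R) +
      (x - 1) • (A + B) - B * A := eq_sub_of_add_eq h
  have h2 : B * A = ((A * B).trace - (x - 1) ^ 2) • (1 : Matrix (Fin 2) (Fin 2) R) +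
      (x - 1) • (A + B) - A * B := eq_sub_of_add_eq' h
  have e1 : A * B * A = ((A * B).trace - (x - 1) ^ 2) • A + (x - 1) • (A * A + B * A) -
      B * (A * A) := by
    nth_rewrite 1 [h1]
    simp only [sub_mul, add_mul, smul_mul_assoc, one_mul, mul_assoc]
  have e2 : B * A * B = ((A * B).trace - (x - 1) ^ 2) • B + (x - 1) • (A * B + B * B) -
      A * (B * B) := by
    nth_rewrite 1 [h2]
    simp only [sub_mul, add_mul, smul_mul_assoc, one_mul, mul_assoc]
  rw [e1, e2, hA2, hB2]
  simp only [mul_add, mul_smul_comm, mul_one]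
  module

/-- The trace of M has weight x and the determinant weight x², so the Cayley–Hamilton recursion
raises the weight by one with each factor M. -/
theorem dvd_trace_pow_mul {x : R} {M Y : Matrix (Fin 2) (Fin 2) R} (ht : x ∣ M.trace)
    (hd : x ^ 2 ∣ M.det) (hY : x ∣ (M * Y).trace) (k : ℕ) : x ^ k ∣ (M ^ k * Y).trace := by
  induction k using Nat.twoStepInduction with
  | zero => simp
  | one => simpa using hY
  | more k h1 h2 =>
    have : M ^ (k + 2) * Y = M.trace • (M ^ (k + 1) * Y) - M.det • (M ^ k * Y) := by
      rw [pow_add, pow_two, mat_sq, mul_sub, mul_smul_comm, mul_smul_comm, mul_one, sub_mul,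
        smul_mul_assoc, smul_mul_assoc, pow_succ]
    rw [this, Matrix.trace_sub, Matrix.trace_smul, Matrix.trace_smul, smul_eq_mul, smul_eq_mul]
    refine dvd_sub ?_ ?_
    · rw [show k + 2 = 1 + (k + 1) by ring, pow_add, pow_one]
      exact mul_dvd_mul ht h2
    · rw [show k + 2 = 2 + k by ring, pow_add]
      exact mul_dvd_mul hd h1

theorem dvd_trace_altProd {x : R} {g : Fin 2 → Matrix (Fin 2) (Fin 2) R}
    (htr : ∀ i, (g i).trace = x - 1) (hdet : ∀ i, (g i).det = -x)
    (ht : x ∣ (g 0 * g 1).trace) (i : Fin 2) (n : ℕ) : x ^ (n / 2) ∣ (altProd g i n).trace := by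
  have hti : x ∣ (g i * g (1 - i)).trace := by
    fin_cases i
    · exact ht
    · rw [Matrix.trace_mul_comm]; exact ht
  have hd : x ^ 2 ∣ (g i * g (1 - i)).det := by
    rw [Matrix.det_mul, hdet, hdet]; exact ⟨1, by ring⟩
  rcases Nat.even_or_odd' n with ⟨k, rfl | rfl⟩
  · rw [altProd_two_mul, Nat.mul_div_cancel_left _ two_pos]
    have := dvd_trace_pow_mul hti hd (Y := 1) (by simpa using hti) k
    simpa using this
  · rw [altProd_two_mul_add_one, show (2 * k + 1) / 2 = k by omega]
    refine dvd_trace_pow_mul hti hd ?_ k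
    rw [Matrix.trace_mul_comm, ← mul_assoc, mat_sq, sub_mul, smul_mul_assoc, smul_mul_assoc,
      Matrix.trace_sub, Matrix.trace_smul, Matrix.trace_smul, hdet]
    exact dvd_sub (hti.mul_left _) ⟨-(1 * g (1 - i)).trace, by simp⟩

end matrices

/-! ### Generic degrees -/

/-- Cancelling common factors can only lower the q-order of the numerator, because the reduced
numerator divides a. -/
theorem qOrder_div_le {a : ℂ[X]} (ha : a ≠ 0) (p : ℂ[X]) :
    qOrder (ofPoly a / ofPoly p) ≤ a.natTrailingDegree := by
  -- The quotient is 0 by convention here and `qOrder 0 = 0`; this spares a proof that Schur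
  -- elements do not vanish.
  by_cases hp : p = 0
  · subst hp
    rw [ofPoly_zero, div_zero, ← ofPoly_zero, qOrder_ofPoly]
    simp
  obtain ⟨c, hc⟩ := RatFunc.num_div_dvd a hp
  have hc0 : (RatFunc.num (ofPoly a / ofPoly p)) * c ≠ 0 := by
    rw [show (RatFunc.num (ofPoly a / ofPoly p)) * c = a from hc.symm]; exact ha
  rw [qOrder]
  conv_rhs => rw [show a = (RatFunc.num (ofPoly a / ofPoly p)) * c from hc]
  rw [natTrailingDegree_mul (left_ne_zero_of_mul hc0) (right_ne_zero_of_mul hc0)]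
  exact Nat.le_add_right _ _

theorem qOrder_div_eq {a p : ℂ[X]} (ha : a ≠ 0) (hp : p.coeff 0 ≠ 0) :
    qOrder (ofPoly a / ofPoly p) = a.natTrailingDegree := by
  refine le_antisymm (qOrder_div_le ha p) ?_
  have hp0 : p ≠ 0 := by rintro rfl; simp at hp
  have hpp : ofPoly p ≠ 0 := fun h => hp0 (ofPoly_injective (h.trans ofPoly_zero.symm))
  set f := ofPoly a / ofPoly p with hf
  have hd : f.denom ≠ 0 := f.denom_ne_zero
  have hdd : ofPoly f.denom ≠ 0 := fun h => hd (ofPoly_injective (h.trans ofPoly_zero.symm))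
  have h1 : ofPoly f.num / ofPoly f.denom = ofPoly a / ofPoly p := by
    rw [← hf]; exact RatFunc.num_div_denom f
  rw [div_eq_div_iff hdd hpp, ← ofPoly_mul, ← ofPoly_mul] at h1
  have h2 := ofPoly_injective h1
  have hn : f.num ≠ 0 := by
    intro h
    rw [h, zero_mul] at h2
    exact mul_ne_zero ha hd h2.symm
  have h3 := congrArg natTrailingDegree h2
  rw [natTrailingDegree_mul hn hp0, natTrailingDegree_mul ha hd,
    natTrailingDegree_eq_zero.2 (Or.inr hp), add_zero] at h3
  rw [qOrder, h3]
  exact Nat.le_add_right _ _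

/-- Once each trace is divided by q^⌊ℓ/2⌋, one factor q clears all denominators, since 2⌊ℓ/2⌋ + 1 -
ℓ is 0 for odd ℓ and 1 for even ℓ. At q = 0 only elements of odd length survive. -/
theorem q_mul_schurElement {n : ℕ} (ρ : HeckeRep m n) (τ : DihedralGroup m → ℂ[X])
    (hτ : ∀ w, (ρ (heckeT X w)).trace = X ^ ((redWord m w).length / 2) * τ w) :
    q * schurElement ρ = ofPoly (C ((n : ℂ)⁻¹) *
      ∑ w, X ^ (((redWord m w).length + 1) % 2) * (τ w * τ w⁻¹)) := by
  have hsum : ofPoly (∑ w, X ^ (((redWord m w).length + 1) % 2) * (τ w * τ w⁻¹)) =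
      ∑ w, ofPoly (X ^ (((redWord m w).length + 1) % 2) * (τ w * τ w⁻¹)) := map_sum _ _ _
  rw [schurElement, ofPoly_mul, ofPoly_C, hsum, mul_left_comm, Finset.mul_sum]
  congr 1
  · simp
  · refine Finset.sum_congr rfl fun w _ => ?_
    rw [hτ, hτ, length_redWord_inv, inv_mul_eq_div, mul_div_assoc',
      div_eq_iff (pow_ne_zero _ q_ne_zero)]
    simp only [ofPoly_mul, ofPoly_pow, ofPoly_X]
    obtain ⟨l, hl⟩ : ∃ l, (redWord m w).length = l := ⟨_, rfl⟩
    rw [hl]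
    have e : q * (q ^ (l / 2) * q ^ (l / 2)) = q ^ ((l + 1) % 2) * q ^ l := by
      rw [← pow_add, ← pow_succ', ← pow_add]
      congr 1
      omega
    linear_combination (ofPoly (τ w) * ofPoly (τ w⁻¹)) * e

theorem poincare_eq : poincare m = ofPoly ((X + 1) * ∑ i ∈ Finset.range m, X ^ i) := by
  have hq1 : q - 1 ≠ 0 := by simpa using q_pow_sub_one_ne_zero one_ne_zero
  have hsum : ofPoly (∑ i ∈ Finset.range m, X ^ i) = ∑ i ∈ Finset.range m, q ^ i := by
    rw [← ofPoly_X]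
    simp only [ofPoly, map_sum, map_pow]
  rw [poincare, ofPoly_mul, ofPoly_add, ofPoly_X, ofPoly_one, hsum, geom_sum_eq (sub_ne_zero.1 hq1)]
  congr 1
  rw [div_eq_iff hq1]; ring

theorem coeff_zero_poincare (hm : 3 ≤ m) :
    (((X + 1) * ∑ i ∈ Finset.range m, X ^ i : ℂ[X])).coeff 0 = 1 := by
  rw [coeff_zero_eq_eval_zero, eval_mul, eval_finsetSum]
  simp only [eval_add, eval_X, eval_one, eval_pow, zero_add, one_mul]
  rw [Finset.sum_eq_single 0]
  · simp
  · intro i _ hi; simp [hi]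
  · intro h; simp at h; omega

theorem genericDegree_eq {n : ℕ} (ρ : HeckeRep m n) {p : ℂ[X]}
    (hp : q * schurElement ρ = ofPoly p) :
    genericDegree ρ = ofPoly (((X + 1) * ∑ i ∈ Finset.range m, X ^ i) * X) / ofPoly p := by
  rw [ofPoly_mul, ← poincare_eq, ← hp, ofPoly_X, genericDegree, mul_comm q,
    mul_div_mul_right _ _ q_ne_zero]

theorem natTrailingDegree_poincare_mul_X (hm : 3 ≤ m) :
    (((X + 1) * ∑ i ∈ Finset.range m, X ^ i) * X : ℂ[X]).natTrailingDegree = 1 := by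
  have h := coeff_zero_poincare hm
  have h0 : ((X + 1) * ∑ i ∈ Finset.range m, X ^ i : ℂ[X]) ≠ 0 := by
    intro h'; rw [h'] at h; simp at h
  rw [natTrailingDegree_mul h0 X_ne_zero, natTrailingDegree_X,
    natTrailingDegree_eq_zero.2 (Or.inr (by rw [h]; exact one_ne_zero))]

theorem poincare_mul_X_ne_zero (hm : 3 ≤ m) :
    (((X + 1) * ∑ i ∈ Finset.range m, X ^ i) * X : ℂ[X]) ≠ 0 := by
  intro h
  have := natTrailingDegree_poincare_mul_X hm
  rw [h] at this
  simp at this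

theorem trace_heckeT_dvd {n : ℕ} (ρ : HeckeRep m n)
    (h : ∀ i k, X ^ (k / 2) ∣ (altProd (fun i => ρ (heckeGen X m i)) i k).trace)
    (w : DihedralGroup m) : X ^ ((redWord m w).length / 2) ∣ (ρ (heckeT X w)).trace := by
  obtain ⟨i, hi⟩ := exists_redWord_eq w
  rw [map_heckeT, hi, length_altWord]
  exact h i _

/-- The generic degree becomes q times the Poincaré polynomial over a polynomial, and the Poincaré
polynomial has constant term 1. A character with b ≥ 2 and such traces is thus not special. -/
theorem qOrder_genericDegree_le (hm : 3 ≤ m) {n : ℕ} (ρ : HeckeRep m n)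
    (h : ∀ i k, X ^ (k / 2) ∣ (altProd (fun i => ρ (heckeGen X m i)) i k).trace) :
    qOrder (genericDegree ρ) ≤ 1 := by
  choose τ hτ using trace_heckeT_dvd ρ h
  rw [genericDegree_eq ρ (q_mul_schurElement ρ τ hτ), ← natTrailingDegree_poincare_mul_X hm]
  exact qOrder_div_le (poincare_mul_X_ne_zero hm) _

/-! ### Deformations of characters -/

section deform

variable {n : ℕ} {ρ : HeckeRep m n} {χ : DihedralGroup m → ℂ}

theorem Deforms.degree (h : Deforms ρ χ) : (n : ℂ) = χ 1 := by
  have h1 := h 1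
  rw [map_heckeT, redWord_one] at h1
  simpa [Matrix.trace_one] using h1

theorem Deforms.sr_zero (h : Deforms ρ χ) :
    (ρ (heckeGen X m 0)).trace.eval 1 = χ (.sr 0) := by
  have h1 := h (.sr 0)
  rw [map_heckeT, redWord_sr_zero] at h1
  simpa using h1

theorem Deforms.sr_one (hm : 3 ≤ m) (h : Deforms ρ χ) :
    (ρ (heckeGen X m 1)).trace.eval 1 = χ (.sr 1) := by
  have h1 := h (.sr 1)
  rw [map_heckeT, redWord_sr_one hm] at h1
  simpa using h1

theorem Deforms.r_one (hm : 3 ≤ m) (h : Deforms ρ χ) :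
    (ρ (heckeGen X m 0) * ρ (heckeGen X m 1)).trace.eval 1 = χ (.r 1) := by
  have h1 := h (.r 1)
  rw [map_heckeT, redWord_r_one hm] at h1
  simpa using h1

theorem Deforms.r_two (hm : 4 ≤ m) (h : Deforms ρ χ) :
    (ρ (heckeGen X m 0) * (ρ (heckeGen X m 1) * (ρ (heckeGen X m 0) *
      ρ (heckeGen X m 1)))).trace.eval 1 = χ (.r 2) := by
  have h1 := h (.r 2)
  rw [map_heckeT, redWord_r_two hm] at h1
  simpa using h1

theorem rep_quadratic (ρ : HeckeRep m n) (i : Fin 2) :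
    ρ (heckeGen X m i) * ρ (heckeGen X m i) =
      (X - 1 : ℂ[X]) • ρ (heckeGen X m i) + (X : ℂ[X]) • 1 := by
  rw [← map_mul, heckeGen_quadratic, map_add, map_mul, AlgHom.commutes, AlgHom.commutes,
    Algebra.algebraMap_eq_smul_one, Algebra.algebraMap_eq_smul_one, smul_mul_assoc, one_mul]

theorem rep_braid (ρ : HeckeRep m n) : altProd (fun i => ρ (heckeGen X m i)) 0 m =
    altProd (fun i => ρ (heckeGen X m i)) 1 m := by
  rw [← map_altProd, ← map_altProd, heckeGen_braid]

end deform

theorem root_of_quadratic {x : ℂ[X]} (h : x * x = (X - 1) * x + X) : x = X ∨ x = -1 := by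
  have : (x - X) * (x + 1) = 0 := by linear_combination h
  rcases mul_eq_zero.1 this with h | h
  · exact Or.inl (sub_eq_zero.1 h)
  · exact Or.inr (eq_neg_of_add_eq_zero_left h)

/-- Compare the quadratic relation with Cayley–Hamilton. If the trace were not q - 1, the matrix
would be triangular with equal diagonal entries q or -1, whose trace at q = 1 is ±2. -/
theorem trace_det_of_quadratic {A : Matrix (Fin 2) (Fin 2) ℂ[X]}
    (hA : A * A = (X - 1 : ℂ[X]) • A + (X : ℂ[X]) • 1) (h0 : A.trace.eval 1 = 0) :
    A.trace = X - 1 ∧ A.det = -X := by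
  have h := mat_sq A
  rw [hA] at h
  have e00 := congrFun (congrFun h 0) 0
  have e01 := congrFun (congrFun h 0) 1
  have e10 := congrFun (congrFun h 1) 0
  have e11 := congrFun (congrFun h 1) 1
  simp only [Matrix.add_apply, Matrix.sub_apply, Matrix.smul_apply, smul_eq_mul,
    Matrix.one_apply_eq, mul_one, Matrix.one_apply_ne (show (0 : Fin 2) ≠ 1 by decide),
    Matrix.one_apply_ne (show (1 : Fin 2) ≠ 0 by decide), mul_zero, add_zero, sub_zero]
    at e00 e01 e10 e11
  by_cases ht : A.trace = X - 1
  · refine ⟨ht, ?_⟩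
    rw [ht] at e00
    linear_combination e00
  · exfalso
    have ht' : A.trace - (X - 1) ≠ 0 := sub_ne_zero.2 ht
    have h01 : A 0 1 = 0 := by
      refine (mul_eq_zero.1 (?_ : (A.trace - (X - 1)) * A 0 1 = 0)).resolve_left ht'
      linear_combination -e01
    have hd : A 0 0 = A 1 1 := by
      refine sub_eq_zero.1 ((mul_eq_zero.1
        (?_ : (A.trace - (X - 1)) * (A 0 0 - A 1 1) = 0)).resolve_left ht')
      linear_combination e11 - e00
    have q00 := congrFun (congrFun hA 0) 0
    simp only [Matrix.mul_apply, Fin.sum_univ_two, h01, zero_mul, add_zero, Matrix.add_apply,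
      Matrix.smul_apply, smul_eq_mul, Matrix.one_apply_eq, mul_one] at q00
    rw [Matrix.trace_fin_two, ← hd] at h0
    rcases root_of_quadratic q00 with h | h <;> rw [h] at h0 <;> norm_num at h0

theorem cosSum_two_ne {j : ℕ} (h0 : j ≠ 0) (hj : 2 * j < m) : cosSum j (2 : ZMod m) ≠ 2 := by
  intro h
  rw [cosSum] at h
  have h1 : (ZMod.stdAddChar ((j : ZMod m) * 2) : ℂ) * ZMod.stdAddChar (-((j : ZMod m) * 2)) = 1 := by
    rw [← AddChar.map_add_eq_mul, add_neg_cancel, AddChar.map_zero_eq_one]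
  have h2 : ((ZMod.stdAddChar ((j : ZMod m) * 2) : ℂ) - 1) ^ 2 = 0 := by
    linear_combination (ZMod.stdAddChar ((j : ZMod m) * 2) : ℂ) * h - h1
  have h3 := sub_eq_zero.1 (pow_eq_zero_iff two_ne_zero |>.1 h2)
  rw [← AddChar.map_zero_eq_one (ZMod.stdAddChar (N := m))] at h3
  have h4 := ZMod.injective_stdAddChar h3
  exact two_mul_natCast_ne_zero h0 hj (by rw [← h4]; ring)

/-- The image of the generators under a two-dimensional representation which deforms `χ_j`. -/
structure IsDihPair (m j : ℕ) [NeZero m] (g : Fin 2 → Matrix (Fin 2) (Fin 2) ℂ[X]) : Prop where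
  trace : ∀ i, (g i).trace = X - 1
  det : ∀ i, (g i).det = -X
  quad : ∀ i, g i * g i = (X - 1 : ℂ[X]) • g i + (X : ℂ[X]) • 1
  braid : altProd g 0 m = altProd g 1 m
  comm : g 0 * g 1 ≠ g 1 * g 0
  eval : (g 0 * g 1).trace.eval 1 = cosSum j (1 : ZMod m)

/-- If the generators commuted, T₀T₁T₀T₁ = T₀²T₁² would have trace 2 at q = 1, but χ_j takes another
value at the square of the basic rotation. -/
theorem Deforms.isDihPair (hm : 4 ≤ m) {j : ℕ} (h0 : j ≠ 0) (hj : 2 * j < m) {ρ : HeckeRep m 2}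
    (h : Deforms ρ (dih m j)) : IsDihPair m j fun i => ρ (heckeGen X m i) := by
  have htd : ∀ i, (ρ (heckeGen X m i)).trace = X - 1 ∧ (ρ (heckeGen X m i)).det = -X := by
    intro i
    refine trace_det_of_quadratic (rep_quadratic ρ i) ?_
    fin_cases i
    · exact h.sr_zero
    · exact h.sr_one (by omega)
  refine ⟨fun i => (htd i).1, fun i => (htd i).2, rep_quadratic ρ, rep_braid ρ, ?_,
    h.r_one (by omega)⟩
  intro hc
  have h2 := h.r_two hm
  apply cosSum_two_ne h0 hj
  rw [← dih_r, ← h2]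
  set A := ρ (heckeGen X m 0)
  set B := ρ (heckeGen X m 1)
  have hc' : A * B = B * A := hc
  have : A * (B * (A * B)) = ((X - 1 : ℂ[X]) • A + (X : ℂ[X]) • 1) *
      ((X - 1 : ℂ[X]) • B + (X : ℂ[X]) • 1) := by
    rw [← rep_quadratic ρ 0, ← rep_quadratic ρ 1]
    change A * (B * (A * B)) = A * A * (B * B)
    rw [← mul_assoc B A B, ← hc', mul_assoc, mul_assoc]
  rw [this]
  simp only [add_mul, mul_add, smul_mul_assoc, mul_smul_comm, mul_one, one_mul, Matrix.trace_add,
    Matrix.trace_smul, smul_eq_mul, Matrix.trace_one]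
  simp

/-- By Cayley–Hamilton both sides of the braid relation are combinations of 1 and T₀T₁ or T₁T₀ with
the same coefficients. Their difference is the Chebyshev value times the nonzero commutator. -/
theorem IsDihPair.cheb_even {j h : ℕ} {g : Fin 2 → Matrix (Fin 2) (Fin 2) ℂ[X]}
    (hg : IsDihPair m j g) (hh : m = 2 * (h + 1)) :
    cheb (g 0 * g 1).trace (X ^ 2) (h + 1) = 0 := by
  have hb := hg.braid
  have hw : ∀ i, altProd g i m = altProd g i _ := fun i => congrArg (altProd g i) hh
  rw [hw, hw] at hb
  rw [altProd_two_mul, altProd_two_mul, mat_pow, mat_pow] at hb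
  have e0 : (g 0 * g (1 - 0)).det = X ^ 2 := by rw [Matrix.det_mul, hg.det, hg.det]; ring
  have e1 : (g 1 * g (1 - 1)).det = X ^ 2 := by rw [Matrix.det_mul, hg.det, hg.det]; ring
  have e2 : (g 1 * g (1 - 1)).trace = (g 0 * g 1).trace := by
    rw [Matrix.trace_mul_comm]; rfl
  rw [e0, e1, e2] at hb
  change cheb (g 0 * g 1).trace (X ^ 2) (h + 1) • (g 0 * g 1) - _ =
    cheb (g 0 * g 1).trace (X ^ 2) (h + 1) • (g 1 * g 0) - _ at hb
  have h3 := sub_left_injective hb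
  by_contra hne
  exact hg.comm (smul_right_injective _ hne h3)

/-- As for even m, with the difference of the two words being a multiple of T₀ - T₁ by
`mat_braid_three`. -/
theorem IsDihPair.cheb_odd {j h : ℕ} {g : Fin 2 → Matrix (Fin 2) (Fin 2) ℂ[X]}
    (hg : IsDihPair m j g) (hh : m = 2 * (h + 1) + 1) :
    ((g 0 * g 1).trace + X) * cheb (g 0 * g 1).trace (X ^ 2) (h + 1) -
      X ^ 2 * cheb (g 0 * g 1).trace (X ^ 2) h = 0 := by
  have hb := hg.braid
  have hw : ∀ i, altProd g i m = altProd g i _ := fun i => congrArg (altProd g i) hh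
  rw [hw, hw] at hb
  rw [altProd_two_mul_add_one, altProd_two_mul_add_one, mat_pow, mat_pow] at hb
  have e0 : (g 0 * g (1 - 0)).det = X ^ 2 := by rw [Matrix.det_mul, hg.det, hg.det]; ring
  have e1 : (g 1 * g (1 - 1)).det = X ^ 2 := by rw [Matrix.det_mul, hg.det, hg.det]; ring
  have e2 : (g 1 * g (1 - 1)).trace = (g 0 * g 1).trace := by
    rw [Matrix.trace_mul_comm]; rfl
  rw [e0, e1, e2] at hb
  change (cheb (g 0 * g 1).trace (X ^ 2) (h + 1) • (g 0 * g 1) - _) * g 0 =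
    (cheb (g 0 * g 1).trace (X ^ 2) (h + 1) • (g 1 * g 0) - _) * g 1 at hb
  have h3 := mat_braid_three (hg.trace 0) (hg.trace 1) (hg.quad 0) (hg.quad 1)
  set t := (g 0 * g 1).trace
  rw [sub_mul, sub_mul, smul_mul_assoc, smul_mul_assoc, smul_mul_assoc, smul_mul_assoc, one_mul,
    one_mul] at hb
  have h4 : ((t + X) * cheb t (X ^ 2) (h + 1) - X ^ 2 * cheb t (X ^ 2) h) • (g 0 - g 1) = 0 := by
    have h5 : cheb t (X ^ 2) (h + 1) • (g 0 * g 1 * g 0 - g 1 * g 0 * g 1) =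
      (X ^ 2 * cheb t (X ^ 2) h) • (g 0 - g 1) := by
      rw [smul_sub, smul_sub, sub_eq_sub_iff_sub_eq_sub]
      exact hb
    rw [h3] at h5
    rw [sub_smul, mul_comm, mul_smul, h5, sub_self]
  rcases smul_eq_zero.1 h4 with h5 | h5
  · exact h5
  · exact absurd (by rw [sub_eq_zero.1 h5]) hg.comm

/-- At q = 0 the determinant q² of T₀T₁ vanishes, and the Chebyshev relation degenerates to a power
of the trace being zero. -/
theorem IsDihPair.X_dvd (hm : 4 ≤ m) {j : ℕ} {g : Fin 2 → Matrix (Fin 2) (Fin 2) ℂ[X]}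
    (hg : IsDihPair m j g) : X ∣ (g 0 * g 1).trace := by
  rw [X_dvd_iff, coeff_zero_eq_eval_zero]
  rcases Nat.even_or_odd' m with ⟨k, hk | hk⟩
  · obtain ⟨h, rfl⟩ : ∃ h, k = h + 1 + 1 := ⟨k - 2, by omega⟩
    have h1 := congrArg (evalRingHom (0 : ℂ)) (hg.cheb_even hk)
    rw [map_cheb] at h1
    simp only [coe_evalRingHom, eval_pow, eval_X, ne_eq, OfNat.ofNat_ne_zero, not_false_eq_true,
      zero_pow, eval_zero, cheb_zero_right] at h1
    exact eq_zero_of_pow_eq_zero h1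
  · obtain ⟨h, rfl⟩ : ∃ h, k = h + 1 := ⟨k - 1, by omega⟩
    have h1 := congrArg (evalRingHom (0 : ℂ)) (hg.cheb_odd hk)
    rw [map_sub, map_mul, map_mul, map_cheb] at h1
    simp only [coe_evalRingHom, eval_pow, eval_X, ne_eq, OfNat.ofNat_ne_zero, not_false_eq_true,
      zero_pow, eval_zero, cheb_zero_right, eval_add, add_zero, zero_mul, sub_zero] at h1
    rw [← pow_succ'] at h1
    exact eq_zero_of_pow_eq_zero h1

theorem IsDihPair.dvd (hm : 4 ≤ m) {j : ℕ} {g : Fin 2 → Matrix (Fin 2) (Fin 2) ℂ[X]}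
    (hg : IsDihPair m j g) (i : Fin 2) (k : ℕ) : X ^ (k / 2) ∣ (altProd g i k).trace :=
  dvd_trace_altProd hg.trace hg.det (hg.X_dvd hm) i k

theorem not_isSpecial_line (hm : 3 ≤ m) {j : ℕ} (hj1 : 2 ≤ j) (hj : 2 * j < m) :
    ¬ IsSpecial (chr m (.line j)) := by
  rintro ⟨n, ρ, hρ, hb⟩
  rw [b_chr hm (show Lab.Valid m (.line j) from hj)] at hb
  have h0 : j ≠ 0 := by omega
  rw [show chr m (.line j) = dih m j by simp [chr, h0]] at hρ
  have hn := hρ.degree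
  rw [DihedralGroup.one_def, dih_r] at hn
  have hn2 : n = 2 := by
    have : (n : ℂ) = (2 : ℕ) := by rw [hn]; simp [cosSum]; norm_num
    exact_mod_cast this
  subst hn2
  have := qOrder_genericDegree_le hm ρ ((hρ.isDihPair (by omega) h0 hj).dvd (by omega))
  rw [hb] at this
  simp only [Lab.pos] at this
  omega

theorem chr_mid_sr_zero (s : Bool) : chr m (.mid s) (.sr 0) = if s then 1 else -1 := by
  cases s <;> simp [chr, chiR, chiR']

theorem chr_mid_sr_one (hm : 3 ≤ m) (s : Bool) :
    chr m (.mid s) (.sr 1) = if s then -1 else 1 := by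
  have : Fact (1 < m) := ⟨by omega⟩
  cases s <;> simp [chr, chiR, chiR', ZMod.val_one]

theorem chr_mid_one (s : Bool) : chr m (.mid s) 1 = 1 := by
  rw [DihedralGroup.one_def]
  cases s <;> simp [chr, chiR, chiR']

/-- The images of the generators under a deformation of `χ_{m/2}` or `χ'_{m/2}`. -/
theorem Deforms.mid (hm : 3 ≤ m) {s : Bool} {ρ : HeckeRep m 1} (h : Deforms ρ (chr m (.mid s))) :
    (ρ (heckeGen X m 0)) 0 0 = (if s then X else -1) ∧
    (ρ (heckeGen X m 1)) 0 0 = (if s then -1 else X) := by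
  have hq : ∀ i, (ρ (heckeGen X m i)) 0 0 = X ∨ (ρ (heckeGen X m i)) 0 0 = -1 := by
    intro i
    apply root_of_quadratic
    have := congrFun (congrFun (rep_quadratic ρ i) 0) 0
    simpa [Matrix.mul_apply] using this
  have h0 := h.sr_zero
  have h1 := h.sr_one hm
  rw [chr_mid_sr_zero, Matrix.trace_fin_one] at h0
  rw [chr_mid_sr_one hm, Matrix.trace_fin_one] at h1
  constructor
  · rcases hq 0 with h' | h' <;> rw [h'] at h0 ⊢ <;> cases s <;>
      first | (simp; done) | (exfalso; norm_num at h0)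
  · rcases hq 1 with h' | h' <;> rw [h'] at h1 ⊢ <;> cases s <;>
      first | (simp; done) | (exfalso; norm_num at h1)

theorem altProd_fin_one {R : Type*} [CommRing R] (g : Fin 2 → Matrix (Fin 1) (Fin 1) R) (i : Fin 2)
    (k : ℕ) : (altProd g i k) 0 0 = altProd (fun i => g i 0 0) i k := by
  induction k generalizing i with
  | zero => simp [altProd_zero]
  | succ k ih => rw [altProd_succ, altProd_succ, ← ih, Matrix.mul_apply]; simp

/-- One generator acts by q and the other by -1, so T₀T₁ acts by -q and the divisibility of traces
is immediate, while b = m/2 ≥ 2. -/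
theorem not_isSpecial_mid (hm : 3 ≤ m) (he : Even m) (s : Bool) :
    ¬ IsSpecial (chr m (.mid s)) := by
  rintro ⟨n, ρ, hρ, hb⟩
  rw [b_chr hm (show Lab.Valid m (.mid s) from he)] at hb
  have hn := hρ.degree
  rw [chr_mid_one] at hn
  have hn1 : n = 1 := by exact_mod_cast hn
  subst hn1
  have hmid := hρ.mid hm
  have := qOrder_genericDegree_le hm ρ (by
    intro i k
    rw [Matrix.trace_fin_one, altProd_fin_one]
    have hi : (ρ (heckeGen X m i)) 0 0 * (ρ (heckeGen X m (1 - i))) 0 0 = -X := by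
      fin_cases i
      · change (ρ (heckeGen X m 0)) 0 0 * (ρ (heckeGen X m 1)) 0 0 = -X
        rw [hmid.1, hmid.2]; cases s <;> simp
      · change (ρ (heckeGen X m 1)) 0 0 * (ρ (heckeGen X m 0)) 0 0 = -X
        rw [hmid.1, hmid.2]; cases s <;> simp
    have hd : (X : ℂ[X]) ∣ -X := dvd_neg.2 dvd_rfl
    rcases Nat.even_or_odd' k with ⟨l, rfl | rfl⟩
    · rw [altProd_two_mul, Nat.mul_div_cancel_left _ two_pos, hi]
      exact pow_dvd_pow_of_dvd hd _
    · rw [altProd_two_mul_add_one, show (2 * l + 1) / 2 = l by omega, hi]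
      exact (pow_dvd_pow_of_dvd hd _).mul_right _)
  rw [hb] at this
  simp only [Lab.pos] at this
  obtain ⟨h, hh⟩ := he
  omega

/-! ### The block of the sign character -/

section antisymmetrizer

variable {A : Type*} [CommRing A] {B : Type*} [Ring B] [Algebra A B]

theorem fin_two_cases (i : Fin 2) : i = 0 ∨ i = 1 := by
  fin_cases i <;> simp

/-- The sum `∑_w u^ℓ(w) T_w`. -/
def wsum (u : A) (m : ℕ) (T : Fin 2 → B) : B :=
  ∑ k ∈ Finset.range m, u ^ k • (altProd T 0 k + altProd T 1 k) + u ^ m • altProd T 0 m - 1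

/-- Regroups the elements into cosets {w, s_i w} of the subgroup generated by s_i, on each of which
T_i acts by a quadratic relation. -/
theorem wsum_eq (u : A) (m : ℕ) (T : Fin 2 → B) (hb : altProd T 0 m = altProd T 1 m) (i : Fin 2) :
    wsum u m T = ∑ k ∈ Finset.range m,
      u ^ k • (altProd T (1 - i) k + u • altProd T i (k + 1)) := by
  have h1 : ∀ i, ∑ k ∈ Finset.range m, u ^ k • (u • altProd T i (k + 1)) =
      ∑ k ∈ Finset.range m, u ^ k • altProd T i k + u ^ m • altProd T i m - 1 := by
    intro i
    have h2 := Finset.sum_range_succ (fun k => u ^ k • altProd T i k) m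
    rw [Finset.sum_range_succ', pow_zero, altProd_zero, one_smul] at h2
    rw [← h2, add_sub_cancel_right]
    refine Finset.sum_congr rfl fun k _ => ?_
    rw [smul_smul, pow_succ]
  have h3 : ∑ k ∈ Finset.range m, u ^ k • (altProd T (1 - i) k + u • altProd T i (k + 1)) =
      ∑ k ∈ Finset.range m, u ^ k • altProd T (1 - i) k +
        ∑ k ∈ Finset.range m, u ^ k • (u • altProd T i (k + 1)) := by
    rw [← Finset.sum_add_distrib]
    exact Finset.sum_congr rfl fun k _ => smul_add _ _ _
  rw [h3, h1, wsum]
  simp only [smul_add, Finset.sum_add_distrib]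
  rcases fin_two_cases i with rfl | rfl
  · rw [show (1 : Fin 2) - 0 = 1 from rfl]; abel
  · rw [show (1 : Fin 2) - 1 = 0 from rfl, hb]; abel

/-- With u = -Q⁻¹ each pair T_w + u T_i T_w is an eigenvector of T_i with eigenvalue -1. -/
theorem mul_wsum {u Q : A} (hu : u * Q = -1) {T : Fin 2 → B}
    (hT : ∀ i, T i * T i = algebraMap A B (Q - 1) * T i + algebraMap A B Q)
    (hb : altProd T 0 m = altProd T 1 m) (i : Fin 2) : T i * wsum u m T = -wsum u m T := by
  rw [wsum_eq u m T hb i, Finset.mul_sum, ← Finset.sum_neg_distrib]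
  refine Finset.sum_congr rfl fun k _ => ?_
  have h : T i * altProd T i (k + 1) = (Q - 1) • altProd T i (k + 1) + Q • altProd T (1 - i) k := by
    rw [altProd_succ, ← mul_assoc, hT, add_mul, mul_assoc, ← Algebra.smul_def, ← Algebra.smul_def]
  rw [mul_smul_comm, mul_add, mul_smul_comm, h, ← altProd_succ, ← smul_neg]
  congr 1
  rw [smul_add, smul_smul, smul_smul, hu]
  have : u * (Q - 1) = -1 - u := by linear_combination hu
  rw [this]
  module

theorem altProd_op (T : Fin 2 → B) (n : ℕ) :
    altProd (fun i => MulOpposite.op (T i)) 0 n + altProd (fun i => MulOpposite.op (T i)) 1 n =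
      MulOpposite.op (altProd T 0 n + altProd T 1 n) ∧
    (altProd T 0 n = altProd T 1 n →
      altProd (fun i => MulOpposite.op (T i)) 0 n = MulOpposite.op (altProd T 0 n) ∧
      altProd (fun i => MulOpposite.op (T i)) 1 n = MulOpposite.op (altProd T 0 n)) := by
  rcases Nat.even_or_odd' n with ⟨k, rfl | rfl⟩
  · have h : ∀ i, altProd (fun i => MulOpposite.op (T i)) i (2 * k) =
        MulOpposite.op (altProd T (1 - i) (2 * k)) := by
      intro i
      rw [altProd_two_mul, altProd_two_mul, sub_sub_cancel]
      simp
    refine ⟨?_, fun hb => ?_⟩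
    · rw [h, h, ← MulOpposite.op_add, add_comm]; rfl
    · rw [h, h]
      exact ⟨congrArg _ hb.symm, rfl⟩
  · have h : ∀ i, altProd (fun i => MulOpposite.op (T i)) i (2 * k + 1) =
        MulOpposite.op (altProd T i (2 * k + 1)) := by
      intro i
      rw [altProd_two_mul_add_one, altProd_two_mul_add_one, ← MulOpposite.op_mul,
        ← MulOpposite.op_pow, ← MulOpposite.op_mul, ← mul_pow_mul]
    refine ⟨?_, fun hb => ?_⟩
    · rw [h, h, ← MulOpposite.op_add]
    · rw [h, h]
      exact ⟨rfl, congrArg _ hb.symm⟩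

/-- The element is invariant under reversal of words, so the left-hand statement applied in the
opposite algebra gives this one. -/
theorem wsum_mul {u Q : A} (hu : u * Q = -1) {T : Fin 2 → B}
    (hT : ∀ i, T i * T i = algebraMap A B (Q - 1) * T i + algebraMap A B Q)
    (hb : altProd T 0 m = altProd T 1 m) (i : Fin 2) : wsum u m T * T i = -wsum u m T := by
  have hop : wsum u m (fun i => MulOpposite.op (T i)) = MulOpposite.op (wsum u m T) := by
    rw [wsum, wsum, ((altProd_op T m).2 hb).1]
    simp only [(altProd_op T _).1]
    simp
  have h := mul_wsum (m := m) (B := Bᵐᵒᵖ) hu (T := fun i => MulOpposite.op (T i)) (by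
    intro i
    rw [← MulOpposite.op_mul, hT, MulOpposite.op_add, MulOpposite.op_mul, MulOpposite.algebraMap_apply,
      MulOpposite.algebraMap_apply, ← MulOpposite.op_mul, ← MulOpposite.op_mul, Algebra.commutes])
    (by rw [((altProd_op T m).2 hb).1, ((altProd_op T m).2 hb).2]) i
  rw [hop, ← MulOpposite.op_mul, ← MulOpposite.op_neg] at h
  exact MulOpposite.op_injective h

theorem altProd_mul_of_neg {T : Fin 2 → B} {x : B} (h : ∀ i, T i * x = -x) (i : Fin 2) (k : ℕ) :
    altProd T i k * x = (-1 : A) ^ k • x := by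
  induction k generalizing i with
  | zero => simp [altProd_zero]
  | succ k ih => rw [altProd_succ, mul_assoc, ih, mul_smul_comm, h, pow_succ]; module

/-- The value of the sign character on `wsum`. -/
def wscal (u : A) (m : ℕ) : A :=
  ∑ k ∈ Finset.range m, u ^ k * ((-1) ^ k + (-1) ^ k) + u ^ m * (-1) ^ m - 1

theorem wsum_mul_of_neg (u : A) {T : Fin 2 → B} {x : B} (h : ∀ i, T i * x = -x) :
    wsum u m T * x = wscal u m • x := by
  rw [wsum, wscal, sub_mul, add_mul, Finset.sum_mul, sub_smul, add_smul, Finset.sum_smul, one_mul,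
    one_smul]
  simp only [smul_mul_assoc, add_mul, altProd_mul_of_neg (A := A) h, mul_smul, add_smul]

theorem map_wsum {C : Type*} [Ring C] [Algebra A C] (f : B →ₐ[A] C) (u : A) (T : Fin 2 → B) :
    f (wsum u m T) = wsum u m fun i => f (T i) := by
  simp [wsum, map_altProd]

theorem map_smul_wsum {C : Type*} [Ring C] [Algebra A C] (f : B →ₐ[A] C) {s u : A}
    (hs : s * wscal u m = 1) {T : Fin 2 → B} (hT : ∀ i, f (T i) = -1) :
    f (s • wsum u m T) = 1 := by
  have h := wsum_mul_of_neg (m := m) u (T := fun _ => (-1 : C)) (x := 1) (by simp)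
  rw [mul_one] at h
  rw [map_smul, map_wsum]
  simp only [hT]
  rw [h, smul_smul, hs, one_smul]

end antisymmetrizer

theorem hecke_induction {A : Type} [CommRing A] {Q : A} {m : ℕ} {p : Hecke A Q m → Prop}
    (hone : p 1) (hsmul : ∀ (r : A) x, p x → p (r • x))
    (hgen : ∀ i x, p x → p (heckeGen Q m i * x))
    (hadd : ∀ x y, p x → p y → p (x + y)) (x : Hecke A Q m) : p x := by
  obtain ⟨y, rfl⟩ := RingQuot.mkAlgHom_surjective A (HeckeRel A Q m) x
  -- The right factor z makes the induction over products in the free algebra possible, since p is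
  -- only stable under left multiplication by generators.
  have key : ∀ y : FreeAlgebra A (Fin 2), ∀ z, p z →
      p (RingQuot.mkAlgHom A (HeckeRel A Q m) y * z) := by
    intro y
    induction y using FreeAlgebra.induction with
    | grade0 r =>
      intro z hz
      rw [AlgHom.commutes, ← Algebra.smul_def]
      exact hsmul r z hz
    | grade1 i => exact hgen i
    | mul a b ha hb =>
      intro z hz
      rw [map_mul, mul_assoc]
      exact ha _ (hb z hz)
    | add a b ha hb =>
      intro z hz
      rw [map_add, add_mul]
      exact hadd _ _ (ha z hz) (hb z hz)
  simpa using key y 1 hone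

theorem mem_center_of_commute_gen {A : Type} [CommRing A] {Q : A} {m : ℕ} {e : Hecke A Q m}
    (h : ∀ i, heckeGen Q m i * e = e * heckeGen Q m i) :
    e ∈ Subalgebra.center A (Hecke A Q m) := by
  rw [Subalgebra.mem_center_iff]
  intro x
  refine hecke_induction (p := fun x => x * e = e * x) ?_ ?_ ?_ ?_ x
  · simp
  · intro r x hx
    rw [smul_mul_assoc, mul_smul_comm, hx]
  · intro i x hx
    rw [mul_assoc, hx, ← mul_assoc, h, mul_assoc]
  · intro x y hx hy
    rw [add_mul, mul_add, hx, hy]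

theorem q_inv_mem : q⁻¹ ∈ rouquierRing :=
  Subring.subset_closure (Or.inl (Or.inr (Or.inr rfl)))

theorem q_pow_sub_one_inv_mem {n : ℕ} (hn : 1 ≤ n) : (q ^ n - 1)⁻¹ ∈ rouquierRing :=
  Subring.subset_closure (Or.inr ⟨n, hn, rfl⟩)

/-- The inverse of the indeterminate in the Rouquier ring. -/
def rouquierQInv : rouquierRing := ⟨q⁻¹, q_inv_mem⟩

theorem rouquierQInv_mul : rouquierQInv * rouquierQ = 1 :=
  Subtype.ext (inv_mul_cancel₀ q_ne_zero)

theorem neg_rouquierQInv_mul : -rouquierQInv * rouquierQ = -1 := by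
  rw [neg_mul, rouquierQInv_mul]

/-- The scalar is the sum of q^(-ℓ(w)), equal to (q^m - 1)(q² - 1)/(q^m (q - 1)²), all of whose
factors are units of the Rouquier ring. -/
theorem exists_wscal_inv (hm : 3 ≤ m) :
    ∃ s : rouquierRing, s * wscal (-rouquierQInv) m = 1 := by
  have hm0 : m ≠ 0 := by omega
  have hqm := q_pow_sub_one_ne_zero hm0
  have hq2 := q_pow_sub_one_ne_zero two_ne_zero
  have hq1 : q - 1 ≠ 0 := by simpa using q_pow_sub_one_ne_zero one_ne_zero
  have hq := q_ne_zero
  have h1 : ((wscal (-rouquierQInv) m : rouquierRing) : RatFunc ℂ) =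
      (q ^ m - 1) * (q ^ 2 - 1) / (q ^ m * (q - 1) ^ 2) := by
    have h2 : ((wscal (-rouquierQInv) m : rouquierRing) : RatFunc ℂ) =
        2 * ∑ k ∈ Finset.range m, (q⁻¹) ^ k + (q⁻¹) ^ m - 1 := by
      rw [wscal, Finset.mul_sum]
      push_cast
      congr 2
      · refine Finset.sum_congr rfl fun k _ => ?_
        rw [← two_mul, mul_left_comm, ← mul_pow]
        congr 2
        change -q⁻¹ * -1 = q⁻¹
        ring
      · rw [← mul_pow]
        congr 1
        change -q⁻¹ * -1 = q⁻¹
        ring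
    have hqi : q⁻¹ ≠ 1 := by
      intro h
      exact hq1 (sub_eq_zero.2 (inv_eq_one.1 h))
    have hqi' : 1 - q ≠ 0 := by
      intro h
      exact hq1 (by linear_combination -h)
    rw [h2, geom_sum_eq hqi, inv_pow]
    have : q⁻¹ - 1 = (1 - q) / q := by field_simp
    rw [this]
    field_simp
    ring
  refine ⟨⟨q ^ m * (q - 1) ^ 2 * ((q ^ m - 1)⁻¹ * (q ^ 2 - 1)⁻¹), ?_⟩, ?_⟩
  · have hqmem : q ∈ rouquierRing := rouquierQ.2
    exact mul_mem (mul_mem (pow_mem hqmem _) (pow_mem (sub_mem hqmem (one_mem _)) _))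
      (mul_mem (q_pow_sub_one_inv_mem (by omega)) (q_pow_sub_one_inv_mem (by omega)))
  · apply Subtype.ext
    change q ^ m * (q - 1) ^ 2 * ((q ^ m - 1)⁻¹ * (q ^ 2 - 1)⁻¹) *
      ((wscal (-rouquierQInv) m : rouquierRing) : RatFunc ℂ) = 1
    rw [h1]
    field_simp

theorem detChar_eq (w : DihedralGroup m) : detChar m w = (-1) ^ (redWord m w).length := by
  have h := congrArg (fun w => (reflRep m w).det) (prod_redWord m w)
  rw [detChar, ← h]
  induction redWord m w with
  | nil => simp
  | cons i l ih =>
    rw [List.map_cons, List.prod_cons, map_mul, Matrix.det_mul, ih, List.length_cons, pow_succ']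
    congr 1
    rcases fin_two_cases i with rfl | rfl
    · exact detChar_sr 0
    · exact detChar_sr 1

theorem altProd_neg_one {R : Type*} [Ring R] (i : Fin 2) (k : ℕ) :
    altProd (fun _ : Fin 2 => (-1 : R)) i k = (-1) ^ k := by
  rw [altProd, List.map_const', List.prod_replicate, length_altWord]

/-- The sign representation over `ℂ[q]`. -/
def sgnRep (m : ℕ) : HeckeRep m 1 :=
  heckeLift X m (fun _ => -1) (by intro i; rw [map_sub, map_one]; noncomm_ring)
    (by rw [altProd_neg_one, altProd_neg_one])

theorem deforms_sgnRep : Deforms (sgnRep m) (detChar m) := by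
  intro w
  rw [map_heckeT]
  simp only [sgnRep, heckeLift_heckeGen]
  rw [List.map_const', List.prod_replicate, detChar_eq]
  rcases Nat.even_or_odd (redWord m w).length with h | h
  · rw [h.neg_one_pow, h.neg_one_pow]; simp
  · rw [h.neg_one_pow, h.neg_one_pow]; simp

/-- If e acts as the identity, then both generators act by -1; degree and values at the simple
reflections single out ε. -/
theorem eq_detChar_of_actsAsOne (hm : 3 ≤ m) {e : RouquierHecke m}
    (he : ∀ i, heckeGen rouquierQ m i * e = -e) {a : Lab} (ha : a.Valid m)
    (h : ActsAsOne e (chr m a)) : a = .sgn := by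
  obtain ⟨n, ρ, φ, hρ, hφ, h1⟩ := h
  have hgen : ∀ i, ρ (heckeGen X m i) = -1 := by
    intro i
    have h2 := congrArg φ (he i)
    rw [map_mul, map_neg, h1, mul_one, hφ] at h2
    ext r c : 1
    apply ofPoly_injective
    have h3 := congrFun (congrFun h2 r) c
    rw [Matrix.map_apply] at h3
    rw [h3]
    simp only [Matrix.neg_apply, ofPoly_neg]
    by_cases hrc : r = c
    · subst hrc; simp [ofPoly_one]
    · simp [hrc, ofPoly_zero]
  have hn := hρ.degree
  have h0 := hρ.sr_zero
  have h1' := hρ.sr_one hm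
  rw [hgen] at h0 h1'
  simp only [Matrix.trace_neg, Matrix.trace_one, Fintype.card_fin, eval_neg, eval_natCast] at h0 h1'
  rw [hn] at h0 h1'
  cases a with
  | sgn => rfl
  | mid s =>
    rw [chr_mid_one, chr_mid_sr_zero] at h0
    rw [chr_mid_one, chr_mid_sr_one hm] at h1'
    cases s
    · norm_num at h1'
    · norm_num at h0
  | line j =>
    exfalso
    by_cases hj : j = 0
    · simp only [chr, hj, if_true, trivChar] at h0
      norm_num at h0
    · simp only [chr, hj, if_false, DihedralGroup.one_def, dih_r, dih_sr] at h0
      norm_num [cosSum] at h0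

/-- The normalized antisymmetrizer is a central idempotent over the Rouquier ring which acts as the
identity only on deformations of ε. -/
theorem not_sameFamily_sgn (hm : 3 ≤ m) {a : Lab} (ha : a.Valid m)
    (h : SameFamily (detChar m) (chr m a)) : a = .sgn := by
  obtain ⟨s, hs⟩ := exists_wscal_inv hm
  set T := heckeGen rouquierQ m with hT
  have hq := heckeGen_quadratic rouquierQ m
  have hb := heckeGen_braid rouquierQ m
  set E := wsum (-rouquierQInv) m T with hE
  have hl : ∀ i, T i * E = -E := mul_wsum neg_rouquierQInv_mul hq hb
  have hr : ∀ i, E * T i = -E := wsum_mul neg_rouquierQInv_mul hq hb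
  have hl' : ∀ i, T i * (s • E) = -(s • E) := fun i => by rw [mul_smul_comm, hl, smul_neg]
  have hc : s • E ∈ Subalgebra.center rouquierRing (RouquierHecke m) := by
    apply mem_center_of_commute_gen
    intro i
    rw [mul_smul_comm, smul_mul_assoc, hl, hr]
  have hid : IsIdempotentElem (s • E) := by
    rw [IsIdempotentElem, smul_mul_assoc]
    nth_rewrite 1 [hE]
    rw [wsum_mul_of_neg _ hl', smul_smul, hs, one_smul]
  have hone : ActsAsOne (s • E) (detChar m) := by
    refine ⟨1, sgnRep m, heckeLift rouquierQ m (fun _ => -1)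
      (by intro i; rw [map_sub, map_one]; noncomm_ring)
      (by rw [altProd_neg_one, altProd_neg_one]), deforms_sgnRep, ?_, ?_⟩
    · intro i
      rw [heckeLift_heckeGen, sgnRep, heckeLift_heckeGen]
      ext r c
      fin_cases r; fin_cases c
      simp [ofPoly_neg, ofPoly_one]
    · exact map_smul_wsum _ hs fun i => heckeLift_heckeGen _ _ _ _ _ i
  exact eq_detChar_of_actsAsOne hm hl' ha ((h _ hc hid).1 hone)

/-! ### Integrality in the Rouquier ring -/

theorem not_isIntegral_inv_prime {p : ℕ} (hp : p.Prime) {y : ℂ} (hy : IsIntegral ℤ y) :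
    (p : ℂ) * y ≠ 1 := by
  intro h
  have hp0 : (p : ℚ) ≠ 0 := Nat.cast_ne_zero.2 hp.ne_zero
  have hy' : y = algebraMap ℚ ℂ (1 / p) := by
    have : (p : ℂ) ≠ 0 := Nat.cast_ne_zero.2 hp.ne_zero
    simp
    field_simp
    linear_combination h
  rw [hy', isIntegral_algebraMap_iff (algebraMap ℚ ℂ).injective] at hy
  obtain ⟨k, hk⟩ := IsIntegrallyClosed.isIntegral_iff.1 hy
  have h1 : (k : ℚ) * p = 1 := by
    have : (k : ℚ) = 1 / p := hk
    rw [this]; field_simp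
  have h2 : k * p = 1 := by exact_mod_cast h1
  have h3 : (p : ℤ) ∣ 1 := ⟨k, by rw [← h2, mul_comm]⟩
  have := Int.natCast_dvd_natCast.1 (by exact_mod_cast h3 : ((p : ℕ) : ℤ) ∣ ((1 : ℕ) : ℤ))
  exact hp.one_lt.ne' (Nat.dvd_one.1 this)

/-- Modulo p, (ξ - 1)^(p^a) is ξ^(p^a) - 1 = 0 up to a multiple of p, so an integral inverse of ξ -
1 would make p invertible among the algebraic integers. -/
theorem not_isIntegral_inv_sub_one {p a : ℕ} (hp : p.Prime) {ξ y : ℂ} (hξ : ξ ^ p ^ a = 1)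
    (hy : IsIntegral ℤ y) : y * (ξ - 1) ≠ 1 := by
  intro h
  have hξi : IsIntegral ℤ ξ := by
    refine IsIntegral.of_pow (pow_pos hp.pos a) ?_
    rw [hξ]; exact isIntegral_one
  let S := integralClosure ℤ ℂ
  let x : S := ⟨ξ - 1, hξi.sub isIntegral_one⟩
  let z : S := ⟨y, hy⟩
  have hzx : z * x = 1 := Subtype.ext h
  obtain ⟨r, hr⟩ := exists_add_pow_prime_pow_eq hp x 1 a
  have h1 : (x + 1) ^ p ^ a = 1 := by
    apply Subtype.ext
    change (ξ - 1 + 1) ^ p ^ a = 1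
    rw [sub_add_cancel, hξ]
  have h2 : (p : S) * (-(z ^ p ^ a * (x * r))) = 1 := by
    have h3 : z ^ p ^ a * x ^ p ^ a = 1 := by rw [← mul_pow, hzx, one_pow]
    rw [h1] at hr
    simp only [one_pow, mul_one] at hr
    linear_combination h3 + z ^ p ^ a * hr
  have h3 := congrArg (Subtype.val) h2
  exact not_isIntegral_inv_prime hp (y := (-(z ^ p ^ a * (x * r)) : S).1)
    (-(z ^ p ^ a * (x * r)) : S).2 (by simpa using h3)

/-- The adjoined inverses have monic denominators, and fractions with monic denominators over the
algebraic integers form a ring. -/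
theorem exists_integral_fraction {f : RatFunc ℂ} (hf : f ∈ rouquierRing) :
    ∃ a d : (integralClosure ℤ ℂ)[X], d.Monic ∧
      f * ofPoly (d.map (algebraMap _ ℂ)) = ofPoly (a.map (algebraMap _ ℂ)) := by
  induction hf using Subring.closure_induction with
  | mem x hx =>
    rcases hx with (⟨z, hz, rfl⟩ | (rfl | rfl)) | ⟨n, hn, rfl⟩
    · refine ⟨C ⟨z, hz⟩, 1, monic_one, ?_⟩
      simp only [Polynomial.map_one, ofPoly_one, mul_one, map_C, ofPoly_C]
      rfl
    · exact ⟨X, 1, monic_one, by simp [ofPoly_one, ofPoly_X]⟩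
    · exact ⟨1, X, monic_X, by simp [ofPoly_one, ofPoly_X, q_ne_zero]⟩
    · refine ⟨1, X ^ n - 1, monic_X_pow_sub_C 1 (by omega), ?_⟩
      simp [ofPoly_one, ofPoly_X, ofPoly_sub, ofPoly_pow, q_pow_sub_one_ne_zero (show n ≠ 0 by omega)]
  | zero => exact ⟨0, 1, monic_one, by simp [ofPoly_zero]⟩
  | one => exact ⟨1, 1, monic_one, by simp⟩
  | add x y _ _ hx hy =>
    obtain ⟨a, d, hd, h⟩ := hx
    obtain ⟨a', d', hd', h'⟩ := hy
    refine ⟨a * d' + a' * d, d * d', hd.mul hd', ?_⟩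
    simp only [Polynomial.map_mul, Polynomial.map_add, ofPoly_mul, ofPoly_add, ← h, ← h']
    ring
  | neg x _ hx =>
    obtain ⟨a, d, hd, h⟩ := hx
    refine ⟨-a, d, hd, ?_⟩
    simp only [Polynomial.map_neg, ofPoly_neg, ← h]
    ring
  | mul x y _ _ hx hy =>
    obtain ⟨a, d, hd, h⟩ := hx
    obtain ⟨a', d', hd', h'⟩ := hy
    refine ⟨a * a', d * d', hd.mul hd', ?_⟩
    simp only [Polynomial.map_mul, ofPoly_mul, ← h, ← h']
    ring

/-- Compare coefficients at the degree of the monic denominator. -/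
theorem isIntegral_of_C_mem {z : ℂ} (h : RatFunc.C z ∈ rouquierRing) : IsIntegral ℤ z := by
  obtain ⟨a, d, hd, h⟩ := exists_integral_fraction h
  rw [← ofPoly_C, ← ofPoly_mul] at h
  have h1 := congrArg (fun p => p.coeff d.natDegree) (ofPoly_injective h)
  simp only [coeff_C_mul, coeff_map, hd.coeff_natDegree, map_one, mul_one] at h1
  rw [h1]
  exact (a.coeff d.natDegree).2

theorem isIntegral_stdAddChar (i : ZMod m) : IsIntegral ℤ (ZMod.stdAddChar i : ℂ) := by
  refine IsIntegral.of_pow (Nat.pos_of_ne_zero (NeZero.ne m)) ?_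
  rw [← AddChar.map_nsmul_eq_pow, nsmul_eq_mul, ZMod.natCast_self, zero_mul,
    AddChar.map_zero_eq_one]
  exact isIntegral_one

/-- `2 cos(2πi/m)`. -/
def cosVal (i : ZMod m) : ℂ := ZMod.stdAddChar i + ZMod.stdAddChar (-i)

theorem isIntegral_cosVal (i : ZMod m) : IsIntegral ℤ (cosVal i) :=
  (isIntegral_stdAddChar i).add (isIntegral_stdAddChar (-i))

/-- `2 cos(2πi/m)` as an element of the Rouquier ring. -/
def cosR (i : ZMod m) : rouquierRing :=
  ⟨RatFunc.C (cosVal i), Subring.subset_closure (Or.inl (Or.inl ⟨_, isIntegral_cosVal i, rfl⟩))⟩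

/-- The difference has the factor ξ - 1 with ξ of prime power order. An inverse in the Rouquier ring
would be constant, hence an algebraic integer, and would invert ξ - 1. -/
theorem not_isUnit_cosR_sub {p a : ℕ} (hp : p.Prime) {i j : ZMod m} (h : (p ^ a) • (i - j) = 0) :
    ¬ IsUnit (cosR i - cosR j) := by
  intro hu
  obtain ⟨y, hy⟩ := hu.exists_left_inv
  have h1 : (y : RatFunc ℂ) * RatFunc.C (cosVal i - cosVal j) = 1 := by
    have := congrArg Subtype.val hy
    rw [map_sub]
    exact this
  have hne : cosVal i - cosVal j ≠ 0 := by
    intro h0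
    rw [h0, map_zero, mul_zero] at h1
    exact zero_ne_one h1
  have hy1 : (y : RatFunc ℂ) = RatFunc.C (cosVal i - cosVal j)⁻¹ := by
    rw [map_inv₀]
    exact eq_inv_of_mul_eq_one_left h1
  have hint : IsIntegral ℤ (cosVal i - cosVal j)⁻¹ := isIntegral_of_C_mem (hy1 ▸ y.2)
  have hfac : cosVal i - cosVal j =
      ZMod.stdAddChar j * (ZMod.stdAddChar (i - j) - 1) * (1 - ZMod.stdAddChar (-i - j)) := by
    have e1 : (ZMod.stdAddChar (i - j) : ℂ) = ZMod.stdAddChar i * ZMod.stdAddChar (-j) := by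
      rw [sub_eq_add_neg, AddChar.map_add_eq_mul]
    have e2 : (ZMod.stdAddChar (-i - j) : ℂ) = ZMod.stdAddChar (-i) * ZMod.stdAddChar (-j) := by
      rw [sub_eq_add_neg, AddChar.map_add_eq_mul]
    have e3 : (ZMod.stdAddChar i : ℂ) * ZMod.stdAddChar (-i) = 1 := by
      rw [← AddChar.map_add_eq_mul, add_neg_cancel, AddChar.map_zero_eq_one]
    have e4 : (ZMod.stdAddChar j : ℂ) * ZMod.stdAddChar (-j) = 1 := by
      rw [← AddChar.map_add_eq_mul, add_neg_cancel, AddChar.map_zero_eq_one]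
    rw [e1, e2, cosVal, cosVal]
    linear_combination (-(ZMod.stdAddChar i : ℂ) + (ZMod.stdAddChar (-j) : ℂ) * ZMod.stdAddChar i *
      ZMod.stdAddChar (-i) - ZMod.stdAddChar (-i)) * e4 + (ZMod.stdAddChar (-j) : ℂ) * e3
  refine not_isIntegral_inv_sub_one (p := p) (a := a) hp (ξ := ZMod.stdAddChar (i - j))
    (y := (cosVal i - cosVal j)⁻¹ * ZMod.stdAddChar j * (1 - ZMod.stdAddChar (-i - j))) ?_ ?_ ?_
  · rw [← AddChar.map_nsmul_eq_pow, h, AddChar.map_zero_eq_one]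
  · exact (hint.mul (isIntegral_stdAddChar _)).mul (isIntegral_one.sub (isIntegral_stdAddChar _))
  · calc _ = (cosVal i - cosVal j)⁻¹ * (ZMod.stdAddChar j * (ZMod.stdAddChar (i - j) - 1) *
          (1 - ZMod.stdAddChar (-i - j))) := by ring
      _ = 1 := by rw [← hfac, inv_mul_cancel₀ hne]

/-- A function on the nonzero residues that does not change along differences of prime power order
has the same value at `m/2` and at `1`. -/
theorem eq_of_prime_power_steps {α : Type*} (hm : 3 ≤ m) (he : Even m) (ω : ZMod m → α)
    (hω : ∀ (p a : ℕ) (i j : ZMod m), p.Prime → i ≠ 0 → j ≠ 0 → (p ^ a) • (i - j) = 0 → ω i = ω j) :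
    ω ((m / 2 : ℕ) : ZMod m) = ω 1 := by
  have hm0 : m ≠ 0 := by omega
  obtain ⟨a, m', hodd, hmm⟩ := Nat.exists_eq_two_pow_mul_odd hm0
  have ha : a ≠ 0 := by
    rintro rfl
    rw [pow_zero, one_mul] at hmm
    rw [hmm] at he
    exact (Nat.not_even_iff_odd.2 hodd) he
  have hcop : Nat.Coprime (2 ^ a) m' := Nat.Coprime.pow_left a hodd.coprime_two_left
  -- A translation by v of order dividing m' is decomposed into translations of prime power order.
  -- The condition m' • u ≠ 0 is kept along the way and keeps all intermediate residues away from 0.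
  have step : ∀ n : ℕ, n ∣ m' → ∀ u v : ZMod m, m' • u ≠ 0 → n • v = 0 → ω u = ω (u + v) := by
    intro n
    induction n using Nat.recOnPosPrimePosCoprime with
    | prime_pow p k hp _ =>
      intro hd u v hu hv
      refine hω p k u (u + v) hp ?_ ?_ ?_
      · rintro rfl; simp at hu
      · intro h0
        apply hu
        have : m' • (u + v) = 0 := by rw [h0, smul_zero]
        obtain ⟨c, rfl⟩ := hd
        rw [smul_add, mul_comm (p ^ k) c, mul_smul c _ v, hv, smul_zero, add_zero] at this
        rwa [mul_comm]
      · rw [sub_add_cancel_left, smul_neg, hv, neg_zero]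
    | zero => 
      intro hd
      rw [zero_dvd_iff.1 hd] at hodd
      simp at hodd
    | one => 
      intro _ u v _ hv
      rw [one_smul] at hv
      rw [hv, add_zero]
    | coprime x y _ _ hxy hx hy =>
      intro hd u v hu hv
      have hxd : x ∣ m' := (Dvd.intro y rfl).trans hd
      have hyd : y ∣ m' := (Dvd.intro_left x rfl).trans hd
      have hb := Nat.gcd_eq_gcd_ab x y
      rw [Nat.Coprime] at hxy
      rw [hxy] at hb
      set r := Nat.gcdA x y
      set s := Nat.gcdB x y
      have hvv : v = (y * s : ℤ) • v + (x * r : ℤ) • v := by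
        rw [← add_smul, add_comm, ← hb]; simp
      have h1 : x • ((y * s : ℤ) • v) = 0 := by
        rw [← natCast_zsmul, smul_smul, ← mul_assoc, mul_comm, mul_smul, ← Nat.cast_mul,
          natCast_zsmul, hv, smul_zero]
      have h2 : y • ((x * r : ℤ) • v) = 0 := by
        rw [← natCast_zsmul, smul_smul, ← mul_assoc, mul_comm, mul_smul, ← Nat.cast_mul,
          natCast_zsmul, mul_comm y x, hv, smul_zero]
      rw [hx hxd u _ hu h1, hy hyd (u + (y * s : ℤ) • v) _ ?_ h2, add_assoc, ← hvv]
      rw [smul_add]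
      have h3 : m' • ((y * s : ℤ) • v) = 0 := by
        obtain ⟨c, hc⟩ := hxd
        rw [hc, mul_comm, mul_smul, h1, smul_zero]
      rwa [h3, add_zero]
  have hb := Nat.gcd_eq_gcd_ab (2 ^ a) m'
  rw [Nat.Coprime] at hcop
  rw [hcop] at hb
  set r := Nat.gcdA (2 ^ a) m'
  set s := Nat.gcdB (2 ^ a) m'
  -- Bézout splits 1 into a part of 2-power order and a part killed by m'.
  have hone : (1 : ZMod m) = (m' * s : ℤ) • 1 + ((2 ^ a : ℕ) * r : ℤ) • 1 := by
    rw [← add_smul, add_comm, ← hb]; simp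
  have hm1 : m • (1 : ZMod m) = 0 := by simp
  have h1 : (2 ^ a) • ((m' * s : ℤ) • (1 : ZMod m)) = 0 := by
    rw [← natCast_zsmul, smul_smul, ← mul_assoc, mul_comm, mul_smul, ← Nat.cast_mul,
      natCast_zsmul, ← hmm, hm1, smul_zero]
  have h2 : m' • (((2 ^ a : ℕ) * r : ℤ) • (1 : ZMod m)) = 0 := by
    rw [← natCast_zsmul, smul_smul, ← mul_assoc, mul_comm, mul_smul, ← Nat.cast_mul,
      natCast_zsmul, mul_comm m', ← hmm, hm1, smul_zero]
  have h3 : m' • ((m' * s : ℤ) • (1 : ZMod m)) ≠ 0 := by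
    intro h0
    have h4 : m' • (1 : ZMod m) = 0 := by
      rw [hone, smul_add, h0, h2, add_zero]
    rw [nsmul_eq_mul, mul_one, ZMod.natCast_eq_zero_iff] at h4
    have h5 := Nat.le_of_dvd hodd.pos h4
    have h6 : 2 ≤ 2 ^ a := by
      calc 2 = 2 ^ 1 := rfl
        _ ≤ 2 ^ a := Nat.pow_le_pow_right two_pos (by omega)
    have h7 := hodd.pos
    nlinarith
  have hhalf : ((m / 2 : ℕ) : ZMod m) ≠ 0 := by
    rw [Ne, ZMod.natCast_eq_zero_iff]
    exact Nat.not_dvd_of_pos_of_lt (by omega) (by omega)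
  -- Since m is even, m/2 has order 2, so it differs from the 2-part of 1 by an element of 2-power
  -- order.
  have h4 : ω ((m / 2 : ℕ) : ZMod m) = ω ((m' * s : ℤ) • (1 : ZMod m)) := by
    refine hω 2 a _ _ Nat.prime_two hhalf ?_ ?_
    · intro h0; rw [h0] at h3; simp at h3
    · rw [smul_sub, h1, sub_zero]
      obtain ⟨b, rfl⟩ : ∃ b, a = b + 1 := ⟨a - 1, by omega⟩
      rw [pow_succ, mul_smul, two_smul, half_add_half he, smul_zero]
  rw [h4, step m' dvd_rfl _ _ h3 h2, ← hone]

/-! ### Explicit two-dimensional representations -/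

section model

variable {R : Type*} [CommRing R]

/-- Explicit matrices for the generators. -/
def mdl (x c : R) : Fin 2 → Matrix (Fin 2) (Fin 2) R :=
  ![!![-1, x; 0, x], !![x, 0; 2 + c, -1]]

theorem trace_mdl (x c : R) (i : Fin 2) : (mdl x c i).trace = x - 1 := by
  fin_cases i <;> simp [mdl, Matrix.trace_fin_two] <;> ring

theorem det_mdl (x c : R) (i : Fin 2) : (mdl x c i).det = -x := by
  fin_cases i <;> simp [mdl, Matrix.det_fin_two]

theorem trace_mdl_mul (x c : R) : (mdl x c 0 * mdl x c 1).trace = x * c := by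
  simp [mdl, Matrix.trace_fin_two]; ring

theorem mdl_quadratic (x c : R) (i : Fin 2) : mdl x c i * mdl x c i =
    algebraMap R _ (x - 1) * mdl x c i + algebraMap R _ x := by
  rw [mat_sq, trace_mdl, det_mdl, ← Algebra.smul_def, Algebra.algebraMap_eq_smul_one]
  module

theorem cheb_mul (x c : R) (n : ℕ) : cheb (x * c) (x ^ 2) (n + 1) = x ^ n * cheb c 1 (n + 1) := by
  induction n using Nat.twoStepInduction with
  | zero => simp [cheb]
  | one => simp [cheb]
  | more n h1 h2 => 
    rw [cheb, h2, h1]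
    conv_rhs => rw [cheb]
    ring

/-- The closed form of the Chebyshev recursion with characteristic roots z and z' = z⁻¹. -/
theorem sub_mul_cheb {z z' : R} (h : z * z' = 1) (n : ℕ) :
    (z - z') * cheb (z + z') 1 n = z ^ n - z' ^ n := by
  induction n using Nat.twoStepInduction with
  | zero => simp [cheb]
  | one => simp [cheb]
  | more n h1 h2 =>
    rw [cheb]
    linear_combination (z + z') * h2 - h1 + (z ^ n - z' ^ n) * h

theorem cheb_two (n : ℕ) : cheb (2 : R) 1 n = n := by
  induction n using Nat.twoStepInduction with
  | zero => simp [cheb]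
  | one => simp [cheb]
  | more n h1 h2 => rw [cheb, h1, h2]; push_cast; ring

/-- The products T₀T₁ and T₁T₀ have equal trace and determinant. When the Chebyshev coefficient
vanishes, their powers of exponent m/2 are the same scalar matrix. -/
theorem mdl_braid {x c : R} {h : ℕ} (hh : m = 2 * (h + 1)) (hc : cheb c 1 (h + 1) = 0) :
    altProd (mdl x c) 0 m = altProd (mdl x c) 1 m := by
  have hw : ∀ i, altProd (mdl x c) i m = altProd (mdl x c) i _ :=
    fun i => congrArg (altProd (mdl x c) i) hh
  rw [hw, hw, altProd_two_mul, altProd_two_mul, mat_pow, mat_pow]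
  have e0 : (mdl x c 0 * mdl x c (1 - 0)).det = x ^ 2 := by
    rw [Matrix.det_mul, det_mdl, det_mdl]; ring
  have e1 : (mdl x c 1 * mdl x c (1 - 1)).det = x ^ 2 := by
    rw [Matrix.det_mul, det_mdl, det_mdl]; ring
  have e2 : (mdl x c 1 * mdl x c (1 - 1)).trace = x * c := by
    rw [Matrix.trace_mul_comm]; exact trace_mdl_mul x c
  have e3 : (mdl x c 0 * mdl x c (1 - 0)).trace = x * c := trace_mdl_mul x c
  rw [e0, e1, e2, e3, cheb_mul, hc]
  simp

theorem map_mdl {S : Type*} [CommRing S] (f : R →+* S) (x c : R) (i : Fin 2) :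
    (mdl x c i).map f = mdl (f x) (f c) i := by
  ext a b
  fin_cases i <;> fin_cases a <;> fin_cases b <;> simp [mdl, map_ofNat]

/-- Makes central elements act by scalars in the model. No condition on c enters, so every parameter
is treated alike. -/
theorem scalar_of_commute_mdl {x c : R} [IsDomain R] (hx : x ≠ 0) (hx1 : x + 1 ≠ 0)
    {E : Matrix (Fin 2) (Fin 2) R} (h : ∀ i, E * mdl x c i = mdl x c i * E) :
    E 0 1 = 0 ∧ E 1 0 = 0 ∧ E 0 0 = E 1 1 := by
  have h0 := h 0
  have h1 := h 1
  have a00 := congrFun (congrFun h0 0) 0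
  have a01 := congrFun (congrFun h0 0) 1
  have b01 := congrFun (congrFun h1 0) 1
  simp [mdl, Matrix.mul_apply, Fin.sum_univ_two] at a00 a01 b01
  have h10 : E 1 0 = 0 := a00.resolve_left hx
  have h01 : E 0 1 = 0 := by
    refine (mul_eq_zero.1 (?_ : (x + 1) * E 0 1 = 0)).resolve_left hx1
    linear_combination -b01
  refine ⟨h01, h10, ?_⟩
  rw [h01] at a01
  refine mul_left_cancel₀ hx ?_
  linear_combination a01

end model

theorem cosVal_eq (i : ZMod m) : cosSum 1 i = cosVal i := by simp [cosSum, cosVal]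

/-- With z = ζ^i one has z^(m/2) = z^(-m/2), while z ≠ z⁻¹ because 2i ≠ 0; the closed form then
forces the value to vanish. -/
theorem cheb_cosVal {h : ℕ} (hh : m = 2 * h) {i : ZMod m} (hi : i + i ≠ 0) :
    cheb (cosVal i) 1 h = 0 := by
  have h1 : (ZMod.stdAddChar i : ℂ) * ZMod.stdAddChar (-i) = 1 := by
    rw [← AddChar.map_add_eq_mul, add_neg_cancel, AddChar.map_zero_eq_one]
  have h2 := sub_mul_cheb h1 h
  have h3 : (ZMod.stdAddChar i : ℂ) ^ h = ZMod.stdAddChar (-i) ^ h := by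
    rw [← AddChar.map_nsmul_eq_pow, ← AddChar.map_nsmul_eq_pow]
    congr 1
    rw [smul_neg, eq_neg_iff_add_eq_zero, ← two_nsmul, smul_smul, ← hh]
    simp
  rw [h3, sub_self] at h2
  refine (mul_eq_zero.1 h2).resolve_left ?_
  intro h0
  have := ZMod.injective_stdAddChar (sub_eq_zero.1 h0)
  apply hi
  nth_rewrite 2 [this]
  rw [add_neg_cancel]

theorem cheb_cosR {h : ℕ} (hh : m = 2 * h) {i : ZMod m} (hi : i + i ≠ 0) :
    cheb (cosR i) 1 h = 0 := by
  have h1 := congrArg (RatFunc.C (K := ℂ)) (cheb_cosVal hh hi)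
  rw [map_cheb, map_one, map_zero] at h1
  apply Subtype.ext
  have h2 := map_cheb rouquierRing.subtype (cosR i) 1 h
  rw [map_one] at h2
  exact h2.trans h1

/-! ### The deformation of the reflection character -/

/-- The representation over `ℂ[q]` which deforms `χ₁`. -/
def reflHeckeRep (m : ℕ) [NeZero m] {h : ℕ} (hh : m = 2 * (h + 2)) : HeckeRep m 2 :=
  heckeLift X m (mdl X (C (cosVal (1 : ZMod m)))) (mdl_quadratic _ _)
    (mdl_braid (show m = 2 * (h + 1 + 1) from hh) (by
      have h1 := congrArg (C : ℂ →+* ℂ[X]) (cheb_cosVal (i := (1 : ZMod m)) hh (by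
        have := two_mul_natCast_ne_zero (m := m) (j := 1) one_ne_zero (by omega)
        simpa using this))
      rwa [map_cheb, map_one, map_zero] at h1))

theorem reflHeckeRep_gen {h : ℕ} (hh : m = 2 * (h + 2)) (i : Fin 2) :
    reflHeckeRep m hh (heckeGen X m i) = mdl X (C (cosVal (1 : ZMod m))) i :=
  heckeLift_heckeGen _ _ _ _ _ i

theorem one_add_one_ne_zero (hm : 3 ≤ m) : (1 : ZMod m) + 1 ≠ 0 := by
  have := two_mul_natCast_ne_zero (m := m) (j := 1) one_ne_zero (by omega)
  simpa using this

theorem trace_altProd_mdl_one (hm : 3 ≤ m) (i : Fin 2) (n : ℕ) :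
    (altProd (mdl 1 (cosVal (1 : ZMod m))) i n).trace =
      if n % 2 = 0 then cosVal (((n / 2 : ℕ) : ZMod m)) else 0 := by
  set c := cosVal (1 : ZMod m) with hc
  have htr : (mdl 1 c i * mdl 1 c (1 - i)).trace = c := by
    rcases fin_two_cases i with rfl | rfl
    · simpa using trace_mdl_mul 1 c
    · rw [Matrix.trace_mul_comm]; simpa using trace_mdl_mul 1 c
  have hdet : (mdl 1 c i * mdl 1 c (1 - i)).det = 1 := by
    rw [Matrix.det_mul, det_mdl, det_mdl]; ring
  have h1 : (ZMod.stdAddChar (1 : ZMod m) : ℂ) * ZMod.stdAddChar (-1 : ZMod m) = 1 := by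
    rw [← AddChar.map_add_eq_mul, add_neg_cancel, AddChar.map_zero_eq_one]
  have hpow : ∀ k : ℕ, cosVal ((k : ZMod m)) =
      (ZMod.stdAddChar (1 : ZMod m) : ℂ) ^ k + ZMod.stdAddChar (-1 : ZMod m) ^ k := by
    intro k
    rw [← AddChar.map_nsmul_eq_pow, ← AddChar.map_nsmul_eq_pow, cosVal]
    simp
  rcases Nat.even_or_odd' n with ⟨k, rfl | rfl⟩
  · rw [if_pos (by omega), altProd_two_mul, Nat.mul_div_cancel_left _ two_pos, hpow]
    rcases k with _ | k
    · simp; norm_num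
    · rw [mat_pow, hdet, htr, Matrix.trace_sub, Matrix.trace_smul, Matrix.trace_smul, htr,
        Matrix.trace_one, smul_eq_mul, smul_eq_mul, one_mul]
      have hne : (ZMod.stdAddChar (1 : ZMod m) : ℂ) - ZMod.stdAddChar (-1 : ZMod m) ≠ 0 := by
        intro h0
        have := ZMod.injective_stdAddChar (sub_eq_zero.1 h0)
        exact one_add_one_ne_zero hm (eq_neg_iff_add_eq_zero.1 this)
      have h2 := sub_mul_cheb h1 (k + 1)
      have h3 := sub_mul_cheb h1 k
      apply mul_left_cancel₀ hne
      have hc' : c = (ZMod.stdAddChar (1 : ZMod m) : ℂ) + ZMod.stdAddChar (-1 : ZMod m) := rfl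
      rw [← hc'] at h2 h3
      set z : ℂ := ZMod.stdAddChar (1 : ZMod m)
      set z' : ℂ := ZMod.stdAddChar (-1 : ZMod m)
      have : ((Fintype.card (Fin 2) : ℕ) : ℂ) = 2 := by simp
      rw [this]
      rw [hc'] at h2 h3 ⊢
      linear_combination (z + z') * h2 - 2 * h3 + (2 * z ^ k - 2 * z' ^ k) * h1
  · rw [if_neg (by omega), altProd_two_mul_add_one]
    rcases k with _ | k
    · simp [trace_mdl]
    · have h2 : (mdl 1 c i * mdl 1 c (1 - i) * mdl 1 c i).trace = 0 := by
        rw [Matrix.trace_mul_comm, ← mul_assoc, mat_sq, trace_mdl, det_mdl, sub_mul,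
          smul_mul_assoc, smul_mul_assoc, one_mul]
        simp [trace_mdl]
      rw [mat_pow, sub_mul, smul_mul_assoc, smul_mul_assoc, one_mul, Matrix.trace_sub,
        Matrix.trace_smul, Matrix.trace_smul, trace_mdl, h2]
      simp

theorem deforms_reflHeckeRep {h : ℕ} (hh : m = 2 * (h + 2)) :
    Deforms (reflHeckeRep m hh) (dih m 1) := by
  have hm : 3 ≤ m := by omega
  intro w
  have e : (reflHeckeRep m hh (heckeT X w)).trace.eval 1 =
      (((redWord m w).map (mdl 1 (cosVal (1 : ZMod m)))).prod).trace := by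
    rw [map_heckeT]
    simp only [reflHeckeRep_gen]
    have h1 := map_list_prod (evalRingHom (1 : ℂ)).mapMatrix
      ((redWord m w).map fun i => mdl X (C (cosVal (1 : ZMod m))) i)
    rw [List.map_map] at h1
    have h2 : ((evalRingHom (1 : ℂ)).mapMatrix ∘ fun i => mdl X (C (cosVal (1 : ZMod m))) i) =
        mdl 1 (cosVal (1 : ZMod m)) := by
      ext i : 1
      rw [Function.comp_apply, RingHom.mapMatrix_apply, map_mdl]
      simp
    rw [h2] at h1
    rw [← h1]
    simp [Matrix.trace_fin_two]
  rw [e]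
  have hw : ∀ i n, (((altWord i n).map (mdl 1 (cosVal (1 : ZMod m)))).prod).trace =
      if n % 2 = 0 then cosVal (((n / 2 : ℕ) : ZMod m)) else 0 := trace_altProd_mdl_one hm
  rcases w with k | k
  · rw [dih_r, cosVal_eq]
    simp only [redWord]
    split_ifs
    · rw [hw, if_pos (by omega), Nat.mul_div_cancel_left _ two_pos, ZMod.natCast_zmod_val]
    · rw [hw, if_pos (by omega), Nat.mul_div_cancel_left _ two_pos, Nat.cast_sub (ZMod.val_lt k).le,
        ZMod.natCast_zmod_val, ZMod.natCast_self, zero_sub, cosVal, cosVal, neg_neg, add_comm]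
  · rw [dih_sr]
    simp only [redWord]
    split_ifs
    · rw [hw, if_neg (by omega)]
    · rw [hw, if_neg (by omega)]
    · rw [hw, if_neg (by omega)]

theorem exists_real_cosVal (i : ZMod m) : ∃ r : ℝ, cosVal i = r := by
  rw [cosVal, AddChar.map_neg_eq_conj]
  exact ⟨_, Complex.add_conj _⟩

/-- The q-order is exactly 1 because q times the Schur element does not vanish at q = 0. There only
the reflections contribute; they are involutions and all numbers are real, so the sum is one of
squares, and the simple reflection contributes 1. -/
theorem isSpecial_reflChar {h : ℕ} (hh : m = 2 * (h + 2)) : IsSpecial (chr m (.line 1)) := by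
  have hm : 3 ≤ m := by omega
  have hchr : chr m (.line 1) = dih m 1 := by simp [chr]
  set ρ := reflHeckeRep m hh with hρ
  refine ⟨2, ρ, by rw [hchr]; exact deforms_reflHeckeRep hh, ?_⟩
  rw [b_chr hm (show Lab.Valid m (.line 1) by simp only [Lab.Valid]; omega)]
  obtain ⟨r, hr⟩ := exists_real_cosVal (1 : ZMod m)
  have hg : (fun i => ρ (heckeGen X m i)) = mdl X (C (cosVal (1 : ZMod m))) :=
    funext (reflHeckeRep_gen hh)
  choose τ hτ using trace_heckeT_dvd ρ (by
    rw [hg]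
    exact dvd_trace_altProd (trace_mdl _ _) (det_mdl _ _) (by rw [trace_mdl_mul]; exact ⟨_, rfl⟩))
  have hreal : ∀ w, ∃ s : ℝ, (τ w).eval 0 = s := by
    intro w
    have h1 : ∃ p : ℝ[X], (ρ (heckeT X w)).trace = p.map Complex.ofRealHom := by
      obtain ⟨i, hi⟩ := exists_redWord_eq w
      refine ⟨(altProd (mdl X (C r)) i (redWord m w).length).trace, ?_⟩
      rw [map_heckeT, hi, length_altWord]
      change (altProd (fun i => ρ (heckeGen X m i)) i _).trace = _
      rw [hg]
      have h2 := map_altProd (mapRingHom Complex.ofRealHom).mapMatrix (mdl X (C r)) i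
        (redWord m w).length
      have h3 : (fun j => (mapRingHom Complex.ofRealHom).mapMatrix (mdl X (C r) j)) =
          mdl X (C (cosVal (1 : ZMod m))) := by
        ext j : 1
        rw [RingHom.mapMatrix_apply, map_mdl, hr]
        simp
      rw [h3] at h2
      rw [← h2]
      simp [Matrix.trace_fin_two]
    obtain ⟨p, hp⟩ := h1
    rw [hτ] at hp
    have h4 := congrArg (fun f => f.coeff ((redWord m w).length / 2)) hp
    simp only [coeff_map] at h4
    have h5 := coeff_X_pow_mul (τ w) ((redWord m w).length / 2) 0
    rw [zero_add] at h5
    rw [h5, coeff_zero_eq_eval_zero] at h4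
    exact ⟨_, h4⟩
  choose s hs using hreal
  rw [genericDegree_eq ρ (q_mul_schurElement ρ τ hτ), qOrder_div_eq (poincare_mul_X_ne_zero hm),
    natTrailingDegree_poincare_mul_X hm]
  · rfl
  rw [coeff_zero_eq_eval_zero, eval_mul, eval_C, eval_finsetSum]
  refine mul_ne_zero (by norm_num) ?_
  have hterm : ∀ w : DihedralGroup m,
      eval 0 (X ^ (((redWord m w).length + 1) % 2) * (τ w * τ w⁻¹)) =
      ((if (redWord m w).length % 2 = 1 then s w ^ 2 else 0 : ℝ) : ℂ) := by
    intro w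
    simp only [eval_mul, eval_pow, eval_X]
    split_ifs with hl
    · have hw : w⁻¹ = w := by
        rcases w with k | k
        · exfalso
          simp only [redWord] at hl
          split_ifs at hl <;> rw [length_altWord] at hl <;> omega
        · rfl
      rw [show ((redWord m w).length + 1) % 2 = 0 by omega, hw, hs]
      push_cast; ring
    · rw [show ((redWord m w).length + 1) % 2 = 1 by omega]
      simp
  rw [Finset.sum_congr rfl fun w _ => hterm w, ← Complex.ofReal_sum, Complex.ofReal_ne_zero]
  apply ne_of_gt
  refine Finset.sum_pos' (fun w _ => ?_) ⟨.sr 0, Finset.mem_univ _, ?_⟩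
  · split_ifs
    · positivity
    · exact le_rfl
  · have h1 := hτ (.sr 0)
    rw [map_heckeT, redWord_sr_zero] at h1
    have h2 : τ (.sr 0) = X - 1 := by
      have h3 : (ρ (heckeGen X m 0)).trace = X - 1 := by
        rw [hρ, reflHeckeRep_gen, trace_mdl]
      simpa [h3] using h1.symm
    have h3 := hs (.sr 0)
    rw [h2] at h3
    simp only [eval_sub, eval_X, eval_one, zero_sub] at h3
    have h4 : s (.sr 0) = -1 := by exact_mod_cast h3.symm
    rw [redWord_sr_zero, h4]
    simp

/-! ### The block of the reflection character -/

/-! ### Two-dimensional representations determined by the trace of T₀T₁ -/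

section pencil

variable {K : Type*} [Field K]

/-- `x` acts by the same linear combination of `1, A, B, AB` in two pairs of matrices. -/
def SamePencil (A B A' B' X Y : Matrix (Fin 2) (Fin 2) K) : Prop :=
  ∃ a b c d : K, X = a • 1 + b • A + c • B + d • (A * B) ∧
    Y = a • 1 + b • A' + c • B' + d • (A' * B')

theorem pencil_mul_left {x a b c d : K} {A B : Matrix (Fin 2) (Fin 2) K}
    (hA : A * A = (x - 1) • A + x • 1) :
    A * (a • 1 + b • A + c • B + d • (A * B)) =
      (b * x) • 1 + (a + b * (x - 1)) • A + (d * x) • B + (c + d * (x - 1)) • (A * B) := by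
  simp only [mul_add, mul_smul_comm, mul_one, ← mul_assoc, hA, add_mul, smul_mul_assoc, one_mul]
  module

theorem pencil_mul_left' {x k a b c d : K} {A B : Matrix (Fin 2) (Fin 2) K}
    (hB : B * B = (x - 1) • B + x • 1) (hAB : A * B + B * A = k • 1 + (x - 1) • (A + B)) :
    B * (a • 1 + b • A + c • B + d • (A * B)) =
      (b * k + c * x + d * (x - 1) * x) • 1 + (b * (x - 1) - d * x) • A +
      (a + b * (x - 1) + c * (x - 1) + d * (k + (x - 1) * (x - 1))) • B + (-b) • (A * B) := by
  have h : B * A = k • 1 + (x - 1) • (A + B) - A * B := eq_sub_of_add_eq' hAB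
  simp only [mul_add, mul_smul_comm, mul_one, ← mul_assoc, h, hB]
  simp only [add_mul, sub_mul, smul_mul_assoc, one_mul, mul_assoc, hB, mul_add, mul_smul_comm,
    mul_one]
  module

end pencil

theorem q_add_one_ne_zero : q + 1 ≠ 0 := by
  have := q_sub_C_ne_zero (-1)
  simpa using this

theorem map_mdl_ofPoly (x c : ℂ[X]) (i : Fin 2) :
    (mdl x c i).map ofPoly = mdl (ofPoly x) (ofPoly c) i :=
  map_mdl (algebraMap ℂ[X] (RatFunc ℂ)) x c i

/-- A deformation of `χ₁` has the same parameter as the explicit one. -/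
theorem IsDihPair.trace_eq {h : ℕ} (hh : m = 2 * (h + 2))
    {g : Fin 2 → Matrix (Fin 2) (Fin 2) ℂ[X]} (hg : IsDihPair m 1 g) :
    (g 0 * g 1).trace = X * C (cosVal (1 : ZMod m)) := by
  obtain ⟨s, hs⟩ := hg.X_dvd (by omega)
  have h1 := hg.cheb_even (h := h + 1) hh
  have h2 := hg.eval
  rw [cosVal_eq] at h2
  rw [hs, cheb_mul] at h1
  have h3 := (mul_eq_zero.1 h1).resolve_left (pow_ne_zero _ X_ne_zero)
  -- A nonconstant s would take the value 2 somewhere, but the Chebyshev value at 2 is m/2 ≠ 0. So s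
  -- is constant, and q = 1 determines it.
  have h4 : s.natDegree = 0 := by
    by_contra hdeg
    have hdeg' : (s - C 2).degree ≠ 0 := by
      intro h0
      apply hdeg
      rw [← natDegree_sub_C (a := (2 : ℂ))]
      exact natDegree_eq_of_degree_eq_some h0
    obtain ⟨a, ha⟩ := IsAlgClosed.exists_root _ hdeg'
    have h5 := congrArg (evalRingHom a) h3
    rw [map_cheb] at h5
    simp only [IsRoot, eval_sub, eval_C, sub_eq_zero] at ha
    simp only [coe_evalRingHom, ha, eval_one, cheb_two, eval_zero] at h5
    have : ((h + 1 + 1 : ℕ) : ℂ) ≠ 0 := Nat.cast_ne_zero.2 (by omega)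
    exact this h5
  have h5 := eq_C_of_natDegree_eq_zero h4
  rw [hs, h5] at h2
  simp only [eval_mul, eval_X, eval_C, one_mul] at h2
  rw [hs, h5, h2]

section

variable {A K : Type} [CommRing A] [Field K] [Algebra A K] {Q : A} {m : ℕ}

theorem algHom_quadratic {n : ℕ} (φ : Hecke A Q m →ₐ[A] Matrix (Fin n) (Fin n) K) (i : Fin 2) :
    φ (heckeGen Q m i) * φ (heckeGen Q m i) =
      (algebraMap A K Q - 1) • φ (heckeGen Q m i) + (algebraMap A K Q) • 1 := by
  rw [← map_mul, heckeGen_quadratic, map_add, map_mul, AlgHom.commutes, AlgHom.commutes,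
    Algebra.algebraMap_eq_smul_one, Algebra.algebraMap_eq_smul_one, smul_mul_assoc, one_mul,
    ← algebraMap_smul K (Q - 1), ← algebraMap_smul K Q, map_sub, map_one]

/-- The character of a two-dimensional representation in which both generators have two eigenvalues
is determined by the trace of the product of the generators. -/
theorem trace_eq_of_trace_mul_eq (φ ψ : Hecke A Q m →ₐ[A] Matrix (Fin 2) (Fin 2) K)
    (hφ : ∀ i, (φ (heckeGen Q m i)).trace = algebraMap A K Q - 1)
    (hψ : ∀ i, (ψ (heckeGen Q m i)).trace = algebraMap A K Q - 1)
    (h : (φ (heckeGen Q m 0) * φ (heckeGen Q m 1)).trace =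
      (ψ (heckeGen Q m 0) * ψ (heckeGen Q m 1)).trace) (x : Hecke A Q m) :
    (φ x).trace = (ψ x).trace := by
  -- Every element acts as a combination of 1, T₀, T₁, T₀T₁ with the same coefficients in both
  -- representations, because left multiplication by a generator transforms the coefficients through
  -- Q and tr(T₀T₁) only.
  have key : SamePencil (φ (heckeGen Q m 0)) (φ (heckeGen Q m 1)) (ψ (heckeGen Q m 0))
      (ψ (heckeGen Q m 1)) (φ x) (ψ x) := by
    refine hecke_induction (p := fun x => SamePencil (φ (heckeGen Q m 0)) (φ (heckeGen Q m 1))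
      (ψ (heckeGen Q m 0)) (ψ (heckeGen Q m 1)) (φ x) (ψ x)) ?_ ?_ ?_ ?_ x
    · exact ⟨1, 0, 0, 0, by simp, by simp⟩
    · rintro r x ⟨a, b, c, d, h1, h2⟩
      refine ⟨algebraMap A K r * a, algebraMap A K r * b, algebraMap A K r * c,
        algebraMap A K r * d, ?_, ?_⟩
      · rw [map_smul, h1, ← algebraMap_smul K r]; module
      · rw [map_smul, h2, ← algebraMap_smul K r]; module
    · rintro i x ⟨a, b, c, d, h1, h2⟩
      rcases fin_two_cases i with rfl | rfl
      · exact ⟨_, _, _, _, by rw [map_mul, h1]; exact pencil_mul_left (algHom_quadratic φ 0),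
          by rw [map_mul, h2]; exact pencil_mul_left (algHom_quadratic ψ 0)⟩
      · have h3 := mat_anticomm (hφ 0) (hφ 1)
        rw [h] at h3
        have h4 := mat_anticomm (hψ 0) (hψ 1)
        exact ⟨_, _, _, _, by rw [map_mul, h1]; exact pencil_mul_left' (algHom_quadratic φ 1) h3,
          by rw [map_mul, h2]; exact pencil_mul_left' (algHom_quadratic ψ 1) h4⟩
    · rintro x y ⟨a, b, c, d, h1, h2⟩ ⟨a', b', c', d', h3, h4⟩
      refine ⟨a + a', b + b', c + c', d + d', ?_, ?_⟩
      · rw [map_add, h1, h3]; module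
      · rw [map_add, h2, h4]; module
  obtain ⟨a, b, c, d, h1, h2⟩ := key
  rw [h1, h2]
  simp only [Matrix.trace_add, Matrix.trace_smul, hφ, hψ, h]

theorem algHom_eq_map {n : ℕ} (φ : Hecke A Q m →ₐ[A] Matrix (Fin n) (Fin n) K)
    (ψ : Hecke A Q m →ₐ[A] Matrix (Fin n) (Fin n) A)
    (h : ∀ i, φ (heckeGen Q m i) = (ψ (heckeGen Q m i)).map (algebraMap A K)) (x : Hecke A Q m) :
    φ x = (ψ x).map (algebraMap A K) := by
  change φ x = (algebraMap A K).mapMatrix (ψ x)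
  refine hecke_induction (p := fun x => φ x = (algebraMap A K).mapMatrix (ψ x)) ?_ ?_ ?_ ?_ x
  · simp only [map_one]
  · intro r x hx
    rw [map_smul, hx, map_smul]
    ext i j
    simp only [Matrix.smul_apply, RingHom.mapMatrix_apply, Matrix.map_apply, smul_eq_mul, map_mul]
    rw [Algebra.smul_def]
  · intro i x hx
    rw [map_mul, hx, h, map_mul, map_mul]
    rfl
  · intro x y hx hy
    rw [map_add, map_add, map_add, hx, hy]

/-- Matrix entries of a fixed noncommutative polynomial are polynomials in c. This produces the
congruences between the values of a central idempotent. -/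
theorem dvd_lift_mdl_sub {R : Type} [CommRing R] (x c c' : R) (y : FreeAlgebra R (Fin 2))
    (r s : Fin 2) : c - c' ∣
      FreeAlgebra.lift R (mdl x c) y r s - FreeAlgebra.lift R (mdl x c') y r s := by
  induction y using FreeAlgebra.induction generalizing r s with
  | grade0 a => simp
  | grade1 i =>
    rw [FreeAlgebra.lift_ι_apply, FreeAlgebra.lift_ι_apply]
    fin_cases i <;> fin_cases r <;> fin_cases s <;> simp [mdl]
  | mul a b ha hb =>
    rw [map_mul, map_mul, Matrix.mul_apply, Matrix.mul_apply, ← Finset.sum_sub_distrib]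
    refine Finset.dvd_sum fun k _ => ?_
    have e : ∀ u v u' v' : R, u * v - u' * v' = (u - u') * v + u' * (v - v') := by intros; ring
    rw [e]
    exact dvd_add ((ha _ _).mul_right _) ((hb _ _).mul_left _)
  | add a b ha hb =>
    rw [map_add, map_add, Matrix.add_apply, Matrix.add_apply, add_sub_add_comm]
    exact dvd_add (ha _ _) (hb _ _)

/-- At c = -2 the entry 2 + c vanishes and both matrices are upper triangular, so the diagonal
entries are multiplicative; they are the two middle characters. -/
theorem lift_mdl_neg_two {R : Type} [CommRing R] (x : R) (y : FreeAlgebra R (Fin 2)) :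
    FreeAlgebra.lift R (mdl x (-2)) y 1 0 = 0 ∧
    ∀ r, FreeAlgebra.lift R (mdl x (-2)) y r r =
      FreeAlgebra.lift R (fun i => (!![mdl x (-2) i r r] : Matrix (Fin 1) (Fin 1) R)) y 0 0 := by
  induction y using FreeAlgebra.induction with
  | grade0 a =>
    refine ⟨by simp [Matrix.algebraMap_matrix_apply], fun r => by
      simp [Matrix.algebraMap_matrix_apply]⟩
  | grade1 i =>
    simp only [FreeAlgebra.lift_ι_apply]
    refine ⟨?_, fun r => by simp⟩
    fin_cases i <;> simp [mdl]
  | mul a b ha hb =>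
    simp only [map_mul, Matrix.mul_apply, Fin.sum_univ_two]
    refine ⟨by rw [ha.1, hb.1]; simp, fun r => ?_⟩
    rcases fin_two_cases r with rfl | rfl
    · rw [ha.2, hb.2, hb.1]; simp
    · rw [ha.2, hb.2, ha.1]; simp
  | add a b ha hb =>
    simp only [map_add, Matrix.add_apply]
    exact ⟨by rw [ha.1, hb.1, add_zero], fun r => by rw [ha.2, hb.2]⟩

theorem heckeLift_mkAlgHom {B : Type*} [Ring B] [Algebra A B] (g : Fin 2 → B)
    (hg : ∀ i, g i * g i = algebraMap A B (Q - 1) * g i + algebraMap A B Q)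
    (hb : altProd g 0 m = altProd g 1 m) (y : FreeAlgebra A (Fin 2)) :
    heckeLift Q m g hg hb (RingQuot.mkAlgHom A (HeckeRel A Q m) y) = FreeAlgebra.lift A g y := by
  rw [heckeLift, RingQuot.liftAlgHom_mkAlgHom_apply]

end

theorem cosVal_of_two_torsion {i : ZMod m} (h0 : i ≠ 0) (h : i + i = 0) : cosVal i = -2 := by
  have h1 : (ZMod.stdAddChar i : ℂ) * ZMod.stdAddChar i = 1 := by
    rw [← AddChar.map_add_eq_mul, h, AddChar.map_zero_eq_one]
  have h2 : (ZMod.stdAddChar i : ℂ) ≠ 1 := by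
    intro h2
    rw [← AddChar.map_zero_eq_one (ZMod.stdAddChar (N := m))] at h2
    exact h0 (ZMod.injective_stdAddChar h2)
  have h3 := (mul_self_eq_one_iff.1 h1).resolve_left h2
  rw [cosVal, ← eq_neg_of_add_eq_zero_left h, h3]
  norm_num

/-- The linear representation given by a diagonal entry of the model at `c = -2`. -/
def linRep (A : Type) [CommRing A] (Q : A) (he : Even m) (r : Fin 2) :
    Hecke A Q m →ₐ[A] Matrix (Fin 1) (Fin 1) A :=
  heckeLift Q m (fun i => !![mdl Q (-2) i r r])
    (by
      intro i
      ext a b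
      fin_cases a; fin_cases b
      fin_cases i <;> fin_cases r <;> simp [mdl, Matrix.mul_apply, Matrix.algebraMap_matrix_apply] <;> try ring)
    (by
      obtain ⟨k, hk⟩ := he
      have hw : ∀ i, altProd (fun i => (!![mdl Q (-2) i r r] : Matrix (Fin 1) (Fin 1) A)) i m =
        altProd (fun i => (!![mdl Q (-2) i r r] : Matrix (Fin 1) (Fin 1) A)) i (2 * k) := by
        rw [hk, two_mul]; exact fun _ => rfl
      rw [hw, hw, altProd_two_mul, altProd_two_mul]
      congr 1
      ext a b
      fin_cases a; fin_cases b
      simp [Matrix.mul_apply, mul_comm])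

theorem linRep_gen (A : Type) [CommRing A] (Q : A) (he : Even m) (r i : Fin 2) :
    linRep A Q he r (heckeGen Q m i) = !![mdl Q (-2) i r r] :=
  heckeLift_heckeGen _ _ _ _ _ i

theorem chr_mid_mul (he : Even m) (s : Bool) (x y : DihedralGroup m) :
    chr m (.mid s) (x * y) = chr m (.mid s) x * chr m (.mid s) y := by
  have h : ∀ i j : ZMod m, (ZMod.stdAddChar (((m / 2 : ℕ) : ZMod m) * (j - i)) : ℂ) =
      ZMod.stdAddChar (((m / 2 : ℕ) : ZMod m) * i) *
        ZMod.stdAddChar (((m / 2 : ℕ) : ZMod m) * j) := by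
    intro i j
    rw [← AddChar.map_add_eq_mul, mul_sub, sub_eq_add_neg, ← neg_mul, neg_half he, add_comm]
  have h' : ∀ i j : ZMod m, (ZMod.stdAddChar (((m / 2 : ℕ) : ZMod m) * (i + j)) : ℂ) =
      ZMod.stdAddChar (((m / 2 : ℕ) : ZMod m) * i) *
        ZMod.stdAddChar (((m / 2 : ℕ) : ZMod m) * j) := by
    intro i j
    rw [← AddChar.map_add_eq_mul, mul_add]
  rcases x with i | i <;> rcases y with j | j <;> cases s <;>
    simp only [DihedralGroup.r_mul_r, DihedralGroup.r_mul_sr, DihedralGroup.sr_mul_r,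
      DihedralGroup.sr_mul_sr, chr, chiR_r he, chiR_sr he, chiR'_r he, chiR'_sr he, h, h'] <;>
    ring

theorem chr_mid_eq (hm : 3 ≤ m) (he : Even m) (s : Bool) (w : DihedralGroup m) :
    chr m (.mid s) w =
      ((redWord m w).map fun i => mdl 1 (-2 : ℂ) i (if s then 1 else 0) (if s then 1 else 0)).prod := by
  have h := congrArg (chr m (.mid s)) (prod_redWord m w)
  rw [← h]
  induction redWord m w with
  | nil => rw [List.map_nil, List.prod_nil, chr_mid_one]; rfl
  | cons i l ih =>
    rw [List.map_cons, List.prod_cons, chr_mid_mul he, ih, List.map_cons, List.prod_cons]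
    congr 1
    rcases fin_two_cases i with rfl | rfl
    · rw [show simpleRefl m 0 = .sr 0 from rfl, chr_mid_sr_zero]
      cases s <;> simp [mdl]
    · rw [show simpleRefl m 1 = .sr 1 from rfl, chr_mid_sr_one hm]
      cases s <;> simp [mdl]

theorem prod_map_fin_one {R : Type*} [CommRing R] (f : Fin 2 → R) (l : List (Fin 2)) :
    (l.map fun i => (!![f i] : Matrix (Fin 1) (Fin 1) R)).prod 0 0 = (l.map f).prod := by
  induction l with
  | nil => simp
  | cons i l ih => simp [Matrix.mul_apply, ← ih]

theorem deforms_linRep (hm : 3 ≤ m) (he : Even m) (s : Bool) :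
    Deforms (linRep ℂ[X] X he (if s then 1 else 0)) (chr m (.mid s)) := by
  intro w
  rw [map_heckeT, chr_mid_eq hm he, Matrix.trace_fin_one]
  simp only [linRep_gen]
  rw [prod_map_fin_one, ← coe_evalRingHom, map_list_prod, List.map_map]
  congr 2
  ext i
  cases s <;> fin_cases i <;> simp [mdl]

/-- A deformation of a middle character is determined on the generators, so the existential in
`ActsAsOne` can be tested on one explicit representation. -/
theorem actsAsOne_mid_iff (hm : 3 ≤ m) (he : Even m) (s : Bool) (e : RouquierHecke m) :
    ActsAsOne e (chr m (.mid s)) ↔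
      linRep rouquierRing rouquierQ he (if s then 1 else 0) e 0 0 = 1 := by
  have key : ∀ (ρ : HeckeRep m 1), (∀ i, ρ (heckeGen X m i) =
      !![mdl X (-2) i (if s then 1 else 0) (if s then 1 else 0)]) →
      ∀ φ : RouquierHecke m →ₐ[rouquierRing] Matrix (Fin 1) (Fin 1) (RatFunc ℂ),
      (∀ i, φ (heckeGen rouquierQ m i) = (ρ (heckeGen X m i)).map ofPoly) →
      (φ e = 1 ↔ linRep rouquierRing rouquierQ he (if s then 1 else 0) e 0 0 = 1) := by
    intro ρ hρ φ hφ
    rw [algHom_eq_map φ (linRep rouquierRing rouquierQ he (if s then 1 else 0))]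
    · rw [← Matrix.ext_iff]
      simp only [Fin.forall_fin_one, Matrix.map_apply, Matrix.one_apply_eq]
      exact ⟨fun h => Subtype.ext h, fun h => congrArg Subtype.val h⟩
    · intro i
      rw [hφ, hρ, linRep_gen]
      ext a b
      fin_cases a; fin_cases b
      fin_cases i <;> cases s <;> simp [mdl, ofPoly_X, ofPoly_neg, ofPoly_one] <;> rfl
  constructor
  · rintro ⟨n, ρ, φ, hρ, hφ, h1⟩
    have hn := hρ.degree
    rw [chr_mid_one] at hn
    have hn1 : n = 1 := by exact_mod_cast hn
    subst hn1
    refine (key ρ ?_ φ hφ).1 h1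
    intro i
    have hmid := hρ.mid hm
    ext a b : 1
    fin_cases a; fin_cases b
    rcases fin_two_cases i with rfl | rfl
    · refine hmid.1.trans ?_
      cases s <;> simp [mdl]
    · refine hmid.2.trans ?_
      cases s <;> simp [mdl]
  · intro h
    obtain ⟨φ, hφ⟩ : ∃ φ : RouquierHecke m →ₐ[rouquierRing] Matrix (Fin 1) (Fin 1) (RatFunc ℂ),
        ∀ i, φ (heckeGen rouquierQ m i) =
          (linRep ℂ[X] X he (if s then 1 else 0) (heckeGen X m i)).map ofPoly := by
      refine ⟨(AlgHom.mapMatrix (Algebra.ofId rouquierRing (RatFunc ℂ))).comp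
        (linRep rouquierRing rouquierQ he (if s then 1 else 0)), ?_⟩
      intro i
      rw [AlgHom.comp_apply, linRep_gen, linRep_gen]
      ext a b
      fin_cases a; fin_cases b
      fin_cases i <;> cases s <;> simp [mdl, ofPoly_X, ofPoly_neg, ofPoly_one] <;> rfl
    exact ⟨1, _, φ, deforms_linRep hm he s, hφ, (key _ (linRep_gen _ _ _ _) φ hφ).2 h⟩

/-- The representation of the Hecke algebra over the Rouquier ring with parameter
`2 cos(2πi/m)`. -/
def modelRep {h : ℕ} (hh : m = 2 * (h + 2)) {i : ZMod m} (hi : i + i ≠ 0) :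
    RouquierHecke m →ₐ[rouquierRing] Matrix (Fin 2) (Fin 2) rouquierRing :=
  heckeLift rouquierQ m (mdl rouquierQ (cosR i)) (mdl_quadratic _ _)
    (mdl_braid (show m = 2 * (h + 1 + 1) from hh) (cheb_cosR hh hi))

theorem modelRep_gen {h : ℕ} (hh : m = 2 * (h + 2)) {i : ZMod m} (hi : i + i ≠ 0) (r : Fin 2) :
    modelRep hh hi (heckeGen rouquierQ m r) = mdl rouquierQ (cosR i) r :=
  heckeLift_heckeGen _ _ _ _ _ r

theorem rouquierQ_ne_zero : rouquierQ ≠ 0 := fun h => q_ne_zero (congrArg Subtype.val h)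

theorem rouquierQ_add_one_ne_zero : rouquierQ + 1 ≠ 0 :=
  fun h => q_add_one_ne_zero (congrArg Subtype.val h)

theorem eq_zero_or_one_of_mul_self {R : Type*} [CommRing R] [IsDomain R] {x : R}
    (h : x * x = x) : x = 0 ∨ x = 1 := by
  have h1 : x * (x - 1) = 0 := by linear_combination h
  exact (mul_eq_zero.1 h1).imp_right sub_eq_zero.1

theorem modelRep_idempotent {h : ℕ} (hh : m = 2 * (h + 2)) {i : ZMod m} (hi : i + i ≠ 0)
    {e : RouquierHecke m} (hc : e ∈ Subalgebra.center rouquierRing (RouquierHecke m))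
    (he : IsIdempotentElem e) : modelRep hh hi e = 0 ∨ modelRep hh hi e = 1 := by
  obtain ⟨h01, h10, h00⟩ := scalar_of_commute_mdl (c := cosR i) rouquierQ_ne_zero
    rouquierQ_add_one_ne_zero (E := modelRep hh hi e) (by
      intro r
      rw [← modelRep_gen hh hi, ← map_mul, ← map_mul, (Subalgebra.mem_center_iff.1 hc) _])
  have h1 : modelRep hh hi e * modelRep hh hi e = modelRep hh hi e := by rw [← map_mul, he.eq]
  have h2 := congrFun (congrFun h1 0) 0
  rw [Matrix.mul_apply, Fin.sum_univ_two, h01, zero_mul, add_zero] at h2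
  refine (eq_zero_or_one_of_mul_self h2).imp (fun h3 => ?_) (fun h3 => ?_)
  · ext a b : 1
    fin_cases a <;> fin_cases b
    · exact h3
    · exact h01
    · exact h10
    · exact h00.symm.trans h3
  · ext a b : 1
    fin_cases a <;> fin_cases b
    · exact h3
    · exact h01
    · exact h10
    · exact h00.symm.trans h3

/-- The value of a central idempotent is carried from the parameter of χ_1 to that of the middle
characters, c = -2, through the parameters 2cos(2πi/m) with i ≠ 0. -/
theorem linRep_eq_modelRep {h : ℕ} (hh : m = 2 * (h + 2)) (heven : Even m)
    (h1 : (1 : ZMod m) + 1 ≠ 0) {e : RouquierHecke m}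
    (hc : e ∈ Subalgebra.center rouquierRing (RouquierHecke m)) (he : IsIdempotentElem e)
    (r : Fin 2) : linRep rouquierRing rouquierQ heven r e 0 0 = modelRep hh h1 e r r := by
  obtain ⟨y, rfl⟩ := RingQuot.mkAlgHom_surjective rouquierRing (HeckeRel rouquierRing rouquierQ m) e
  set e := RingQuot.mkAlgHom rouquierRing (HeckeRel rouquierRing rouquierQ m) y with hedef
  -- Defined on a preimage in the free algebra, since the two-by-two model at i = m/2 need not
  -- satisfy the braid relation; only its diagonal entries are used there.
  set ω : ZMod m → rouquierRing :=
    fun i => FreeAlgebra.lift rouquierRing (mdl rouquierQ (cosR i)) y r r with hω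
  have hmodel : ∀ {i : ZMod m} (hi : i + i ≠ 0), modelRep hh hi e r r = ω i := by
    intro i hi
    rw [modelRep, hedef, heckeLift_mkAlgHom]
  have hlin : ∀ {i : ZMod m}, i ≠ 0 → i + i = 0 →
      ω i = linRep rouquierRing rouquierQ heven r e 0 0 := by
    intro i h0 hi
    have hcos : cosR i = -2 := by
      apply Subtype.ext
      change RatFunc.C (cosVal i) = -2
      rw [cosVal_of_two_torsion h0 hi, map_neg, map_ofNat]
    rw [linRep, hedef, heckeLift_mkAlgHom, ← (lift_mdl_neg_two rouquierQ y).2 r, ← hcos]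
  have h01 : ∀ i : ZMod m, i ≠ 0 → ω i = 0 ∨ ω i = 1 := by
    intro i h0
    by_cases hi : i + i = 0
    · rw [hlin h0 hi]
      apply eq_zero_or_one_of_mul_self
      have h2 : linRep rouquierRing rouquierQ heven r e * linRep rouquierRing rouquierQ heven r e =
        linRep rouquierRing rouquierQ heven r e := by rw [← map_mul, he.eq]
      have h3 := congrFun (congrFun h2 0) 0
      rwa [Matrix.mul_apply, Fin.sum_univ_one] at h3
    · rw [← hmodel hi]
      rcases modelRep_idempotent hh hi hc he with h2 | h2 <;> rw [h2]
      · exact Or.inl rfl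
      · exact Or.inr (Matrix.one_apply_eq r)
  -- Values 0 and 1 cannot occur at neighbouring parameters: their difference is a unit, yet
  -- divisible by a non-unit.
  have hsteps := eq_of_prime_power_steps (by omega) heven ω (by
    intro p a i j hp hi hj hij
    have hnu := not_isUnit_cosR_sub hp hij
    have hd : cosR i - cosR j ∣ ω i - ω j := dvd_lift_mdl_sub _ _ _ _ _ _
    rcases h01 i hi with h2 | h2 <;> rcases h01 j hj with h3 | h3 <;> rw [h2, h3] at hd ⊢
    · exact absurd (isUnit_of_dvd_unit hd (by simp)) hnu
    · exact absurd (isUnit_of_dvd_unit hd (by simp)) hnu)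
  have hhalf : ((m / 2 : ℕ) : ZMod m) ≠ 0 := by
    rw [Ne, ZMod.natCast_eq_zero_iff]
    exact Nat.not_dvd_of_pos_of_lt (by omega) (by omega)
  rw [hmodel, ← hlin hhalf (half_add_half heven), hsteps]

/-- All deformations of χ_1 have the same character by `IsDihPair.trace_eq`, and the idempotent is 0
or 1 in the model, so the trace distinguishes the two cases. -/
theorem actsAsOne_reflChar_iff {h : ℕ} (hh : m = 2 * (h + 2)) (h1 : (1 : ZMod m) + 1 ≠ 0)
    {e : RouquierHecke m} (hc : e ∈ Subalgebra.center rouquierRing (RouquierHecke m))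
    (he : IsIdempotentElem e) (r : Fin 2) :
    ActsAsOne e (chr m (.line 1)) ↔ modelRep hh h1 e r r = 1 := by
  have hchr : chr m (.line 1) = dih m 1 := by simp [chr]
  set φ₁ := (AlgHom.mapMatrix (Algebra.ofId rouquierRing (RatFunc ℂ))).comp (modelRep hh h1)
  have hφ₁ : ∀ x, φ₁ x = (modelRep hh h1 x).map (algebraMap rouquierRing (RatFunc ℂ)) :=
    fun _ => rfl
  have hφ₁g : ∀ i, φ₁ (heckeGen rouquierQ m i) = mdl q (RatFunc.C (cosVal (1 : ZMod m))) i := by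
    intro i
    rw [hφ₁, modelRep_gen, map_mdl]
    rfl
  rw [hchr]
  constructor
  · rintro ⟨n, ρ, φ, hρ, hφ, hone⟩
    have hn := hρ.degree
    rw [DihedralGroup.one_def, dih_r] at hn
    have hn2 : n = 2 := by
      have : (n : ℂ) = (2 : ℕ) := by rw [hn]; simp [cosSum]; norm_num
      exact_mod_cast this
    subst hn2
    have hg := hρ.isDihPair (by omega) one_ne_zero (by omega)
    have hmt : ∀ M : Matrix (Fin 2) (Fin 2) ℂ[X], (M.map ofPoly).trace = ofPoly M.trace := by
      intro M
      simp [Matrix.trace_fin_two, ofPoly_add]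
    have htr : (φ e).trace = (φ₁ e).trace := by
      refine trace_eq_of_trace_mul_eq φ φ₁ ?_ ?_ ?_ e
      · intro i
        rw [hφ, hmt, hg.trace, ofPoly_sub, ofPoly_X, ofPoly_one]
        rfl
      · intro i
        rw [hφ₁g, trace_mdl]
        rfl
      · have h2 : (ρ (heckeGen X m 0) * ρ (heckeGen X m 1)).map ofPoly =
            (ρ (heckeGen X m 0)).map ofPoly * (ρ (heckeGen X m 1)).map ofPoly :=
          map_mul (algebraMap ℂ[X] (RatFunc ℂ)).mapMatrix _ _
        rw [hφ, hφ, ← h2, hmt, hg.trace_eq hh, hφ₁g, hφ₁g, trace_mdl_mul, ofPoly_mul, ofPoly_X,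
          ofPoly_C]
    rcases modelRep_idempotent hh h1 hc he with h2 | h2
    · exfalso
      rw [hone, hφ₁, h2] at htr
      simp [Matrix.trace_fin_two] at htr
    · rw [h2, Matrix.one_apply_eq]
  · intro h2
    refine ⟨2, reflHeckeRep m hh, φ₁, deforms_reflHeckeRep hh, ?_, ?_⟩
    · intro i
      rw [hφ₁g, reflHeckeRep_gen, map_mdl_ofPoly, ofPoly_X, ofPoly_C]
    · rcases modelRep_idempotent hh h1 hc he with h3 | h3
      · rw [h3] at h2
        exact absurd h2 zero_ne_one
      · rw [hφ₁, h3]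
        exact map_one (algebraMap rouquierRing (RatFunc ℂ)).mapMatrix

/-- For even `m` the linear characters other than the trivial and the sign character lie in the
family of the reflection character. -/
theorem sameFamily_reflChar_mid (hm : 3 ≤ m) (heven : Even m) (s : Bool) :
    SameFamily (chr m (.line 1)) (chr m (.mid s)) := by
  intro e hc he
  obtain ⟨k, hk⟩ := heven
  have hh : m = 2 * ((k - 2) + 2) := by omega
  have heven : Even m := ⟨k, hk⟩
  rw [actsAsOne_reflChar_iff hh (one_add_one_ne_zero hm) hc he (if s then 1 else 0),
    actsAsOne_mid_iff hm heven, linRep_eq_modelRep hh heven (one_add_one_ne_zero hm) hc he]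

/-! ### Green systems and linear relations between rows of `Ω` -/

/-- A linear relation between the rows of `Ω` restricted to a closed set of columns carries over
to the rows of `P`. -/
theorem green_regression {ι K : Type*} [Fintype ι] [DecidableEq ι] [Field K]
    {P Λ Ω : Matrix ι ι K} {r : ι → ι → Prop} (htot : ∀ i j, r i j ∨ r j i)
    (htrans : ∀ i j k, r i j → r j k → r i k) (hP : ∀ i j, i ≠ j → r i j → P i j = 0)
    (hP0 : ∀ i, P i i ≠ 0) (hΛ : ∀ i j, ¬ (r i j ∧ r j i) → Λ i j = 0)
    (heq : P * Λ * P.transpose = Ω) (hΩ : Ω.det ≠ 0) {L : ι → Prop}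
    (hL : ∀ i j, L j → r i j → L i) {v : ι → K} (hv : ∀ i, L i → Matrix.vecMul v Ω i = 0) :
    ∀ i, L i → Matrix.vecMul v P i = 0 := by
  classical
  set u := Matrix.vecMul v P with hu
  set w := Matrix.vecMul u Λ with hw
  have hvw : ∀ i, L i → ∑ j, w j * P i j = 0 := by
    intro i hi
    have h := hv i hi
    rw [← heq, ← Matrix.vecMul_vecMul, ← Matrix.vecMul_vecMul] at h
    exact h
  -- Induction along the supports: in the equation for i all columns other than i itself and those
  -- of strictly smaller support drop out, and the latter again lie in L.
  have hw0 : ∀ i, L i → w i = 0 := by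
    let s : ι → ι → Prop := fun i j => r i j ∧ ¬ r j i
    have : IsTrans ι s := ⟨fun i j k h h' => ⟨htrans _ _ _ h.1 h'.1, fun h'' =>
      h.2 (htrans _ _ _ h'.1 h'')⟩⟩
    have : Std.Irrefl s := ⟨fun i h => h.2 h.1⟩
    have hwf : WellFounded s := Finite.wellFounded_of_trans_of_irrefl s
    intro i
    induction i using hwf.induction with
    | _ i ih =>
      intro hi
      have h := hvw i hi
      rw [Finset.sum_eq_single i] at h
      · exact (mul_eq_zero.1 h).resolve_right (hP0 i)
      · intro j _ hj
        by_cases hij : r i j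
        · rw [hP i j hj.symm hij, mul_zero]
        · have hji := (htot i j).resolve_left hij
          rw [ih j ⟨hji, hij⟩ (hL j i hi hji), zero_mul]
      · simp
  have hdet : Λ.det ≠ 0 := by
    intro h0
    apply hΩ
    rw [← heq, Matrix.det_mul, Matrix.det_mul, h0, mul_zero, zero_mul]
  -- As Λ is block diagonal and L a union of blocks, the truncation of u = vP to L is killed by Λ,
  -- which is invertible together with Ω.
  have hz : Matrix.vecMul (fun i => if L i then u i else 0) Λ = 0 := by
    ext j
    by_cases hj : L j
    · have h := hw0 j hj
      rw [hw] at h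
      refine Eq.trans ?_ h
      refine Finset.sum_congr rfl fun i _ => ?_
      change (if L i then u i else 0) * Λ i j = u i * Λ i j
      by_cases hi : L i
      · simp only [if_pos hi]
      · rw [hΛ i j fun h => hi (hL i j hj h.1), mul_zero, mul_zero]
    · refine Finset.sum_eq_zero fun i _ => ?_
      change (if L i then u i else 0) * Λ i j = 0
      by_cases hi : L i
      · rw [hΛ i j fun h => hj (hL j i hi h.2), mul_zero]
      · simp only [if_neg hi, zero_mul]
  have h := Matrix.eq_zero_of_vecMul_eq_zero hdet hz
  intro i hi
  have h2 := congrFun h i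
  simp only [if_pos hi] at h2
  exact h2

/-- The fake degrees as polynomials. -/
def RdegPoly (m : ℕ) : Lab → ℂ[X]
  | .line j => if j = 0 then 1 else X ^ j + X ^ (m - j)
  | .mid _ => X ^ (m / 2)
  | .sgn => X ^ m

/-- The kernel as a polynomial. -/
def KerPoly (m : ℕ) : Lab → Lab → ℂ[X]
  | .line i, .line j => X ^ (i + j) + X ^ (m - (max i j - min i j))
  | .line i, .mid _ => X ^ (i + m / 2)
  | .mid _, .line i => X ^ (i + m / 2)
  | .mid s, .mid t => if s = t then X ^ m else 0
  | .sgn, _ => 0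
  | .mid _, .sgn => 0
  | .line _, .sgn => 0

theorem ofPoly_RdegPoly (a : Lab) : ofPoly (RdegPoly m a) = Rdeg m a := by
  cases a <;> simp only [RdegPoly, Rdeg, apply_ite ofPoly, ofPoly_add, ofPoly_pow, ofPoly_X,
    ofPoly_one]

theorem ofPoly_KerPoly (a a' : Lab) : ofPoly (KerPoly m a a') = Ker m a a' := by
  cases a <;> cases a' <;> simp only [KerPoly, Ker, apply_ite ofPoly, ofPoly_add, ofPoly_pow,
    ofPoly_X, ofPoly_zero]

theorem RdegPoly_natDegree_le (hm : 3 ≤ m) {a : Lab} (ha : a.Valid m) :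
    (RdegPoly m a).natDegree ≤ m ∧ (RdegPoly m a).coeff m = if a = .sgn then 1 else 0 := by
  cases a with
  | line j =>
    have hj : 2 * j < m := ha
    simp only [RdegPoly]
    split_ifs with h h'
    · simp at h'
    · exact ⟨by simp, by rw [coeff_one, if_neg (by omega)]⟩
    · simp_all
    · refine ⟨natDegree_add_le_of_degree_le ((natDegree_X_pow_le _).trans (by omega))
        ((natDegree_X_pow_le _).trans (by omega)), ?_⟩
      rw [coeff_add, coeff_X_pow, coeff_X_pow, if_neg (by omega), if_neg (by omega), add_zero]
  | mid s =>
    simp only [RdegPoly]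
    exact ⟨(natDegree_X_pow_le _).trans (by omega), by rw [coeff_X_pow, if_neg (by omega)]; simp⟩
  | sgn => exact ⟨natDegree_X_pow_le _, by simp [RdegPoly]⟩

theorem KerPoly_natDegree_le (hm : 3 ≤ m) {a a' : Lab} (ha : a.Valid m) (ha' : a'.Valid m) :
    (KerPoly m a a').natDegree ≤ m ∧
      (KerPoly m a a').coeff m = if a = a' ∧ a ≠ .sgn then 1 else 0 := by
  rcases a with i | s | _ <;> rcases a' with j | t | _ <;>
    simp only [Lab.Valid, Nat.even_iff] at ha ha' <;> simp only [KerPoly]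
  · refine ⟨natDegree_add_le_of_degree_le ((natDegree_X_pow_le _).trans (by omega))
      ((natDegree_X_pow_le _).trans (by omega)), ?_⟩
    rw [coeff_add, coeff_X_pow, coeff_X_pow, if_neg (by omega), zero_add]
    by_cases h : i = j
    · subst h
      simp
    · rw [if_neg (by omega), if_neg (by simp [h])]
  · exact ⟨(natDegree_X_pow_le _).trans (by omega), by rw [coeff_X_pow, if_neg (by omega)]; simp⟩
  · simp
  · exact ⟨(natDegree_X_pow_le _).trans (by omega), by rw [coeff_X_pow, if_neg (by omega)]; simp⟩
  · by_cases h : s = t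
    · simp [h]
    · simp [h]
  · simp
  · simp
  · simp
  · simp

/-- All entries are polynomials of degree at most 2m, and their coefficients at degree 2m form the
identity matrix: R Rᵗ contributes the entry of ε, the kernel the others. In a kernel vector, an
entry of maximal degree would have zero leading coefficient. -/
theorem det_Omega_ne_zero (hm : 3 ≤ m) : (Omega m).det ≠ 0 := by
  choose lab hval hlab using fun χ : Irr m => exists_label χ.2
  have hinj : ∀ χ χ' : Irr m, lab χ = lab χ' ↔ χ = χ' := by
    refine fun χ χ' => ⟨fun h => Subtype.ext ?_, fun h => by rw [h]⟩
    rw [← hlab, ← hlab, h]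
  set M : Matrix (Irr m) (Irr m) ℂ[X] := fun χ χ' =>
    RdegPoly m (lab χ) * RdegPoly m (lab χ') + (X ^ m - 1) * KerPoly m (lab χ) (lab χ') with hM
  have hmap : (algebraMap ℂ[X] (RatFunc ℂ)).mapMatrix M = Omega m := by
    ext χ χ'
    have h := Omega_chr hm (hval χ) (hval χ')
    simp only [hlab, Subtype.coe_eta] at h
    rw [h, ← ofPoly_RdegPoly, ← ofPoly_RdegPoly, ← ofPoly_KerPoly, ← ofPoly_X, ← ofPoly_one,
      ← ofPoly_pow, ← ofPoly_sub, ← ofPoly_mul, ← ofPoly_mul, ← ofPoly_add]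
    rfl
  have hX : (X ^ m - 1 : ℂ[X]).natDegree ≤ m := by
    rw [← C_1, natDegree_X_pow_sub_C]
  have hX1 : (X ^ m - 1 : ℂ[X]).coeff m = 1 := by
    rw [coeff_sub, coeff_X_pow, if_pos rfl, coeff_one, if_neg (by omega), sub_zero]
  have hdeg : ∀ χ χ', (M χ χ').natDegree ≤ m + m := by
    intro χ χ'
    exact natDegree_add_le_of_degree_le
      (natDegree_mul_le_of_le (RdegPoly_natDegree_le hm (hval χ)).1
        (RdegPoly_natDegree_le hm (hval χ')).1)
      (natDegree_mul_le_of_le hX (KerPoly_natDegree_le hm (hval χ) (hval χ')).1)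
  have hcoeff : ∀ χ χ', (M χ χ').coeff (m + m) = if χ = χ' then 1 else 0 := by
    intro χ χ'
    have hR := RdegPoly_natDegree_le hm (hval χ)
    have hR' := RdegPoly_natDegree_le hm (hval χ')
    have hK := KerPoly_natDegree_le hm (hval χ) (hval χ')
    simp only [hM]
    rw [coeff_add, coeff_mul_add_eq_of_natDegree_le hR.1 hR'.1, coeff_mul_add_eq_of_natDegree_le hX hK.1, hR.2,
      hR'.2, hK.2, hX1]
    by_cases h : χ = χ'
    · subst h
      by_cases h1 : lab χ = .sgn <;> simp [h1]
    · have h2 : lab χ ≠ lab χ' := fun h' => h ((hinj _ _).1 h')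
      by_cases h1 : lab χ = .sgn
      · have h3 : lab χ' ≠ .sgn := fun h' => h2 (h1.trans h'.symm)
        simp [h, h2, h3]
      · simp [h, h2, h1]
  rw [← hmap, ← RingHom.map_det]
  intro h0
  have h1 : M.det = 0 := ofPoly_injective (h0.trans ofPoly_zero.symm)
  obtain ⟨v, hv0, hv⟩ := Matrix.exists_mulVec_eq_zero_iff.2 h1
  obtain ⟨i₀, hi₀⟩ := Function.ne_iff.1 hv0
  obtain ⟨χ, hχ, hmax⟩ := Finset.exists_max_image (Finset.univ.filter fun i => v i ≠ 0)
    (fun i => (v i).natDegree) ⟨i₀, by simpa using hi₀⟩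
  have hχ0 : v χ ≠ 0 := by simpa using hχ
  have hle : ∀ j, (v j).natDegree ≤ (v χ).natDegree := by
    intro j
    by_cases hj : v j = 0
    · simp [hj]
    · exact hmax j (by simpa using hj)
  have h2 := congrArg (fun p => p.coeff (m + m + (v χ).natDegree)) (congrFun hv χ)
  simp only [Matrix.mulVec, dotProduct, finsetSum_coeff, Pi.zero_apply, coeff_zero] at h2
  rw [Finset.sum_congr rfl fun j _ => coeff_mul_add_eq_of_natDegree_le (hdeg χ j) (hle j)] at h2
  simp only [hcoeff, ite_mul, one_mul, zero_mul, Finset.sum_ite_eq, Finset.mem_univ, if_true] at h2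
  exact hχ0 (leadingCoeff_eq_zero.1 h2)

/-! ### Springer correspondences in terms of labels -/

namespace LSDatum

variable {D : LSDatum m}

theorem exists_part {χ : DihedralGroup m → ℂ} (hχ : χ ∈ Irr m) : ∃ C ∈ D.parts, χ ∈ C := by
  rw [← D.sUnion_parts] at hχ
  exact hχ

theorem supp_mem_parts {χ : DihedralGroup m → ℂ} (hχ : χ ∈ Irr m) : D.supp χ ∈ D.parts := by
  obtain ⟨C, hC, h⟩ := D.exists_part hχ
  rwa [D.supp_eq hC h]

theorem mem_supp_self {χ : DihedralGroup m → ℂ} (hχ : χ ∈ Irr m) : χ ∈ D.supp χ := by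
  obtain ⟨C, hC, h⟩ := D.exists_part hχ
  rwa [D.supp_eq hC h]

theorem mem_Irr_of_mem {C : Set (DihedralGroup m → ℂ)} (hC : C ∈ D.parts)
    {χ : DihedralGroup m → ℂ} (hχ : χ ∈ C) : χ ∈ Irr m := by
  rw [← D.sUnion_parts]
  exact ⟨C, hC, hχ⟩

theorem supp_eq_supp {χ χ' : DihedralGroup m → ℂ} (hχ : χ ∈ Irr m) (h : χ' ∈ D.supp χ) :
    D.supp χ' = D.supp χ :=
  D.supp_eq (D.supp_mem_parts hχ) h

theorem le_total {C C' : Set (DihedralGroup m → ℂ)} (hC : C ∈ D.parts) (hC' : C' ∈ D.parts) :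
    D.le C C' ∨ D.le C' C := by
  by_cases h : C = C'
  · exact Or.inl (Or.inl h)
  · exact (D.lt_total C hC C' hC' h).imp Or.inr Or.inr

theorem le_trans {C C' C'' : Set (DihedralGroup m → ℂ)} (hC : C ∈ D.parts) (hC' : C' ∈ D.parts)
    (hC'' : C'' ∈ D.parts) (h : D.le C C') (h' : D.le C' C'') : D.le C C'' := by
  rcases h with rfl | h
  · exact h'
  · rcases h' with rfl | h'
    · exact Or.inr h
    · exact Or.inr (D.lt_trans _ hC _ hC' _ hC'' h h')

theorem a_le_of_le {C C' : Set (DihedralGroup m → ℂ)} (hC : C ∈ D.parts) (hC' : C' ∈ D.parts)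
    (h : D.le C C') : D.a C' ≤ D.a C := by
  rcases h with rfl | h
  · exact le_rfl
  · exact D.a_antitone _ hC _ hC' h

/-- The Springer representation of the support of `χ`. -/
theorem IsSpringerFor.exists_rep {S : Set (DihedralGroup m → ℂ)} (hD : D.IsSpringerFor S)
    {χ : DihedralGroup m → ℂ} (hχ : χ ∈ Irr m) :
    ∃ σ ∈ S, σ ∈ Irr m ∧ σ ∈ D.supp χ ∧ D.supp σ = D.supp χ ∧ D.a (D.supp χ) = b σ ∧
      (χ ≠ σ → b σ < b χ) ∧ (χ ∈ S → χ = σ) := by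
  have hC := D.supp_mem_parts hχ
  obtain ⟨σ, hσ, ha, hmin⟩ := hD.1.min_b _ hC
  have hs := D.supp_eq_supp hχ hσ
  have hσi := D.mem_Irr_of_mem hC hσ
  refine ⟨σ, ?_, hσi, hσ, hs, ha, fun h => hmin χ (D.mem_supp_self hχ) h, ?_⟩
  · rw [← hD.2]
    refine ⟨hσi, fun χ' h' => ?_⟩
    rw [hs] at h'
    by_cases h : χ' = σ
    · rw [h]
    · exact (hmin χ' h' h).le
  · intro h
    rw [← hD.2] at h
    by_contra hne
    exact absurd (h.2 σ hσ) (not_le.2 (hmin χ (D.mem_supp_self hχ) hne))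

end LSDatum

/-- The part of the data of a Springer correspondence and its Green functions which is needed
below, in terms of labels: `r x y` stands for `supp x ≤ supp y`. -/
structure IsLabSystem (m : ℕ) [NeZero m] (S : Set Lab) (r : Lab → Lab → Prop) (a : Lab → ℕ)
    (P : Lab → Lab → RatFunc ℂ) : Prop where
  total : ∀ x y, x.Valid m → y.Valid m → r x y ∨ r y x
  trans : ∀ x y z, x.Valid m → y.Valid m → z.Valid m → r x y → r y z → r x z
  anti : ∀ x y, x.Valid m → y.Valid m → r x y → a y ≤ a x
  rep : ∀ x, x.Valid m → ∃ σ ∈ S, σ.Valid m ∧ r x σ ∧ r σ x ∧ a x = σ.pos m ∧ a σ = σ.pos m ∧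
    (x ≠ σ → σ.pos m < x.pos m) ∧ (x ∈ S → x = σ)
  P_self : ∀ x, x.Valid m → P x x = q ^ a x
  P_le : ∀ x y, x.Valid m → y.Valid m → x ≠ y → r x y → P x y = 0
  -- Three terms suffice: two neighbouring lines, or one line and the two middle characters. Shorter
  -- relations use zero coefficients.
  regress : ∀ L : Lab → Prop, (∀ x y, x.Valid m → y.Valid m → L y → r x y → L x) →
    ∀ l c d e : Lab, l.Valid m → c.Valid m → d.Valid m → e.Valid m → ∀ α β γ : RatFunc ℂ,
      Rdeg m l = α * Rdeg m c + β * Rdeg m d + γ * Rdeg m e →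
      (∀ y, y.Valid m → L y → Ker m l y = α * Ker m c y + β * Ker m d y + γ * Ker m e y) →
      ∀ y, y.Valid m → L y → P l y = α * P c y + β * P d y + γ * P e y
  nat : ∀ x y, x.Valid m → y.Valid m →
    ∃ p : ℕ[X], P x y = ofPoly (p.map (Nat.castRingHom ℂ)) ∧ X ^ a x ∣ p
  family : Even m → ∀ s, r (.mid s) (.line 1)

/-- The label of an irreducible character. -/
def lab (m : ℕ) [NeZero m] (χ : Irr m) : Lab := (exists_label χ.2).choose

theorem lab_valid (χ : Irr m) : (lab m χ).Valid m := (exists_label χ.2).choose_spec.1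

theorem chr_lab (χ : Irr m) : chr m (lab m χ) = χ := (exists_label χ.2).choose_spec.2

open Classical in
/-- The irreducible character with a given label; invalid labels give the trivial character. -/
def irr (m : ℕ) [NeZero m] (x : Lab) : Irr m :=
  if h : x.Valid m then ⟨chr m x, chr_mem_Irr h⟩ else
    ⟨chr m (.line 0), chr_mem_Irr (show 2 * 0 < m by rw [mul_zero]; exact NeZero.pos m)⟩

theorem irr_val {x : Lab} (h : x.Valid m) : (irr m x).1 = chr m x := by
  rw [irr, dif_pos h]

theorem irr_lab (χ : Irr m) : irr m (lab m χ) = χ :=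
  Subtype.ext ((irr_val (lab_valid χ)).trans (chr_lab χ))

theorem lab_irr (hm : 3 ≤ m) {x : Lab} (h : x.Valid m) : lab m (irr m x) = x :=
  chr_injective hm (lab_valid _) h ((chr_lab _).trans (irr_val h))

theorem irr_injective (hm : 3 ≤ m) {x y : Lab} (hx : x.Valid m) (hy : y.Valid m)
    (h : irr m x = irr m y) : x = y := by
  rw [← lab_irr hm hx, h, lab_irr hm hy]

theorem Omega_irr (hm : 3 ≤ m) {x y : Lab} (hx : x.Valid m) (hy : y.Valid m) :
    Omega m (irr m x) (irr m y) = Rdeg m x * Rdeg m y + (q ^ m - 1) * Ker m x y := by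
  rw [irr, dif_pos hx, irr, dif_pos hy, Omega_chr hm hx hy]

/-- A Springer correspondence gives a system in terms of labels. -/
theorem LSDatum.IsSpringerFor.isLabSystem (hm : 3 ≤ m) {D : LSDatum m} {S : Set Lab}
    (hS : ∀ x ∈ S, x.Valid m) (hD : D.IsSpringerFor (chr m '' S)) :
    ∃ P, IsLabSystem m S (fun x y => D.le (D.supp (chr m x)) (D.supp (chr m y)))
      (fun x => D.a (D.supp (chr m x))) P := by
  obtain ⟨P, Λ, hG, -, hnat⟩ := hD.1.green
  have hp : ∀ {x : Lab}, x.Valid m → D.supp (chr m x) ∈ D.parts :=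
    fun hx => D.supp_mem_parts (chr_mem_Irr hx)
  have hpi : ∀ χ : Irr m, D.supp χ.1 ∈ D.parts := fun χ => D.supp_mem_parts χ.2
  have hPle : ∀ χ χ' : Irr m, χ ≠ χ' → D.le (D.supp χ.1) (D.supp χ'.1) → P χ χ' = 0 := by
    rintro χ χ' hne (h | h)
    · exact hG.P_of_eq χ χ' hne h
    · exact hG.P_of_lt χ χ' h
  refine ⟨fun x y => P (irr m x) (irr m y), ?_, ?_, ?_, ?_, ?_, ?_, ?_, ?_, ?_⟩
  · exact fun x y hx hy => D.le_total (hp hx) (hp hy)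
  · exact fun x y z hx hy hz => D.le_trans (hp hx) (hp hy) (hp hz)
  · exact fun x y hx hy => D.a_le_of_le (hp hx) (hp hy)
  · intro x hx
    obtain ⟨σ, ⟨y, hy, rfl⟩, hσi, hσ, hs, ha, hlt, hmem⟩ := hD.exists_rep (chr_mem_Irr hx)
    have hyv := hS y hy
    have hb := b_chr hm hyv
    refine ⟨y, hy, hyv, Or.inl hs.symm, Or.inl hs, ha.trans hb, ?_, ?_, ?_⟩
    · rw [hs]; exact ha.trans hb
    · intro hne
      have := hlt fun h => hne (chr_injective hm hx hyv h)
      rwa [hb, b_chr hm hx] at this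
    · exact fun h => chr_injective hm hx hyv (hmem ⟨x, h, rfl⟩)
  · intro x hx
    rw [hG.P_self, irr_val hx]
  · intro x y hx hy hne h
    refine hPle _ _ (fun h' => hne (irr_injective hm hx hy h')) ?_
    rwa [irr_val hx, irr_val hy]
  · intro L hL l c d e hl hc hd he α β γ hR hK y hy hLy
    have h := green_regression (P := P) (Λ := Λ) (Ω := Omega m)
      (r := fun χ χ' : Irr m => D.le (D.supp χ.1) (D.supp χ'.1))
      (fun i j => D.le_total (hpi i) (hpi j))
      (fun i j k => D.le_trans (hpi i) (hpi j) (hpi k)) hPle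
      (fun i => by rw [hG.P_self]; exact pow_ne_zero _ q_ne_zero)
      (fun i j h => hG.Λ_of_ne i j fun h' => h ⟨Or.inl h', Or.inl h'.symm⟩) hG.equation
      (det_Omega_ne_zero hm) (L := fun χ => L (lab m χ))
      (fun i j hj hij => hL _ _ (lab_valid _) (lab_valid _) hj (by rwa [chr_lab, chr_lab]))
      -- This vector encodes the relation. Since Ω = R Rᵗ + (q^m - 1) K, it is enough to have the
      -- relation for R and, on L, for K.
      (v := Pi.single (irr m l) 1 - α • Pi.single (irr m c) 1 - β • Pi.single (irr m d) 1 -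
        γ • Pi.single (irr m e) 1) (by
        intro i hi
        have h1 := hK _ (lab_valid i) hi
        simp only [Matrix.sub_vecMul, Matrix.smul_vecMul, Matrix.single_one_vecMul, Pi.sub_apply,
          Pi.smul_apply, smul_eq_mul, Matrix.row_apply]
        rw [← irr_lab i, Omega_irr hm hl (lab_valid i), Omega_irr hm hc (lab_valid i),
          Omega_irr hm hd (lab_valid i), Omega_irr hm he (lab_valid i), h1, hR]
        ring) (irr m y) (by rwa [lab_irr hm hy])
    simp only [Matrix.sub_vecMul, Matrix.smul_vecMul, Matrix.single_one_vecMul, Pi.sub_apply,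
          Pi.smul_apply, smul_eq_mul, Matrix.row_apply] at h
    linear_combination h
  · intro x y hx hy
    obtain ⟨p, h1, h2⟩ := hnat (irr m x) (irr m y)
    rw [irr_val hx] at h2
    exact ⟨p, h1, h2⟩
  · intro he s
    obtain ⟨k, hk⟩ := he
    have he : Even m := ⟨k, hk⟩
    have hv1 : (Lab.line 1).Valid m := show 2 * 1 < m by omega
    exact hD.1.family _ (chr_mem_Irr hv1) _ (chr_mem_Irr (show (Lab.mid s).Valid m from he))
      (isSpecial_reflChar (h := k - 2) (by omega)) (not_isSpecial_mid hm he s)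
      (sameFamily_reflChar_mid hm he s)

/-! ### Bounds for the supports in a Springer correspondence -/

/-! ### Obstructions to polynomiality, positivity and divisibility -/

section integrality

theorem eval_eq_zero_of_mul_eq {p d u : ℂ[X]} (h : ofPoly p * ofPoly d = ofPoly u) {ζ : ℂ}
    (hd : d.eval ζ = 0) : u.eval ζ = 0 := by
  rw [← ofPoly_mul] at h
  rw [← ofPoly_injective h, eval_mul, hd, mul_zero]

/-- A primitive n-th root of unity is a root of the left side but not of the right side. -/
theorem mul_q_pow_sub_one_ne {s n : ℕ} (hs : s ≠ 0) (hsn : s < n) (p : ℂ[X]) (N : ℕ) :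
    ofPoly p * (q ^ n - 1) ≠ q ^ N * (q ^ s - 1) := by
  intro h
  have hζ := Complex.isPrimitiveRoot_exp n (by omega)
  have h1 := eval_eq_zero_of_mul_eq (p := p) (d := X ^ n - 1) (u := X ^ N * (X ^ s - 1))
    (by simpa only [ofPoly_mul, ofPoly_sub, ofPoly_pow, ofPoly_X, ofPoly_one] using h)
    (ζ := _) (by rw [eval_sub, eval_pow, eval_X, eval_one, hζ.pow_eq_one, sub_self])
  simp only [eval_mul, eval_sub, eval_pow, eval_X, eval_one] at h1
  rcases mul_eq_zero.1 h1 with h2 | h2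
  · exact pow_ne_zero _ (hζ.ne_zero (by omega)) h2
  · exact hζ.pow_ne_one_of_pos_of_lt hs hsn (sub_eq_zero.1 h2)

theorem exists_pow_eq_neg_one {n : ℕ} (hn : n ≠ 0) :
    ∃ ζ : ℂ, IsPrimitiveRoot ζ (2 * n) ∧ ζ ^ n = -1 := by
  have hζ := Complex.isPrimitiveRoot_exp (2 * n) (by omega)
  generalize Complex.exp (2 * Real.pi * Complex.I / (2 * n : ℕ)) = ζ at hζ
  refine ⟨ζ, hζ, ?_⟩
  have h1 := hζ.pow_eq_one
  rw [show 2 * n = n + n from two_mul n, pow_add] at h1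
  exact (mul_self_eq_one_iff.1 h1).resolve_left (hζ.pow_ne_one_of_pos_of_lt hn (by omega))

/-- A primitive 2n'-th root of unity kills 1 + q^n' but not 1 + q^n, as 2n < 2n'. -/
theorem mul_one_add_q_pow_ne {n n' : ℕ} (hn : n ≠ 0) (hnn : n < n') (p : ℂ[X]) (N : ℕ) :
    ofPoly p * (1 + q ^ n') ≠ q ^ N * (1 + q ^ n) := by
  intro h
  obtain ⟨ζ, hζ, hζn⟩ := exists_pow_eq_neg_one (show n' ≠ 0 by omega)
  have h1 := eval_eq_zero_of_mul_eq (p := p) (d := 1 + X ^ n') (u := X ^ N * (1 + X ^ n))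
    (by simpa only [ofPoly_mul, ofPoly_add, ofPoly_pow, ofPoly_X, ofPoly_one] using h)
    (ζ := ζ) (by rw [eval_add, eval_pow, eval_X, eval_one, hζn]; ring)
  simp only [eval_mul, eval_add, eval_pow, eval_X, eval_one] at h1
  rcases mul_eq_zero.1 h1 with h2 | h2
  · exact pow_ne_zero _ (hζ.ne_zero (by omega)) h2
  · refine hζ.pow_ne_one_of_pos_of_lt (l := 2 * n) (by omega) (by omega) ?_
    rw [mul_comm, pow_mul, eq_neg_of_add_eq_zero_right h2]
    norm_num

theorem mul_one_add_q_pow_ne_pow {n' : ℕ} (hn : n' ≠ 0) (p : ℂ[X]) (N : ℕ) :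
    ofPoly p * (1 + q ^ n') ≠ q ^ N := by
  intro h
  obtain ⟨ζ, hζ, hζn⟩ := exists_pow_eq_neg_one hn
  have h1 := eval_eq_zero_of_mul_eq (p := p) (d := 1 + X ^ n') (u := X ^ N)
    (by simpa only [ofPoly_mul, ofPoly_add, ofPoly_pow, ofPoly_X, ofPoly_one] using h)
    (ζ := ζ) (by rw [eval_add, eval_pow, eval_X, eval_one, hζn]; ring)
  rw [eval_pow, eval_X] at h1
  exact pow_ne_zero _ (hζ.ne_zero (by omega)) h1

theorem one_add_q_pow_ne_zero {n : ℕ} (hn : n ≠ 0) : 1 + q ^ n ≠ 0 := by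
  intro h0
  refine q_pow_sub_one_ne_zero (show n * 2 ≠ 0 by omega) ?_
  rw [pow_mul, eq_neg_of_add_eq_zero_right h0]
  norm_num

theorem natCast_ne_neg_one (n : ℕ) : (n : ℂ) ≠ -1 := by
  intro h
  have : ((n + 1 : ℕ) : ℂ) = 0 := by push_cast; rw [h]; ring
  exact Nat.cast_ne_zero.2 (Nat.succ_ne_zero n) this

theorem coeff_X_pow_mul_map (p : ℕ[X]) (u B : ℕ) :
    ∃ n : ℕ, ((X ^ u * p.map (Nat.castRingHom ℂ)).coeff B : ℂ) = (n : ℂ) := by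
  rw [coeff_X_pow_mul']
  split_ifs
  · exact ⟨_, by rw [coeff_map]; rfl⟩
  · exact ⟨0, by simp⟩

theorem q_pow_mul_ne_neg (A : ℕ) (p : ℕ[X]) (u : ℕ) :
    q ^ u * ofPoly (p.map (Nat.castRingHom ℂ)) ≠ -q ^ A := by
  intro h
  have h1 : X ^ u * p.map (Nat.castRingHom ℂ) = -X ^ A := by
    apply ofPoly_injective
    simpa only [ofPoly_mul, ofPoly_neg, ofPoly_pow, ofPoly_X] using h
  obtain ⟨n, hn⟩ := coeff_X_pow_mul_map p u A
  rw [h1, coeff_neg, coeff_X_pow, if_pos rfl] at hn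
  exact natCast_ne_neg_one n hn.symm

theorem le_of_q_pow_mul_eq {p : ℕ[X]} {u A B : ℕ} (hA : X ^ A ∣ p)
    (h : q ^ u * ofPoly (p.map (Nat.castRingHom ℂ)) = q ^ B) : u + A ≤ B := by
  have h1 : X ^ u * p.map (Nat.castRingHom ℂ) = X ^ B := by
    apply ofPoly_injective
    simpa only [ofPoly_mul, ofPoly_pow, ofPoly_X] using h
  obtain ⟨c, rfl⟩ := hA
  rw [Polynomial.map_mul, Polynomial.map_pow, map_X, ← mul_assoc, ← pow_add] at h1
  exact (pow_dvd_pow_iff X_ne_zero not_isUnit_X).1 ⟨_, h1.symm⟩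

end integrality

/-! ### Values of the kernel as products -/

theorem Rdeg_line {j : ℕ} (hj : j ≠ 0) : Rdeg m (.line j) = q ^ j + q ^ (m - j) := by
  simp only [Rdeg, if_neg hj]

theorem Rdeg_mid (s : Bool) : Rdeg m (.mid s) = q ^ (m / 2) := rfl

theorem Ker_line_of_ge {i j : ℕ} (hi : i ≠ 0) (him : 2 * i < m) (h : j ≤ i) :
    Ker m (.line i) (.line j) = q ^ j * Rdeg m (.line i) := by
  rw [Rdeg_line hi, Ker, max_eq_left h, min_eq_right h, mul_add, ← pow_add, ← pow_add]
  congr 2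
  · omega
  · omega

theorem Ker_line_of_le {i j : ℕ} (hj : j ≠ 0) (hjm : 2 * j < m) (h : i ≤ j) :
    Ker m (.line i) (.line j) = q ^ i * Rdeg m (.line j) := by
  rw [Rdeg_line hj, Ker, max_eq_right h, min_eq_left h, mul_add, ← pow_add, ← pow_add]
  congr 2
  omega

theorem Ker_line_mid (i : ℕ) (s : Bool) : Ker m (.line i) (.mid s) = q ^ i * q ^ (m / 2) := by
  rw [Ker, pow_add]

theorem Ker_mid_line {i : ℕ} (s : Bool) : Ker m (.mid s) (.line i) = q ^ i * q ^ (m / 2) := by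
  rw [Ker, pow_add]

theorem Ker_sgn (x : Lab) : Ker m x .sgn = 0 := by cases x <;> rfl

/-! ### Relations between rows of the Green matrix and the resulting bounds -/

namespace IsLabSystem

variable {S : Set Lab} {r : Lab → Lab → Prop} {a : Lab → ℕ} {P : Lab → Lab → RatFunc ℂ}

theorem refl (h : IsLabSystem m S r a P) {x : Lab} (hx : x.Valid m) : r x x :=
  (h.total x x hx hx).elim id id

theorem a_eq (h : IsLabSystem m S r a P) {x : Lab} (hx : x.Valid m) (hxS : x ∈ S) :
    a x = x.pos m := by
  obtain ⟨σ, -, -, -, -, h1, -, -, h2⟩ := h.rep x hx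
  rw [h1, ← h2 hxS]

theorem le_of_lt (h : IsLabSystem m S r a P) {x y : Lab} (hx : x.Valid m) (hy : y.Valid m)
    (hxy : a x < a y) : r y x :=
  (h.total x y hx hy).resolve_left fun h1 => absurd (h.anti x y hx hy h1) (not_le.2 hxy)

/-- The characters whose support is at most that of a given one form a closed set. -/
theorem closed (h : IsLabSystem m S r a P) {z : Lab} (hz : z.Valid m) (x y : Lab)
    (hx : x.Valid m) (hy : y.Valid m) (hyz : r y z) (hxy : r x y) : r x z :=
  h.trans x y z hx hy hz hxy hyz

/-- The largest line below a bound in a set of labels. -/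
theorem exists_max_line {L : Lab → Prop} {c₀ l : ℕ} (h0 : L (.line c₀)) (hl : c₀ < l) :
    ∃ c, c₀ ≤ c ∧ c < l ∧ L (.line c) ∧ ∀ j, j < l → L (.line j) → j ≤ c := by
  classical
  have h1 : c₀ ≤ Nat.findGreatest (fun j => L (.line j)) (l - 1) :=
    Nat.le_findGreatest (by omega) h0
  refine ⟨_, h1, ?_, Nat.findGreatest_spec (P := fun j => L (.line j)) (by omega) h0, ?_⟩
  · have := Nat.findGreatest_le (P := fun j => L (.line j)) (l - 1)
    omega
  · exact fun j hj hL => Nat.le_findGreatest (by omega) hL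

/-- Relation between a line and the next lower and the next higher one. -/
theorem between_lines (h : IsLabSystem m S r a P) {L : Lab → Prop}
    (hL : ∀ x y, x.Valid m → y.Valid m → L y → r x y → L x) {c l d : ℕ} (hc0 : c ≠ 0)
    (hcl : c < l) (hld : l < d) (hd : 2 * d < m) (hLc : L (.line c)) (hLd : L (.line d))
    (hLj : ∀ j, 2 * j < m → L (.line j) → j ≤ c ∨ d ≤ j) : False := by
  have hvc : (Lab.line c).Valid m := show 2 * c < m by omega
  have hvl : (Lab.line l).Valid m := show 2 * l < m by omega
  have hvd : (Lab.line d).Valid m := hd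
  obtain ⟨t, rfl⟩ : ∃ t, l = c + t := ⟨l - c, by omega⟩
  obtain ⟨s, rfl⟩ : ∃ s, d = c + t + s := ⟨d - (c + t), by omega⟩
  obtain ⟨w, hw⟩ : ∃ w, m = 2 * (c + t + s) + w := ⟨m - 2 * (c + t + s), by omega⟩
  have hn := q_pow_sub_one_ne_zero (show 2 * (t + s) ≠ 0 by omega)
  -- The coefficients solve q^l = αq^c + βq^d and q^(-l) = αq^(-c) + βq^(-d). Fake degrees of lines
  -- and their kernel entries on L are linear in q^(±l), so the relation holds for R and K at once.
  set α : RatFunc ℂ := q ^ t * (q ^ (2 * s) - 1) / (q ^ (2 * (t + s)) - 1) with hα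
  set β : RatFunc ℂ := q ^ s * (q ^ (2 * t) - 1) / (q ^ (2 * (t + s)) - 1) with hβ
  have hR : Rdeg m (.line (c + t)) = α * Rdeg m (.line c) + β * Rdeg m (.line (c + t + s)) +
      0 * Rdeg m (.line c) := by
    rw [Rdeg_line (by omega), Rdeg_line (by omega), Rdeg_line (by omega),
      show m - (c + t) = c + t + 2 * s + w by omega, show m - c = c + 2 * t + 2 * s + w by omega,
      show m - (c + t + s) = c + t + s + w by omega, hα, hβ]
    field_simp
    ring
  have hq : q ^ (c + t) = α * q ^ c + β * q ^ (c + t + s) := by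
    rw [hα, hβ]
    field_simp
    ring
  have key := h.regress L hL (.line (c + t)) (.line c) (.line (c + t + s)) (.line c) hvl hvc hvd
    hvc α β 0 hR (by
      intro y hy hyL
      cases y with
      | sgn => simp [Ker_sgn]
      | mid u => rw [Ker_line_mid, Ker_line_mid, Ker_line_mid, hq]; ring
      | line j =>
        rcases hLj j hy hyL with hj | hj
        · rw [Ker_line_of_ge (by omega) hvl (by omega), Ker_line_of_ge (by omega) hvc (by omega),
            Ker_line_of_ge (by omega) hvd (by omega), hR]
          ring
        · rw [Ker_line_of_le (by omega) hy (by omega), Ker_line_of_le (by omega) hy (by omega),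
            Ker_line_of_le (by omega) hy (by omega), hq]
          ring)
  -- In the column of the line with larger support the row of the other one vanishes. There the row
  -- of l has entry α or β times a power of q, which is not a polynomial.
  rcases h.total _ _ hvc hvd with hcd | hcd
  · have h1 := key _ hvd hLd
    rw [h.P_le _ _ hvc hvd (by simp; omega) hcd, h.P_self _ hvd, hβ] at h1
    obtain ⟨p, hp, -⟩ := h.nat _ _ hvl hvd
    rw [hp] at h1
    refine mul_q_pow_sub_one_ne (s := 2 * t) (n := 2 * (t + s)) (by omega) (by omega)
        (p.map (Nat.castRingHom ℂ))
      (s + a (.line (c + t + s))) ?_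
    rw [h1]
    field_simp
    ring
  · have h1 := key _ hvc hLc
    rw [h.P_le _ _ hvd hvc (by simp; omega) hcd, h.P_self _ hvc, hα] at h1
    obtain ⟨p, hp, -⟩ := h.nat _ _ hvl hvc
    rw [hp] at h1
    refine mul_q_pow_sub_one_ne (s := 2 * s) (n := 2 * (t + s)) (by omega) (by omega)
        (p.map (Nat.castRingHom ℂ))
      (t + a (.line c)) ?_
    rw [h1]
    field_simp
    ring

/-- Relation between a line, the next lower one and the two middle characters. -/
theorem below_mids (h : IsLabSystem m S r a P) (he : Even m) {L : Lab → Prop}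
    (hL : ∀ x y, x.Valid m → y.Valid m → L y → r x y → L x) {c l : ℕ} (hc0 : c ≠ 0)
    (hcl : c < l) (hl : 2 * l < m) (hLc : L (.line c)) (hLs : ∀ s, L (.mid s))
    (hLj : ∀ j, 2 * j < m → L (.line j) → j ≤ c) : False := by
  have hvc : (Lab.line c).Valid m := show 2 * c < m by omega
  have hvl : (Lab.line l).Valid m := hl
  have hvs : ∀ s, (Lab.mid s).Valid m := fun _ => he
  obtain ⟨g, hg⟩ := he
  obtain ⟨t, rfl⟩ : ∃ t, l = c + t := ⟨l - c, by omega⟩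
  obtain ⟨s, hs⟩ : ∃ s, m = 2 * (c + t + s) := ⟨g - (c + t), by omega⟩
  have hh : m / 2 = c + t + s := by omega
  have hn := q_pow_sub_one_ne_zero (show 2 * (t + s) ≠ 0 by omega)
  -- The interpolation of `between_lines` with d = m/2, where the sum of the two middle characters
  -- takes the place of χ_d; hence the same coefficient β for both.
  set α : RatFunc ℂ := q ^ t * (q ^ (2 * s) - 1) / (q ^ (2 * (t + s)) - 1) with hα
  set β : RatFunc ℂ := q ^ s * (q ^ (2 * t) - 1) / (q ^ (2 * (t + s)) - 1) with hβ
  have hR : Rdeg m (.line (c + t)) = α * Rdeg m (.line c) + β * Rdeg m (.mid true) +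
      β * Rdeg m (.mid false) := by
    rw [Rdeg_line (by omega), Rdeg_line (by omega), Rdeg_mid, Rdeg_mid, hh,
      show m - (c + t) = c + t + 2 * s by omega, show m - c = c + 2 * t + 2 * s by omega, hα, hβ]
    field_simp
    ring
  have hq : q ^ (c + t) = α * q ^ c + β * q ^ (c + t + s) := by
    rw [hα, hβ]
    field_simp
    ring
  have hqm : q ^ m = q ^ (c + t + s) * q ^ (c + t + s) := by
    rw [← pow_add]; congr 1; omega
  have key := h.regress L hL (.line (c + t)) (.line c) (.mid true) (.mid false) hvl hvc (hvs _)
    (hvs _) α β β hR (by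
      intro y hy hyL
      cases y with
      | sgn => simp [Ker_sgn]
      | mid u =>
        rw [Ker_line_mid, Ker_line_mid, hh, hq]
        cases u <;> simp only [Ker, if_true, hqm, reduceCtorEq, if_false] <;> ring
      | line j =>
        have hj := hLj j hy hyL
        rw [Ker_line_of_ge (by omega) hvl (by omega), Ker_line_of_ge (by omega) hvc (by omega),
          Ker_mid_line, Ker_mid_line, hR, Rdeg_mid, Rdeg_mid]
        ring)
  have hmid : ∀ u, r (.mid (!u)) (.mid u) → r (.line c) (.mid u) → False := by
    intro u h1 h2
    have h3 := key _ (hvs u) (hLs u)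
    have h4 : P (.line (c + t)) (.mid u) = β * q ^ a (.mid u) := by
      rw [h3, h.P_le _ _ hvc (hvs u) (by simp) h2]
      cases u
      · rw [h.P_le (.mid true) (.mid false) (hvs _) (hvs _) (by simp) h1, h.P_self _ (hvs _)]
        ring
      · rw [h.P_le (.mid false) (.mid true) (hvs _) (hvs _) (by simp) h1, h.P_self _ (hvs _)]
        ring
    obtain ⟨p, hp, -⟩ := h.nat _ _ hvl (hvs u)
    rw [hp, hβ] at h4
    refine mul_q_pow_sub_one_ne (s := 2 * t) (n := 2 * (t + s)) (by omega) (by omega)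
        (p.map (Nat.castRingHom ℂ))
      (s + a (.mid u)) ?_
    rw [h4]
    field_simp
    ring
  have hline : (∀ u, r (.mid u) (.line c)) → False := by
    intro h1
    have h3 := key _ hvc hLc
    rw [h.P_le _ _ (hvs _) hvc (by simp) (h1 true), h.P_le _ _ (hvs _) hvc (by simp) (h1 false),
      h.P_self _ hvc, hα] at h3
    obtain ⟨p, hp, -⟩ := h.nat _ _ hvl hvc
    rw [hp] at h3
    refine mul_q_pow_sub_one_ne (s := 2 * s) (n := 2 * (t + s)) (by omega) (by omega)
        (p.map (Nat.castRingHom ℂ))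
      (t + a (.line c)) ?_
    rw [h3]
    field_simp
    ring
  -- The middle character with the larger support is compared with the line c, and the column of the
  -- larger one leads to the contradiction.
  obtain ⟨u, hu⟩ : ∃ u, r (.mid (!u)) (.mid u) := by
    rcases h.total _ _ (hvs false) (hvs true) with h1 | h1
    · exact ⟨true, h1⟩
    · exact ⟨false, h1⟩
  rcases h.total _ _ hvc (hvs u) with h1 | h1
  · exact hmid u hu h1
  · refine hline fun v => ?_
    rcases Bool.eq_or_eq_not v u with rfl | rfl
    · exact h1
    · exact h.trans _ _ _ (hvs _) (hvs _) hvc hu h1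

/-- Relation between a line and the next lower one if nothing lies above. -/
theorem top_line (h : IsLabSystem m S r a P) {L : Lab → Prop}
    (hL : ∀ x y, x.Valid m → y.Valid m → L y → r x y → L x) {c l : ℕ} (hc0 : c ≠ 0)
    (hcl : c < l) (hl : 2 * l < m) (hLc : L (.line c)) (hLs : Even m → ∀ s, ¬ L (.mid s))
    (hLj : ∀ j, 2 * j < m → L (.line j) → j ≤ c) : False := by
  have hvc : (Lab.line c).Valid m := show 2 * c < m by omega
  have hvl : (Lab.line l).Valid m := hl
  obtain ⟨t, rfl⟩ : ∃ t, l = c + t := ⟨l - c, by omega⟩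
  obtain ⟨w, hw⟩ : ∃ w, m = 2 * (c + t) + w := ⟨m - 2 * (c + t), by omega⟩
  have hR0 : Rdeg m (.line c) = q ^ c * (1 + q ^ (2 * t + w)) := by
    rw [Rdeg_line hc0, show m - c = c + (2 * t + w) by omega]; ring
  have hR1 : Rdeg m (.line (c + t)) = q ^ (c + t) * (1 + q ^ w) := by
    rw [Rdeg_line (by omega), show m - (c + t) = c + t + w by omega]; ring
  have hne := one_add_q_pow_ne_zero (show 2 * t + w ≠ 0 by omega)
  -- On L the kernel rows of both lines are q^j times their fake degrees, so the rows are
  -- proportional with the ratio of the fake degrees, which is not a polynomial up to powers of q.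
  set α : RatFunc ℂ := q ^ t * (1 + q ^ w) / (1 + q ^ (2 * t + w)) with hα
  have hR : Rdeg m (.line (c + t)) = α * Rdeg m (.line c) + 0 * Rdeg m (.line c) +
      0 * Rdeg m (.line c) := by
    rw [hR0, hR1, hα]
    field_simp
    ring
  have key := h.regress L hL (.line (c + t)) (.line c) (.line c) (.line c) hvl hvc hvc
    hvc α 0 0 hR (by
      intro y hy hyL
      cases y with
      | sgn => simp [Ker_sgn]
      | mid u => exact absurd hyL (hLs hy u)
      | line j =>
        have hj := hLj j hy hyL
        rw [Ker_line_of_ge (by omega) hvl (by omega), Ker_line_of_ge (by omega) hvc (by omega), hR]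
        ring)
  have h1 := key _ hvc hLc
  rw [h.P_self _ hvc, hα] at h1
  obtain ⟨p, hp, -⟩ := h.nat _ _ hvl hvc
  rw [hp] at h1
  refine mul_one_add_q_pow_ne (n := w) (n' := 2 * t + w) (by omega) (by omega)
        (p.map (Nat.castRingHom ℂ))
    (t + a (.line c)) ?_
  rw [h1]
  field_simp
  ring

/-- Relation between a middle character and the highest line if no middle character lies below. -/
theorem top_mid (h : IsLabSystem m S r a P) (he : Even m) {L : Lab → Prop}
    (hL : ∀ x y, x.Valid m → y.Valid m → L y → r x y → L x) {c : ℕ} (hc0 : c ≠ 0) (u : Bool)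
    (hc : 2 * c < m) (hLc : L (.line c)) (hLs : ∀ s, ¬ L (.mid s))
    (hLj : ∀ j, 2 * j < m → L (.line j) → j ≤ c) : False := by
  have hvc : (Lab.line c).Valid m := hc
  have hvu : (Lab.mid u).Valid m := he
  obtain ⟨g, hg⟩ := he
  obtain ⟨t, ht⟩ : ∃ t, m = 2 * (c + t) := ⟨g - c, by omega⟩
  have hh : m / 2 = c + t := by omega
  have hR0 : Rdeg m (.line c) = q ^ c * (1 + q ^ (2 * t)) := by
    rw [Rdeg_line hc0, show m - c = c + (2 * t) by omega]; ring
  have hne := one_add_q_pow_ne_zero (show 2 * t ≠ 0 by omega)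
  set α : RatFunc ℂ := q ^ t / (1 + q ^ (2 * t)) with hα
  have hR : Rdeg m (.mid u) = α * Rdeg m (.line c) + 0 * Rdeg m (.line c) +
      0 * Rdeg m (.line c) := by
    rw [hR0, Rdeg_mid, hα, hh]
    field_simp
    ring
  have key := h.regress L hL (.mid u) (.line c) (.line c) (.line c) hvu hvc hvc
    hvc α 0 0 hR (by
      intro y hy hyL
      cases y with
      | sgn => simp [Ker_sgn]
      | mid u => exact absurd hyL (hLs u)
      | line j =>
        have hj := hLj j hy hyL
        rw [Ker_mid_line, Ker_line_of_ge (by omega) hvc (by omega), ← Rdeg_mid u, hR]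
        ring)
  have h1 := key _ hvc hLc
  rw [h.P_self _ hvc, hα] at h1
  obtain ⟨p, hp, -⟩ := h.nat _ _ hvu hvc
  rw [hp] at h1
  refine mul_one_add_q_pow_ne_pow (n' := 2 * t) (by omega)
    (p.map (Nat.castRingHom ℂ)) (t + a (.line c)) ?_
  rw [h1]
  field_simp
  ring

/-- Relation between the middle characters if only one of them lies below. -/
theorem one_mid (h : IsLabSystem m S r a P) (he : Even m) {L : Lab → Prop}
    (hL : ∀ x y, x.Valid m → y.Valid m → L y → r x y → L x) {c : ℕ} (hc0 : c ≠ 0) {u : Bool}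
    (hc : 2 * c < m) (hLc : L (.line c)) (hLu : L (.mid u)) (hLu' : ¬ L (.mid (!u)))
    (hLj : ∀ j, 2 * j < m → L (.line j) → j ≤ c) :
    ¬ r (.line c) (.mid u) ∧ m / 2 + a (.mid (!u)) ≤ c + a (.line c) := by
  have hvc : (Lab.line c).Valid m := hc
  have hvs : ∀ s, (Lab.mid s).Valid m := fun _ => he
  obtain ⟨g, hg⟩ := he
  obtain ⟨t, ht⟩ : ∃ t, m = 2 * (c + t) := ⟨g - c, by omega⟩
  have hh : m / 2 = c + t := by omega
  -- Determined by the fake degrees together with the column of `.mid u`, where the kernel vanishes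
  -- on `.mid (!u)`.
  set α : RatFunc ℂ := (q ^ t)⁻¹ with hα
  set β : RatFunc ℂ := -(q ^ (2 * t))⁻¹ with hβ
  have hq := q_ne_zero
  have hR : Rdeg m (.mid (!u)) = α * Rdeg m (.line c) + β * Rdeg m (.mid u) +
      0 * Rdeg m (.line c) := by
    rw [Rdeg_line hc0, show m - c = c + 2 * t by omega, Rdeg_mid, Rdeg_mid, hα, hβ, hh]
    field_simp
    ring
  have hqm : q ^ m = q ^ (c + t) * q ^ (c + t) := by
    rw [← pow_add]; congr 1; omega
  have key := h.regress L hL (.mid (!u)) (.line c) (.mid u) (.line c) (hvs _) hvc (hvs _)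
    hvc α β 0 hR (by
      intro y hy hyL
      cases y with
      | sgn => simp [Ker_sgn]
      | mid v =>
        rcases Bool.eq_or_eq_not v u with rfl | rfl
        · rw [Ker_line_mid, hh, hα, hβ]
          simp only [Ker, if_true, hqm, Bool.not_eq_eq_eq_not, Bool.eq_not_self, if_false]
          field_simp
          ring
        · exact absurd hyL hLu'
      | line j =>
        have hj := hLj j hy hyL
        have hR' := hR
        rw [Rdeg_mid, Rdeg_mid] at hR'
        rw [Ker_mid_line, Ker_mid_line, Ker_line_of_ge (by omega) hvc (by omega)]
        linear_combination q ^ j * hR')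
  -- Otherwise the entry in the column of `.mid u` would be minus a power of q.
  have hnot : ¬ r (.line c) (.mid u) := by
    intro h1
    have h2 := key _ (hvs u) hLu
    rw [h.P_le _ _ hvc (hvs u) (by simp) h1, h.P_self _ (hvs u), hβ] at h2
    obtain ⟨p, hp, -⟩ := h.nat (.mid (!u)) (.mid u) (hvs _) (hvs _)
    rw [hp] at h2
    refine q_pow_mul_ne_neg (a (.mid u)) p (2 * t) ?_
    rw [h2]
    field_simp
    ring
  refine ⟨hnot, ?_⟩
  have h1 := (h.total _ _ hvc (hvs u)).resolve_left hnot
  have h2 := key _ hvc hLc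
  rw [h.P_le _ _ (hvs u) hvc (by simp) h1, h.P_self _ hvc, hα] at h2
  -- In the column of c the entry is q^(a(c) - t) with t = m/2 - c, and it has to be divisible by q
  -- to the a-value of its row.
  obtain ⟨p, hp, hd⟩ := h.nat (.mid (!u)) (.line c) (hvs _) hvc
  rw [hp] at h2
  have h3 := le_of_q_pow_mul_eq (u := t) (B := a (.line c)) hd (by
    rw [h2]
    field_simp
    ring)
  omega

/-- If one middle character is not in `S`, the other one does not have larger support. -/
theorem mid_le_mid (h : IsLabSystem m S r a P) (hm : 3 ≤ m) (h1 : Lab.line 1 ∈ S) (he : Even m)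
    {u : Bool} (hu : Lab.mid u ∉ S) : r (.mid (!u)) (.mid u) := by
  by_contra hn
  have hvu : (Lab.mid u).Valid m := he
  obtain ⟨σ, hσS, hσ, h2, h3, -, h5, h6, -⟩ := h.rep _ hvu
  have hlt := h6 fun h' => hu (h' ▸ hσS)
  obtain ⟨j, rfl⟩ : ∃ j, σ = .line j := by
    cases σ with
    | line j => exact ⟨j, rfl⟩
    | mid s => exact absurd hlt (lt_irrefl _)
    | sgn => simp only [Lab.pos] at hlt; omega
  simp only [Lab.pos] at hlt
  have hv1 : (Lab.line 1).Valid m := show 2 * 1 < m by omega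
  -- A nontrivial line below the middle character is needed. It is the Springer representation of
  -- its class, or χ_1 if that one is trivial.
  have hL1 : ∃ j, j ≠ 0 ∧ 2 * j < m ∧ r (.line j) (.mid u) := by
    by_cases hj : j = 0
    · subst hj
      refine ⟨1, one_ne_zero, hv1, h.trans _ _ _ hv1 hσ hvu (h.le_of_lt hσ hv1 ?_) h3⟩
      rw [h5, h.a_eq hv1 h1]
      exact zero_lt_one
    · exact ⟨j, hj, hσ, h3⟩
  obtain ⟨j, hj0, hjm, hj⟩ := hL1
  obtain ⟨c, hjc, hcm, hLc, hmax⟩ := exists_max_line (L := fun x => r x (.mid u)) (l := (m + 1) / 2)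
    hj (by omega)
  -- Every line in L has support at most that of `.mid u`, which is exactly what `one_mid` excludes
  -- for the largest one.
  refine (h.one_mid he (h.closed hvu) (c := c) (by omega) (by omega) hLc (h.refl hvu) hn ?_).1 hLc
  exact fun j hj hr => hmax j (by omega) hr

/-- The only use of the family condition: the middle characters lie in the family of the special
character χ_1. -/
theorem mid_bound_one (h : IsLabSystem m S r a P) (hm : 3 ≤ m) (h1 : Lab.line 1 ∈ S) (he : Even m)
    (u : Bool) : 1 ≤ a (.mid u) := by
  have hv1 : (Lab.line 1).Valid m := show 2 * 1 < m by omega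
  have h2 := h.anti _ _ (show (Lab.mid u).Valid m from he) hv1 (h.family he u)
  rwa [h.a_eq hv1 h1] at h2

/-- When neither middle character is in S, they have the same support by `mid_le_mid`. If it
exceeded that of χ_k, the characters at most χ_k would include no middle one, against `top_mid`. -/
theorem mid_bound (h : IsLabSystem m S r a P) (hm : 3 ≤ m) (h1 : Lab.line 1 ∈ S) (he : Even m)
    (hS : ∀ u, Lab.mid u ∉ S) {k : ℕ} (hkm : 2 * k < m) (hk : Lab.line k ∈ S) (u : Bool) :
    k ≤ a (.mid u) := by
  by_contra! hlt
  have hvk : (Lab.line k).Valid m := hkm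
  have hvs : ∀ s, (Lab.mid s).Valid m := fun _ => he
  have hnot : ∀ s, ¬ r (.mid s) (.line k) := by
    intro s hs
    have h2 : r (.mid u) (.line k) := by
      rcases Bool.eq_or_eq_not u s with rfl | rfl
      · exact hs
      · exact h.trans _ _ _ (hvs _) (hvs _) hvk (h.mid_le_mid hm h1 he (hS s)) hs
    have h3 := h.anti _ _ (hvs u) hvk h2
    rw [h.a_eq hvk hk] at h3
    simp only [Lab.pos] at h3
    omega
  obtain ⟨c, hkc, hcm, hLc, hmax⟩ := exists_max_line (L := fun x => r x (.line k))
    (l := (m + 1) / 2) (h.refl hvk) (by omega)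
  exact h.top_mid he (h.closed hvk) (c := c) (by omega) u (by omega) hLc hnot
    fun j hj hr => hmax j (by omega) hr

/-- If a line is supported above a lower Springer line, then exactly one middle character is
supported on the lower side. -/
theorem exists_one_mid (h : IsLabSystem m S r a P) {κ l : ℕ} (hκ0 : κ ≠ 0) (hκl : κ < l)
    (hl : 2 * l < m) (hκ : Lab.line κ ∈ S) (hlt : a (.line l) < κ) :
    Even m ∧ ∃ u, r (.mid u) (.line κ) ∧ ¬ r (.mid (!u)) (.line κ) ∧
      ∀ j, 2 * j < m → r (.line j) (.line κ) → j < l := by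
  have hvκ : (Lab.line κ).Valid m := show 2 * κ < m by omega
  have hvl : (Lab.line l).Valid m := hl
  have hnl : ¬ r (.line l) (.line κ) := by
    intro h'
    have h3 := h.anti _ _ hvl hvκ h'
    rw [h.a_eq hvκ hκ] at h3
    simp only [Lab.pos] at h3
    omega
  obtain ⟨c, hκc, hcl, hLc, hmax⟩ := exists_max_line (L := fun x => r x (.line κ))
    (h.refl hvκ) hκl
  -- Otherwise l lies in a gap between neighbouring lines of the closed set, which `between_lines`
  -- forbids; d is the lowest line above the gap.
  have hno : ∀ j, 2 * j < m → r (.line j) (.line κ) → j < l := by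
    intro j hj hr
    by_contra! hlj
    have hlj' : l < j := lt_of_le_of_ne hlj (by rintro rfl; exact hnl hr)
    classical
    have hex : ∃ d, l < d ∧ 2 * d < m ∧ r (.line d) (.line κ) := ⟨j, hlj', hj, hr⟩
    obtain ⟨hd1, hd2, hd3⟩ := Nat.find_spec hex
    refine h.between_lines (h.closed hvκ) (c := c) (l := l) (by omega) hcl hd1 hd2 hLc hd3 ?_
    intro i hi hLi
    by_cases hil : i < l
    · exact Or.inl (hmax i hil hLi)
    · right
      refine Nat.find_min' hex ⟨lt_of_le_of_ne (not_lt.1 hil) ?_, hi, hLi⟩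
      rintro rfl
      exact hnl hLi
  have hmax' : ∀ j, 2 * j < m → r (.line j) (.line κ) → j ≤ c :=
    fun j hj hr => hmax j (hno j hj hr) hr
  -- No middle character contradicts `top_line`, two contradict `below_mids`; exactly one is left.
  by_cases hs : Even m → ∀ s, ¬ r (.mid s) (.line κ)
  · exact (h.top_line (h.closed hvκ) (c := c) (by omega) hcl hl hLc hs hmax').elim
  · push Not at hs
    obtain ⟨he, u, hu⟩ := hs
    refine ⟨he, u, hu, ?_, hno⟩
    intro hu'
    refine h.below_mids he (h.closed hvκ) (c := c) (by omega) hcl hl hLc ?_ hmax'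
    intro s
    rcases Bool.eq_or_eq_not s u with rfl | rfl
    · exact hu
    · exact hu'

/-- Both middle characters are supported at most at χ_1 by the family condition, so the exceptional
case of `exists_one_mid` cannot occur. -/
theorem line_bound_one (h : IsLabSystem m S r a P) (hm : 3 ≤ m) (h1 : Lab.line 1 ∈ S) {l : ℕ}
    (hl1 : 1 < l) (hl : 2 * l < m) : 1 ≤ a (.line l) := by
  by_contra! hlt
  obtain ⟨he, u, -, h2, -⟩ := h.exists_one_mid one_ne_zero hl1 hl h1 hlt
  exact h2 (h.family he _)

/-- A violation requires exactly one middle character below χ_κ. This is impossible if S treats both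
alike or contains a line beyond l, and the inequality of `one_mid` excludes it for small l + κ. -/
theorem line_bound (h : IsLabSystem m S r a P) (hm : 3 ≤ m) (hSv : ∀ x ∈ S, x.Valid m)
    (h1 : Lab.line 1 ∈ S) {κ l : ℕ} (hκl : κ < l) (hl : 2 * l < m) (hκ : Lab.line κ ∈ S)
    (hprev : ∀ j, j < l → Lab.line j ∈ S → j ≤ κ)
    (hmid : (Lab.mid true ∈ S ↔ Lab.mid false ∈ S) ∨ (∃ j, l < j ∧ Lab.line j ∈ S) ∨
      l + κ ≤ m / 2 + 1) : κ ≤ a (.line l) := by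
  by_contra! hlt
  have hvκ : (Lab.line κ).Valid m := show 2 * κ < m by omega
  have hvl : (Lab.line l).Valid m := hl
  obtain ⟨he, u, hu, hu', hno⟩ := h.exists_one_mid (by omega) hκl hl hκ hlt
  have hvs : ∀ s, (Lab.mid s).Valid m := fun _ => he
  have hin : ∀ s, Lab.mid s ∈ S → r (.mid s) (.line κ) := by
    intro s hs
    refine h.le_of_lt hvκ (hvs s) ?_
    rw [h.a_eq hvκ hκ, h.a_eq (hvs s) hs]
    simp only [Lab.pos]
    omega
  rcases hmid with hmid | ⟨j, hj, hjS⟩ | hmid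
  · by_cases hS : Lab.mid u ∈ S
    · apply hu'
      apply hin
      cases u
      · exact hmid.2 hS
      · exact hmid.1 hS
    · exact hu' (h.trans _ _ _ (hvs _) (hvs _) hvκ (h.mid_le_mid hm h1 he hS) hu)
  · have hvj := hSv _ hjS
    have h2 := hno j hvj (h.le_of_lt hvκ hvj (by
      rw [h.a_eq hvκ hκ, h.a_eq hvj hjS]
      simp only [Lab.pos]
      omega))
    omega
  -- Since c < l, a(c) ≤ κ and the middle character has a ≥ 1, `one_mid` yields m/2 + 1 ≤ c + κ < l
  -- + κ.
  · obtain ⟨c, hκc, hcl, hLc, hmax⟩ := exists_max_line (L := fun x => r x (.line κ))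
      (h.refl hvκ) hκl
    have hvc : (Lab.line c).Valid m := show 2 * c < m by omega
    have h2 := (h.one_mid he (h.closed hvκ) (c := c) (by omega) (by omega) hLc hu hu'
      fun j hj hr => hmax j (hno j hj hr) hr).2
    have h3 := h.mid_bound_one hm h1 he (!u)
    have h4 : a (.line c) ≤ κ := by
      obtain ⟨σ, hσS, hσ, -, -, h5, -, h6, -⟩ := h.rep _ hvc
      have h7 : σ.pos m ≤ c := by
        by_cases h8 : Lab.line c = σ
        · rw [← h8]; exact le_rfl
        · exact (h6 h8).le
      cases σ with
      | line j =>
        simp only [Lab.pos] at h5 h7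
        rw [h5]
        exact hprev j (by omega) hσS
      | mid s => simp only [Lab.pos] at h7; omega
      | sgn => simp only [Lab.pos] at h7; omega
    omega

end IsLabSystem

/-! ### The maximal Springer correspondence in terms of labels -/

/-- The conditions on the labels of the Springer representations. -/
structure IsBase (m : ℕ) (S : Set Lab) : Prop where
  three_le : 3 ≤ m
  valid : ∀ x ∈ S, x.Valid m
  triv : Lab.line 0 ∈ S
  refl : Lab.line 1 ∈ S
  sgn : Lab.sgn ∈ S

section

variable (m) (S : Set Lab)

open Classical in
/-- The largest line in `S` below `n`. -/
def prevLine (n : ℕ) : ℕ := Nat.findGreatest (fun j => Lab.line j ∈ S) (n - 1)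

/-- The largest line in `S`. -/
def topLine : ℕ := prevLine S m

open Classical in
/-- The characters outside `S` which lie beyond this threshold have the support of `χ₁`. -/
def threshold : ℕ :=
  -- The value m lies beyond no label. Otherwise, with top line t and threshold θ, a row at position
  -- p > θ has the entry q^(t+θ-p) in the class of t; divisibility by q for all p ≤ m/2 requires t +
  -- θ ≥ m/2 + 1.
  if Lab.mid true ∈ S ↔ Lab.mid false ∈ S then m else max (topLine m S) (m / 2 + 1 - topLine m S)

/-- The characters outside `S` beyond the threshold. -/
def IsHigh (x : Lab) : Prop := x ∉ S ∧ threshold m S < x.pos m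

open Classical in
/-- The Springer representation of the support. -/
def springerRep (x : Lab) : Lab :=
  if x ∈ S then x else if IsHigh m S x then .line 1 else .line (prevLine S (x.pos m))

open Classical in
/-- `q ^ (m - 2 a)` for the smallest line `a ≥ n` in `S`; if there is none, one less than the
number of middle characters in `S`. -/
def gapTerm (n : ℕ) : RatFunc ℂ :=
  -- Chosen so that the class of χ_a contributes q^(i+j)(gap(a) - gap(a+1)) to lines i, j < a below
  -- the threshold. The sum telescopes, and the last value makes the middle characters in S,
  -- contributing q^(i+j) each, leave exactly one q^(i+j).
  if h : ∃ a, n ≤ a ∧ Lab.line a ∈ S then q ^ (m - 2 * Nat.find h)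
  else (if Lab.mid true ∈ S then 1 else 0) + (if Lab.mid false ∈ S then 1 else 0) - 1

end

section

variable {S : Set Lab}

theorem prevLine_mem (h0 : Lab.line 0 ∈ S) (n : ℕ) : Lab.line (prevLine S n) ∈ S := by
  classical
  exact Nat.findGreatest_spec (P := fun j => Lab.line j ∈ S) (Nat.zero_le _) h0

theorem prevLine_lt {n : ℕ} (hn : n ≠ 0) : prevLine S n < n := by
  classical
  have := Nat.findGreatest_le (P := fun j => Lab.line j ∈ S) (n - 1)
  unfold prevLine
  omega

theorem le_prevLine {n j : ℕ} (hj : j < n) (h : Lab.line j ∈ S) : j ≤ prevLine S n := by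
  classical
  exact Nat.le_findGreatest (by omega) h

theorem gapTerm_of_mem {n : ℕ} (h : Lab.line n ∈ S) : gapTerm m S n = q ^ (m - 2 * n) := by
  classical
  have hex : ∃ a, n ≤ a ∧ Lab.line a ∈ S := ⟨n, le_rfl, h⟩
  rw [gapTerm, dif_pos hex]
  have h1 := (Nat.find_spec hex).1
  have h2 := Nat.find_min' hex ⟨le_rfl, h⟩
  rw [show Nat.find hex = n by omega]

theorem gapTerm_of_not_mem {n : ℕ} (h : Lab.line n ∉ S) :
    gapTerm m S n = gapTerm m S (n + 1) := by
  classical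
  have hiff : ∀ a, (n ≤ a ∧ Lab.line a ∈ S) ↔ (n + 1 ≤ a ∧ Lab.line a ∈ S) := by
    intro a
    refine ⟨fun ⟨h1, h2⟩ => ⟨?_, h2⟩, fun ⟨h1, h2⟩ => ⟨by omega, h2⟩⟩
    rcases Nat.lt_or_ge n a with h3 | h3
    · exact h3
    · exact absurd (by rwa [show n = a by omega]) h
  simp only [gapTerm, hiff]

namespace IsBase

variable (hS : IsBase m S)
include hS

theorem line_lt {j : ℕ} (h : Lab.line j ∈ S) : 2 * j < m := hS.valid _ h

theorem top_mem : Lab.line (topLine m S) ∈ S := prevLine_mem hS.triv m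

theorem le_top {j : ℕ} (h : Lab.line j ∈ S) : j ≤ topLine m S :=
  le_prevLine (by have := hS.line_lt h; omega) h

theorem one_le_top : 1 ≤ topLine m S := hS.le_top hS.refl

theorem top_lt : 2 * topLine m S < m := hS.line_lt hS.top_mem

theorem gapTerm_of_large {n : ℕ} (h : topLine m S < n) : gapTerm m S n =
    open Classical in
    (if Lab.mid true ∈ S then 1 else 0) + (if Lab.mid false ∈ S then 1 else 0) - 1 := by
  rw [gapTerm, dif_neg]
  rintro ⟨a, ha, haS⟩
  have := hS.le_top haS
  omega

theorem not_isHigh_sgn : ¬ IsHigh m S .sgn := fun h => h.1 hS.sgn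

/-- What happens if there are characters beyond the threshold. -/
theorem of_isHigh {x : Lab} (hx : x.Valid m) (h : IsHigh m S x) :
    Even m ∧ (∃ s, Lab.mid s ∈ S ∧ Lab.mid (!s) ∉ S) ∧ 2 ≤ topLine m S ∧
      topLine m S ≤ threshold m S ∧ m / 2 + 1 ≤ threshold m S + topLine m S ∧
      threshold m S < x.pos m ∧ x.pos m ≤ m / 2 ∧ springerRep m S (.line (threshold m S)) =
        .line (topLine m S) := by
  obtain ⟨hxS, hlt⟩ := h
  have hpos : x.pos m ≤ m / 2 := by
    cases x with
    | line j => have : 2 * j < m := hx; simp only [Lab.pos]; omega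
    | mid s => exact le_rfl
    | sgn => exact absurd hS.sgn hxS
  have hthr := hlt
  have hm := hS.three_le
  unfold threshold at hlt
  split_ifs at hlt with hiff
  · omega
  have h1 := hS.one_le_top
  have hmid : ∃ s, Lab.mid s ∈ S ∧ Lab.mid (!s) ∉ S := by
    by_cases ht : Lab.mid true ∈ S
    · exact ⟨true, ht, fun hf => hiff ⟨fun _ => hf, fun _ => ht⟩⟩
    · refine ⟨false, ?_, ht⟩
      by_contra hf
      exact hiff ⟨fun h' => absurd h' ht, fun h' => absurd h' hf⟩
  have hthr_eq : threshold m S = max (topLine m S) (m / 2 + 1 - topLine m S) := if_neg hiff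
  obtain ⟨s, hs, hs'⟩ := hmid
  -- If the top line were χ_1, the threshold would be m/2 and nothing would lie beyond it; hence the
  -- top line is at least 2.
  refine ⟨hS.valid _ hs, ⟨s, hs, hs'⟩, by omega, by omega, by omega, hthr, hpos, ?_⟩
  by_cases hT : Lab.line (threshold m S) ∈ S
  · have := hS.le_top hT
    rw [springerRep, if_pos hT]
    congr 1
    omega
  · rw [springerRep, if_neg hT, if_neg (fun h => lt_irrefl _ h.2)]
    congr 1
    have hne : topLine m S ≠ threshold m S := fun h => hT (h ▸ hS.top_mem)
    apply le_antisymm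
    · exact hS.le_top (prevLine_mem hS.triv _)
    · exact le_prevLine (by simp only [Lab.pos]; omega) hS.top_mem

theorem springerRep_of_mem {x : Lab} (h : x ∈ S) : springerRep m S x = x := if_pos h

theorem springerRep_mem (x : Lab) : springerRep m S x ∈ S := by
  unfold springerRep
  split_ifs with h1 h2
  · exact h1
  · exact hS.refl
  · exact prevLine_mem hS.triv _

theorem springerRep_of_isHigh {x : Lab} (h : IsHigh m S x) : springerRep m S x = .line 1 := by
  rw [springerRep, if_neg h.1, if_pos h]

theorem not_isHigh_of_mem {x : Lab} (h : x ∈ S) : ¬ IsHigh m S x := fun h' => h'.1 h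

/-- The support of the other lines and middle characters. -/
theorem springerRep_of_not_isHigh {x : Lab} (hx : x.Valid m) (h : ¬ IsHigh m S x)
    (hsgn : x ≠ .sgn) (hmid : ∀ s, x = .mid s → x ∉ S) :
    ∃ ρ, springerRep m S x = .line ρ ∧ Lab.line ρ ∈ S ∧ ρ ≤ x.pos m ∧
      ∀ j, Lab.line j ∈ S → j ≤ x.pos m → j ≤ ρ := by
  by_cases hxS : x ∈ S
  · cases x with
    | line j => exact ⟨j, if_pos hxS, hxS, le_rfl, fun _ _ h => h⟩
    | mid s => exact absurd hxS (hmid s rfl)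
    | sgn => exact absurd rfl hsgn
  · have hm := hS.three_le
    have hpos : x.pos m ≠ 0 := by
      intro h0
      cases x with
      | line j => simp only [Lab.pos] at h0; subst h0; exact hxS hS.triv
      | mid s => simp only [Lab.pos] at h0; omega
      | sgn => exact hsgn rfl
    refine ⟨_, by rw [springerRep, if_neg hxS, if_neg h], prevLine_mem hS.triv _,
      (prevLine_lt hpos).le, fun j hj hjx => le_prevLine (lt_of_le_of_ne hjx ?_) hj⟩
    intro hj'
    cases x with
    | line i => simp only [Lab.pos] at hj'; subst hj'; exact hxS hj
    | mid s =>
      have := hS.line_lt hj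
      have : Even m := hx
      rw [Nat.even_iff] at this
      simp only [Lab.pos] at hj'
      omega
    | sgn => exact hsgn rfl

/-- The other members of a class lie beyond its Springer representation. -/
theorem pos_springerRep_lt {x : Lab} (hx : x.Valid m) (hxS : x ∉ S) :
    (springerRep m S x).pos m < x.pos m := by
  by_cases h : IsHigh m S x
  · rw [hS.springerRep_of_isHigh h]
    obtain ⟨-, -, h1, h2, -, h3, -⟩ := hS.of_isHigh hx h
    change 1 < x.pos m
    omega
  · have hsgn : x ≠ .sgn := fun h' => hxS (h' ▸ hS.sgn)
    obtain ⟨ρ, h1, h2, h3, -⟩ := hS.springerRep_of_not_isHigh hx h hsgn fun _ _ => hxS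
    rw [h1]
    refine lt_of_le_of_ne h3 ?_
    intro h4
    simp only [Lab.pos] at h4
    cases x with
    | line i => simp only [Lab.pos] at h4; subst h4; exact hxS h2
    | mid s =>
      have := hS.line_lt h2
      have : Even m := hx
      rw [Nat.even_iff] at this
      simp only [Lab.pos] at h4
      omega
    | sgn => exact hsgn rfl

/-- The Springer representation of the support in the candidate is the lowest possible one. -/
theorem pos_springerRep_le {r : Lab → Lab → Prop} {a : Lab → ℕ} {P : Lab → Lab → RatFunc ℂ}
    (h : IsLabSystem m S r a P) {x : Lab} (hx : x.Valid m) : (springerRep m S x).pos m ≤ a x := by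
  by_cases hxS : x ∈ S
  · rw [hS.springerRep_of_mem hxS, h.a_eq hx hxS]
  have hm := hS.three_le
  by_cases hh : IsHigh m S x
  · rw [hS.springerRep_of_isHigh hh]
    obtain ⟨he, -, h1, h2, -, h3, -⟩ := hS.of_isHigh hx hh
    cases x with
    | line l => exact h.line_bound_one hm hS.refl (by simp only [Lab.pos] at h3; omega) hx
    | mid s => exact h.mid_bound_one hm hS.refl he s
    | sgn => exact absurd hS.sgn hxS
  · have hrep : springerRep m S x = .line (prevLine S (x.pos m)) := by
      rw [springerRep, if_neg hxS, if_neg hh]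
    rw [hrep]
    simp only [Lab.pos]
    have hle : x.pos m ≤ threshold m S := not_lt.1 fun h' => hh ⟨hxS, h'⟩
    cases x with
    | sgn => exact absurd hS.sgn hxS
    | line l =>
      simp only [Lab.pos] at hle ⊢
      have hl0 : l ≠ 0 := by rintro rfl; exact hxS hS.triv
      refine h.line_bound hm hS.valid hS.refl (prevLine_lt hl0) hx (prevLine_mem hS.triv _)
        (fun j hj hjS => le_prevLine hj hjS) ?_
      by_cases hiff : Lab.mid true ∈ S ↔ Lab.mid false ∈ S
      · exact Or.inl hiff
      · right
        rw [threshold, if_neg hiff] at hle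
        have hlt : l ≠ topLine m S := by rintro rfl; exact hxS hS.top_mem
        rcases lt_or_gt_of_ne hlt with h1 | h1
        · exact Or.inl ⟨_, h1, hS.top_mem⟩
        · right
          have := hS.le_top (prevLine_mem hS.triv l)
          omega
    | mid s =>
      -- If the other middle character is in S, not being beyond the threshold forces the top line
      -- to be χ_1, and the bound 1 suffices.
      by_cases hs : Lab.mid (!s) ∈ S
      · have hiff : ¬ (Lab.mid true ∈ S ↔ Lab.mid false ∈ S) := by
          cases s <;> simp_all
        have hle' := hle
        simp only [Lab.pos] at hle
        rw [threshold, if_neg hiff] at hle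
        have h1 := hS.top_lt
        have h2 := hS.one_le_top
        have he : Even m := hx
        have h3 := hS.le_top (prevLine_mem hS.triv (m / 2))
        have h4 := Nat.even_iff.1 he
        refine le_trans ?_ (h.mid_bound_one hm hS.refl he s)
        change prevLine S (m / 2) ≤ 1
        omega
      · refine h.mid_bound hm hS.refl hx ?_ (hS.line_lt (prevLine_mem hS.triv _))
          (prevLine_mem hS.triv _) s
        intro u
        rcases Bool.eq_or_eq_not u s with rfl | rfl
        · exact hxS
        · exact hs

end IsBase

end

/-! ### The Green functions -/

section

variable (m) (S : Set Lab)

open Classical in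
/-- The member of the class of `σ ∈ S` at which the row of `x` does not vanish. -/
def greenCol (x σ : Lab) : Lab :=
  if springerRep m S x = σ then x
  -- The row of a character beyond the threshold θ meets the class of the top line in χ_θ, the
  -- largest line of that class.
  else if IsHigh m S x ∧ σ = .line (topLine m S) then .line (threshold m S) else σ

open Classical in
/-- The entry in the row of `x` and the class of `σ ∈ S`. -/
def greenVal (x σ : Lab) : RatFunc ℂ :=
  if springerRep m S x = σ then q ^ σ.pos m
  else if σ = .sgn then Rdeg m x
  else if IsHigh m S x ∧ σ = .line (topLine m S) then q ^ (topLine m S + threshold m S - x.pos m)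
  else if x.pos m < σ.pos m then q ^ x.pos m else 0

/-- The part of `Λ` for two characters that are not beyond the threshold. -/
def lowKer : Lab → Lab → RatFunc ℂ
  | .line i, .line j => q ^ (m - (max i j - min i j)) - gapTerm m S (max i j + 1) * q ^ (i + j)
  | x, y => Ker m x y

/-- The part of `Λ` for two characters beyond the threshold. -/
def highKer : Lab → Lab → RatFunc ℂ
  | .line i, .line j => q ^ (m - (max i j - min i j)) - q ^ (m + 2 * threshold m S - (i + j))
  | x, y => Ker m x y - q ^ (m + 2 * threshold m S - (x.pos m + y.pos m))

open Classical in
/-- The entries of `Λ` within a class, up to a factor. -/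
def classKer (x y : Lab) : RatFunc ℂ :=
  if IsHigh m S x ∧ IsHigh m S y then highKer m S x y
  else if IsHigh m S x ∨ IsHigh m S y then 0 else lowKer m S x y

/-- The contribution of the class of `σ` to the kernel. -/
def classTerm (x y σ : Lab) : RatFunc ℂ :=
  (q ^ (2 * σ.pos m))⁻¹ * (greenVal m S x σ * greenVal m S y σ) *
    classKer m S (greenCol m S x σ) (greenCol m S y σ)

open Classical in
/-- The sum of the contributions of all classes other than that of the sign character. -/
def classSum (x y : Lab) : RatFunc ℂ :=
  ∑ a ∈ Finset.range ((m + 1) / 2), (if Lab.line a ∈ S then classTerm m S x y (.line a) else 0) +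
    ∑ s : Bool, (if Lab.mid s ∈ S then classTerm m S x y (.mid s) else 0)

end

theorem Ker_comm (x y : Lab) : Ker m x y = Ker m y x := by
  cases x <;> cases y <;> simp only [Ker, max_comm, min_comm, add_comm, eq_comm]

/-! ### Row entries and contributions of single classes -/

section

variable {S : Set Lab}

theorem classKer_comm (x y : Lab) : classKer m S x y = classKer m S y x := by
  have h1 : lowKer m S x y = lowKer m S y x := by
    cases x <;> cases y <;> simp only [lowKer, Ker_comm, max_comm, min_comm, add_comm]
  have h2 : highKer m S x y = highKer m S y x := by
    cases x <;> cases y <;> simp only [highKer, max_comm, min_comm, add_comm] <;> rw [Ker_comm]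
  unfold classKer
  rw [h1, h2]
  by_cases hx : IsHigh m S x <;> by_cases hy : IsHigh m S y <;> simp [hx, hy]

theorem classTerm_comm (x y σ : Lab) : classTerm m S x y σ = classTerm m S y x σ := by
  rw [classTerm, classTerm, classKer_comm, mul_comm (greenVal m S x σ)]

theorem classSum_comm (x y : Lab) : classSum m S x y = classSum m S y x := by
  simp only [classSum, classTerm_comm]

theorem classTerm_eq_zero {x y σ : Lab} (h : greenVal m S y σ = 0) : classTerm m S x y σ = 0 := by
  rw [classTerm, h, mul_zero, mul_zero, zero_mul]

theorem classKer_of_not_isHigh {x y : Lab} (hx : ¬ IsHigh m S x) (hy : ¬ IsHigh m S y) :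
    classKer m S x y = lowKer m S x y := by
  rw [classKer, if_neg (fun h => hx h.1), if_neg (fun h => h.elim hx hy)]

theorem classKer_mixed {x y : Lab} (hx : IsHigh m S x) (hy : ¬ IsHigh m S y) :
    classKer m S x y = 0 := by
  rw [classKer, if_neg (fun h => hy h.2), if_pos (Or.inl hx)]

theorem lowKer_of_le {i j : ℕ} (h : i ≤ j) : lowKer m S (.line i) (.line j) =
    q ^ (m - (j - i)) - gapTerm m S (j + 1) * q ^ (i + j) := by
  rw [lowKer, max_eq_right h, min_eq_left h]

namespace IsBase

variable (hS : IsBase m S)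
include hS

/-- The row of a line or middle character which is neither beyond the threshold nor a middle
character in `S`. -/
theorem greenVal_low {x : Lab} (hx : ¬ IsHigh m S x) {ρ : ℕ}
    (hρ : springerRep m S x = .line ρ) (a : ℕ) :
    greenVal m S x (.line a) = (if a = ρ then q ^ ρ else if x.pos m < a then q ^ x.pos m else 0) ∧
    greenCol m S x (.line a) = (if a = ρ then x else .line a) := by
  constructor
  · by_cases h : a = ρ
    · subst h
      rw [greenVal, if_pos hρ, if_pos rfl]
      rfl
    · rw [greenVal, if_neg (by rw [hρ]; simpa using Ne.symm h), if_neg (by simp),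
        if_neg (fun h => hx h.1), if_neg h]
      rfl
  · by_cases h : a = ρ
    · subst h
      rw [greenCol, if_pos hρ, if_pos rfl]
    · rw [greenCol, if_neg (by rw [hρ]; simpa using Ne.symm h),
        if_neg (fun h => hx h.1), if_neg h]

theorem greenVal_high {x : Lab} (hxv : x.Valid m) (hx : IsHigh m S x) (a : ℕ)
    (ha : Lab.line a ∈ S) :
    greenVal m S x (.line a) = (if a = 1 then q else if a = topLine m S then
      q ^ (topLine m S + threshold m S - x.pos m) else 0) ∧
    greenCol m S x (.line a) = (if a = 1 then x else if a = topLine m S then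
      .line (threshold m S) else .line a) := by
  have hr := hS.springerRep_of_isHigh hx
  obtain ⟨-, -, h1, h2, -, h3, -⟩ := hS.of_isHigh hxv hx
  constructor
  · by_cases h : a = 1
    · subst h
      rw [greenVal, if_pos hr, if_pos rfl, Lab.pos, pow_one]
    · rw [greenVal, if_neg (by rw [hr]; simpa using Ne.symm h), if_neg (by simp), if_neg h]
      by_cases h' : a = topLine m S
      · rw [if_pos ⟨hx, by rw [h']⟩, if_pos h']
      · rw [if_neg (fun h => h' (by simpa using h.2)), if_neg h', if_neg]
        have := hS.le_top ha
        change ¬ x.pos m < a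
        omega
  · by_cases h : a = 1
    · subst h
      rw [greenCol, if_pos hr, if_pos rfl]
    · rw [greenCol, if_neg (by rw [hr]; simpa using Ne.symm h), if_neg h]
      by_cases h' : a = topLine m S
      · rw [if_pos ⟨hx, by rw [h']⟩, if_pos h']
      · rw [if_neg (fun h => h' (by simpa using h.2)), if_neg h']

theorem greenVal_mid {x : Lab} {s : Bool} (h : springerRep m S x ≠ .mid s) :
    greenVal m S x (.mid s) = (if x.pos m < m / 2 then q ^ x.pos m else 0) ∧
    greenCol m S x (.mid s) = .mid s := by
  constructor
  · rw [greenVal, if_neg h, if_neg (by simp), if_neg (by simp)]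
    rfl
  · rw [greenCol, if_neg h, if_neg (by simp)]

theorem springerRep_ne_mid {x : Lab} {s : Bool} (hx : x ≠ .mid s) : springerRep m S x ≠ .mid s := by
  unfold springerRep
  split_ifs <;> simp [hx]

theorem greenVal_of_mid_mem {s : Bool} (hs : Lab.mid s ∈ S) :
    (∀ a, Lab.line a ∈ S → greenVal m S (.mid s) (.line a) = 0) ∧
    (∀ t, greenVal m S (.mid s) (.mid t) = if s = t then q ^ (m / 2) else 0) := by
  have hr := hS.springerRep_of_mem hs
  constructor
  · intro a ha
    have := hS.line_lt ha
    rw [greenVal, if_neg (by rw [hr]; simp), if_neg (by simp),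
      if_neg (fun h => hS.not_isHigh_of_mem hs h.1), if_neg]
    simp only [Lab.pos]
    omega
  · intro t
    by_cases h : s = t
    · subst h
      rw [greenVal, if_pos hr, if_pos rfl, Lab.pos]
    · rw [greenVal, if_neg (by rw [hr]; simpa using h), if_neg (by simp),
        if_neg (by simp), if_neg h, if_neg]
      simp only [Lab.pos]
      omega

/-- The term of a middle character in `S` for two other characters. -/
theorem classTerm_mid {x y : Lab} {s : Bool} (hs : Lab.mid s ∈ S) (hx : x ≠ .mid s)
    (hy : y ≠ .mid s) : classTerm m S x y (.mid s) =
      if x.pos m < m / 2 ∧ y.pos m < m / 2 then q ^ (x.pos m + y.pos m) else 0 := by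
  have hq := q_ne_zero
  have he : Even m := hS.valid _ hs
  obtain ⟨hx1, hx2⟩ := hS.greenVal_mid (hS.springerRep_ne_mid hx)
  obtain ⟨hy1, hy2⟩ := hS.greenVal_mid (hS.springerRep_ne_mid hy)
  have h0 := hS.not_isHigh_of_mem hs
  rw [classTerm, hx1, hx2, hy1, hy2, classKer_of_not_isHigh h0 h0]
  by_cases h1 : x.pos m < m / 2
  · by_cases h2 : y.pos m < m / 2
    · rw [if_pos h1, if_pos h2, if_pos ⟨h1, h2⟩]
      have : 2 * (m / 2) = m := Nat.two_mul_div_two_of_even he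
      simp only [lowKer, Ker, if_true, Lab.pos, this]
      field_simp
      ring
    · rw [if_neg h2, if_neg (show ¬ (_ ∧ _) from fun h => h2 h.2)]; ring
  · rw [if_neg h1, if_neg (show ¬ (_ ∧ _) from fun h => h1 h.1)]; ring

/-- The case of a middle character in `S`. -/
theorem classSum_mid {x : Lab} (hx : x.Valid m) {s : Bool} (hs : Lab.mid s ∈ S) :
    classSum m S x (.mid s) = Ker m x (.mid s) := by
  have hq := q_ne_zero
  have he : Even m := hS.valid _ hs
  have hm2 : 2 * (m / 2) = m := Nat.two_mul_div_two_of_even he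
  obtain ⟨h1, h2⟩ := hS.greenVal_of_mid_mem hs
  rw [classSum, Finset.sum_eq_zero, zero_add, Finset.sum_eq_single s, if_pos hs]
  · have h0 := hS.not_isHigh_of_mem hs
    have hcol : greenCol m S (.mid s) (.mid s) = .mid s := by
      rw [greenCol, if_pos (hS.springerRep_of_mem hs)]
    rw [classTerm, h2, if_pos rfl, hcol]
    by_cases hxs : x = .mid s
    · subst hxs
      rw [h2, if_pos rfl, hcol, classKer_of_not_isHigh h0 h0, Lab.pos, hm2, ← pow_add, ← two_mul,
        hm2]
      simp only [lowKer]
      field_simp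
    · obtain ⟨h3, h4⟩ := hS.greenVal_mid (hS.springerRep_ne_mid hxs)
      rw [h3, h4, classKer_of_not_isHigh h0 h0, Lab.pos, hm2]
      cases x with
      | sgn =>
        rw [if_neg (by simp only [Lab.pos]; omega)]
        simp [Ker]
      | mid t =>
        have hts : t ≠ s := fun h => hxs (by rw [h])
        rw [if_neg (by simp only [Lab.pos]; omega)]
        simp [Ker, hts]
      | line i =>
        have hi : 2 * i < m := hx
        rw [if_pos (by simp only [Lab.pos]; omega)]
        simp only [lowKer, Ker, if_true, Lab.pos]
        field_simp
        ring
  · intro t _ hts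
    split_ifs
    · exact classTerm_eq_zero (by rw [h2, if_neg hts.symm])
    · rfl
  · simp
  · intro a _
    split_ifs with ha
    · exact classTerm_eq_zero (h1 a ha)
    · rfl

theorem greenVal_sgn {σ : Lab} (hσ : σ ∈ S) (hne : σ ≠ .sgn) : greenVal m S .sgn σ = 0 := by
  rw [greenVal, if_neg (by rw [hS.springerRep_of_mem hS.sgn]; exact hne.symm), if_neg hne,
    if_neg (fun h => hS.not_isHigh_sgn h.1), if_neg]
  have := hS.valid _ hσ
  cases σ with
  | line j => have : 2 * j < m := this; simp only [Lab.pos]; omega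
  | mid s => simp only [Lab.pos]; omega
  | sgn => exact absurd rfl hne

theorem classSum_sgn (x : Lab) : classSum m S x .sgn = 0 := by
  rw [classSum, Finset.sum_eq_zero, Finset.sum_eq_zero, add_zero]
  · intro s _
    split_ifs with h
    · exact classTerm_eq_zero (hS.greenVal_sgn h (by simp))
    · rfl
  · intro a _
    split_ifs with h
    · exact classTerm_eq_zero (hS.greenVal_sgn h (by simp))
    · rfl

/-- Telescoping. -/
theorem sum_gapTerm {n : ℕ} (c : RatFunc ℂ) (hn : n ≤ (m + 1) / 2) :
    ∑ a ∈ Finset.range ((m + 1) / 2),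
      (if n ≤ a then c * (gapTerm m S a - gapTerm m S (a + 1)) else 0) =
    c * (gapTerm m S n - gapTerm m S ((m + 1) / 2)) := by
  rw [← Finset.sum_filter, ← Finset.mul_sum]
  congr 1
  have : (Finset.range ((m + 1) / 2)).filter (fun a => n ≤ a) = Finset.Ico n ((m + 1) / 2) := by
    ext a; simp [and_comm]
  rw [this, Finset.sum_Ico_eq_sum_range]
  have h := Finset.sum_range_sub' (fun k => gapTerm m S (n + k)) ((m + 1) / 2 - n)
  rw [add_zero, show n + ((m + 1) / 2 - n) = (m + 1) / 2 by omega] at h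
  rw [← h]
  rfl

/-- The case of two lines which are not beyond the threshold. -/
theorem classSum_low_lines {i j : ℕ} (hij : i ≤ j) (hj : 2 * j < m)
    (hi' : ¬ IsHigh m S (.line i)) (hj' : ¬ IsHigh m S (.line j)) :
    classSum m S (.line i) (.line j) = Ker m (.line i) (.line j) := by
  classical
  have hq := q_ne_zero
  obtain ⟨ρ, hρ, hρS, hρi, hρmax⟩ := hS.springerRep_of_not_isHigh (x := .line i)
    (show 2 * i < m by omega) hi' (by simp) (by simp)
  obtain ⟨τ, hτ, hτS, hτj, hτmax⟩ := hS.springerRep_of_not_isHigh (x := .line j) hj hj'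
    (by simp) (by simp)
  simp only [Lab.pos] at hρi hρmax hτj hτmax
  have hρτ : ρ ≤ τ := hτmax ρ hρS (hρi.trans hij)
  -- Classes below that of j contribute nothing, the class of j contributes its own part of Λ, and
  -- each higher class gives one telescoping difference. For a ∉ S that difference is zero, so the
  -- sum may run over all lines.
  have hterm : ∀ a ∈ Finset.range ((m + 1) / 2),
      (if Lab.line a ∈ S then classTerm m S (.line i) (.line j) (.line a) else 0) =
      (if a = τ then q ^ (m - (j - i)) - gapTerm m S (j + 1) * q ^ (i + j) else 0) +
      (if j + 1 ≤ a then q ^ (i + j) * (gapTerm m S a - gapTerm m S (a + 1)) else 0) := by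
    intro a _
    by_cases haS : Lab.line a ∈ S
    · have ham := hS.line_lt haS
      have hx1 : greenVal m S (.line i) (.line a) =
        if a = ρ then q ^ ρ else if i < a then q ^ i else 0 := (hS.greenVal_low hi' hρ a).1
      have hx2 := (hS.greenVal_low hi' hρ a).2
      have hy1 : greenVal m S (.line j) (.line a) =
        if a = τ then q ^ τ else if j < a then q ^ j else 0 := (hS.greenVal_low hj' hτ a).1
      have hy2 := (hS.greenVal_low hj' hτ a).2
      rw [if_pos haS]
      rcases lt_trichotomy a τ with h | h | h
      · rw [if_neg h.ne, if_neg (show ¬ j < a by omega)] at hy1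
        rw [if_neg h.ne, if_neg (by omega), classTerm_eq_zero hy1, add_zero]
      · rw [if_pos h, ← h] at hy1
        rw [if_pos h] at hy2
        rw [if_pos h, if_neg (by omega), classTerm, hx1, hx2, hy1, hy2, Lab.pos]
        by_cases hρa : a = ρ
        · rw [if_pos hρa, if_pos hρa, classKer_of_not_isHigh hi' hj', lowKer_of_le hij, ← hρa]
          field_simp
          ring
        · have hia : i < a := by
            by_contra! h'
            have := hρmax a haS h'
            omega
          rw [if_neg hρa, if_neg hρa, if_pos hia,
            classKer_of_not_isHigh (hS.not_isHigh_of_mem haS) hj', lowKer_of_le (by omega)]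
          obtain ⟨d, rfl⟩ : ∃ d, a = i + d := ⟨a - i, by omega⟩
          rw [show m - (j - (i + d)) = m - (j - i) + d by omega]
          field_simp
          ring
      · have hja : j < a := by
          by_contra! h'
          have := hτmax a haS h'
          omega
        have ha := hS.not_isHigh_of_mem haS
        rw [if_neg (show a ≠ ρ by omega), if_pos (show i < a by omega)] at hx1
        rw [if_neg (show a ≠ ρ by omega)] at hx2
        rw [if_neg h.ne', if_pos hja] at hy1
        rw [if_neg h.ne'] at hy2
        rw [classTerm, hx1, hx2, hy1, hy2, Lab.pos, if_neg h.ne', if_pos (by omega),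
          classKer_of_not_isHigh ha ha, lowKer_of_le le_rfl, gapTerm_of_mem haS,
          show m - (a - a) = (m - 2 * a) + 2 * a by omega]
        field_simp
        ring
    · rw [if_neg haS, if_neg (by rintro rfl; exact haS hτS), gapTerm_of_not_mem haS, sub_self]
      simp
  have hmid : ∀ s : Bool, (if Lab.mid s ∈ S then classTerm m S (.line i) (.line j) (.mid s) else 0)
      = (if Lab.mid s ∈ S then 1 else 0) * q ^ (i + j) := by
    intro s
    split_ifs with h
    · rw [hS.classTerm_mid h (by simp) (by simp), if_pos, one_mul]
      · rfl
      · have := Nat.even_iff.1 (hS.valid _ h)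
        simp only [Lab.pos]
        omega
    · rw [zero_mul]
  rw [classSum, Finset.sum_congr rfl hterm, Finset.sum_add_distrib, Finset.sum_ite_eq',
    if_pos (by rw [Finset.mem_range]; omega), hS.sum_gapTerm _ (by omega),
    Finset.sum_congr rfl fun s _ => hmid s, Fintype.sum_bool, Ker, max_eq_right hij,
    min_eq_left hij, hS.gapTerm_of_large (n := (m + 1) / 2) (by have := hS.top_lt; omega)]
  ring

/-- The case of a middle character which is neither in `S` nor beyond the threshold. -/
theorem classSum_low_mid {x : Lab} (hx : x.Valid m) (hx' : ¬ IsHigh m S x) (hsgn : x ≠ .sgn)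
    (hxm : ∀ s, x = .mid s → x ∉ S) {u : Bool} (he : Even m) (hu : ¬ IsHigh m S (.mid u))
    (huS : Lab.mid u ∉ S) : classSum m S x (.mid u) = Ker m x (.mid u) := by
  classical
  have hq := q_ne_zero
  obtain ⟨ρ, hρ, hρS, hρi, hρmax⟩ := hS.springerRep_of_not_isHigh hx hx' hsgn hxm
  obtain ⟨τ, hτ, hτS, hτj, hτmax⟩ := hS.springerRep_of_not_isHigh (x := .mid u) he hu
    (by simp) (fun _ _ => huS)
  simp only [Lab.pos] at hτj hτmax
  have hpos : x.pos m ≤ m / 2 := by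
    cases x with
    | line i => have : 2 * i < m := hx; simp only [Lab.pos]; omega
    | mid s => exact le_rfl
    | sgn => exact absurd rfl hsgn
  have hρτ : ρ ≤ τ := hτmax ρ hρS (hρi.trans hpos)
  have hτm := hS.line_lt hτS
  -- Only the class of the middle character itself contributes, since no line lies at or beyond m/2.
  have hterm : ∀ a ∈ Finset.range ((m + 1) / 2),
      (if Lab.line a ∈ S then classTerm m S x (.mid u) (.line a) else 0) =
      (if a = τ then Ker m x (.mid u) else 0) := by
    intro a _
    by_cases haS : Lab.line a ∈ S
    · have ham := hS.line_lt haS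
      obtain ⟨hx1, hx2⟩ := hS.greenVal_low hx' hρ a
      have hy1 : greenVal m S (.mid u) (.line a) =
        if a = τ then q ^ τ else if m / 2 < a then q ^ (m / 2) else 0 :=
          (hS.greenVal_low hu hτ a).1
      have hy2 := (hS.greenVal_low hu hτ a).2
      rw [if_pos haS]
      by_cases h : a = τ
      · rw [if_pos h, ← h] at hy1
        rw [if_pos h] at hy2
        rw [if_pos h, classTerm, hx1, hx2, hy1, hy2, Lab.pos]
        by_cases hρa : a = ρ
        · have hlk : lowKer m S x (.mid u) = Ker m x (.mid u) := by cases x <;> rfl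
          rw [if_pos hρa, if_pos hρa, classKer_of_not_isHigh hx' hu, hlk, ← hρa]
          field_simp
          ring
        · have hia : x.pos m < a := by
            by_contra! h'
            have := hρmax a haS h'
            omega
          rw [if_neg hρa, if_neg hρa, if_pos hia,
            classKer_of_not_isHigh (hS.not_isHigh_of_mem haS) hu]
          cases x with
          | line i =>
            simp only [lowKer, Ker, Lab.pos]
            field_simp
            ring
          | mid s => simp only [Lab.pos] at hia; omega
          | sgn => exact absurd rfl hsgn
      · have := hτmax a haS (by omega)
        rw [if_neg h, if_neg (show ¬ m / 2 < a by omega)] at hy1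
        rw [if_neg h, classTerm_eq_zero hy1]
    · rw [if_neg haS, if_neg (by rintro rfl; exact haS hτS)]
  rw [classSum, Finset.sum_congr rfl hterm, Finset.sum_ite_eq',
    if_pos (by rw [Finset.mem_range]; omega), Finset.sum_eq_zero, add_zero]
  intro s _
  split_ifs with hs
  · have hne : Lab.mid u ≠ .mid s := by rintro h; exact huS (h ▸ hs)
    refine classTerm_eq_zero ?_
    rw [(hS.greenVal_mid (hS.springerRep_ne_mid hne)).1, if_neg (by simp [Lab.pos])]
  · rfl

end IsBase

end

/-! ### Characters beyond the threshold -/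

section

variable {S : Set Lab}

namespace IsBase

variable (hS : IsBase m S)
include hS

/-- The classes which contribute to the row of a character beyond the threshold. -/
theorem classSum_of_isHigh {x y : Lab} (hxv : x.Valid m) (hx : IsHigh m S x) (hyS : ∀ s, y = .mid s → y ∉ S) :
    classSum m S x y = classTerm m S x y (.line 1) + classTerm m S x y (.line (topLine m S)) +
      if x.pos m < m / 2 ∧ y.pos m < m / 2 then q ^ (x.pos m + y.pos m) else 0 := by
  classical
  obtain ⟨he, ⟨s, hs, hs'⟩, ht, -⟩ := hS.of_isHigh hxv hx
  have htm := hS.top_lt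
  have hterm : ∀ a ∈ Finset.range ((m + 1) / 2),
      (if Lab.line a ∈ S then classTerm m S x y (.line a) else 0) =
      (if a = 1 then classTerm m S x y (.line 1) else 0) +
      (if a = topLine m S then classTerm m S x y (.line (topLine m S)) else 0) := by
    intro a _
    by_cases haS : Lab.line a ∈ S
    · rw [if_pos haS]
      by_cases h1 : a = 1
      · rw [if_pos h1, if_neg (by omega), h1, add_zero]
      · by_cases h2 : a = topLine m S
        · rw [if_neg h1, if_pos h2, ← h2, zero_add]
        · have h := (hS.greenVal_high hxv hx a haS).1
          rw [if_neg h1, if_neg h2] at h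
          rw [if_neg h1, if_neg h2, classTerm_comm, classTerm_eq_zero h, add_zero]
    · rw [if_neg haS, if_neg (by rintro rfl; exact haS hS.refl),
        if_neg (by rintro rfl; exact haS hS.top_mem), add_zero]
  rw [classSum, Finset.sum_congr rfl hterm, Finset.sum_add_distrib, Finset.sum_ite_eq',
    Finset.sum_ite_eq', if_pos (by rw [Finset.mem_range]; omega),
    if_pos (by rw [Finset.mem_range]; omega)]
  congr 1
  -- Exactly one middle character is in S, and it accounts for the last term.
  rw [Finset.sum_eq_single s, if_pos hs,
    hS.classTerm_mid hs (by rintro rfl; exact hx.1 hs) (by rintro rfl; exact hyS s rfl hs)]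
  · intro t _ hts
    rw [if_neg]
    rwa [show t = !s by cases s <;> cases t <;> simp_all]
  · simp

theorem gapTerm_of_exactlyOne {s : Bool} (h : Lab.mid s ∈ S) (h' : Lab.mid (!s) ∉ S) {n : ℕ}
    (hn : topLine m S < n) : gapTerm m S n = 0 := by
  rw [hS.gapTerm_of_large hn]
  cases s <;> simp_all

theorem not_isHigh_threshold : ¬ IsHigh m S (.line (threshold m S)) :=
  fun h => lt_irrefl _ h.2

theorem classSum_high_low {x : Lab} (hxv : x.Valid m) (hx : IsHigh m S x) {j : ℕ}
    (hj : 2 * j < m) (hy : ¬ IsHigh m S (.line j)) :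
    classSum m S x (.line j) = Ker m x (.line j) := by
  have hq := q_ne_zero
  obtain ⟨he, ⟨s, hs, hs'⟩, ht, htc, htc', hc, hh, hrep⟩ := hS.of_isHigh hxv hx
  have hm2 : 2 * (m / 2) = m := Nat.two_mul_div_two_of_even he
  have hjc : j ≤ threshold m S := by
    by_contra! h
    have : Lab.line j ∈ S := by
      by_contra h'
      exact hy ⟨h', h⟩
    have := hS.le_top this
    omega
  obtain ⟨τ, hτ, hτS, hτj, hτmax⟩ := hS.springerRep_of_not_isHigh (x := .line j) hj hy
    (by simp) (by simp)
  simp only [Lab.pos] at hτj hτmax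
  have ht1 : topLine m S ≠ 1 := by omega
  -- Within the class of χ_1, Λ has no entries between characters beyond the threshold and the
  -- others.
  have h1 : classTerm m S x (.line j) (.line 1) = 0 := by
    rw [classTerm, (hS.greenVal_high hxv hx 1 hS.refl).2, if_pos rfl, classKer_mixed hx, mul_zero]
    rw [(hS.greenVal_low hy hτ 1).2]
    split_ifs
    · exact hy
    · exact hS.not_isHigh_of_mem hS.refl
  -- As exactly one middle character is in S, the gap term above the top line is 1 - 1 = 0, and a
  -- single power of q remains.
  have h2 : classTerm m S x (.line j) (.line (topLine m S)) = q ^ (m - (x.pos m - j)) := by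
    obtain ⟨hx1, hx2⟩ := hS.greenVal_high hxv hx _ hS.top_mem
    rw [if_neg ht1, if_pos rfl] at hx1 hx2
    have hy1 : greenVal m S (.line j) (.line (topLine m S)) = if topLine m S = τ then q ^ τ else
        if j < topLine m S then q ^ j else 0 := (hS.greenVal_low hy hτ _).1
    have hy2 := (hS.greenVal_low hy hτ (topLine m S)).2
    have hk : ∀ n ≤ threshold m S, ¬ IsHigh m S (.line n) →
        classKer m S (.line (threshold m S)) (.line n) = q ^ (m - (threshold m S - n)) := by
      intro n hn hn'
      rw [classKer_comm, classKer_of_not_isHigh hn' hS.not_isHigh_threshold, lowKer_of_le hn,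
        hS.gapTerm_of_exactlyOne hs hs' (by omega), zero_mul, sub_zero]
    rw [classTerm, hx1, hx2, hy1, hy2, Lab.pos]
    by_cases h : topLine m S = τ
    · rw [if_pos h, if_pos h, hk j hjc hy, ← h, inv_mul_eq_div, div_mul_eq_mul_div,
        div_eq_iff (pow_ne_zero _ hq)]
      simp only [← pow_add]
      congr 1
      omega
    · have hjt : j < topLine m S := by
        by_contra! h'
        have := hτmax _ hS.top_mem h'
        have := hS.le_top hτS
        omega
      rw [if_neg h, if_neg h, if_pos hjt, hk _ htc (hS.not_isHigh_of_mem hS.top_mem),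
        inv_mul_eq_div, div_mul_eq_mul_div, div_eq_iff (pow_ne_zero _ hq)]
      simp only [← pow_add]
      congr 1
      omega
  rw [hS.classSum_of_isHigh hxv hx (by simp), h1, h2, zero_add]
  cases x with
  | line i =>
    have hi : 2 * i < m := hxv
    simp only [Lab.pos] at hc hh
    rw [if_pos (by simp only [Lab.pos]; omega), Lab.pos, Lab.pos, Ker, max_eq_left (by omega), min_eq_right (by omega)]
    ring
  | mid u =>
    simp only [Lab.pos] at hc hh
    rw [if_neg (by simp only [Lab.pos]; omega), Lab.pos, Ker, add_zero]
    congr 1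
    omega
  | sgn => exact absurd hx hS.not_isHigh_sgn

/-- The class of χ_1 contributes `highKer`, which is the kernel minus the contributions of the top
line and of the middle character in S. -/
theorem classSum_high_high {x y : Lab} (hxv : x.Valid m) (hx : IsHigh m S x) (hyv : y.Valid m)
    (hy : IsHigh m S y) : classSum m S x y = Ker m x y := by
  have hq := q_ne_zero
  obtain ⟨he, ⟨s, hs, hs'⟩, ht, htc, htc', hc, hh, hrep⟩ := hS.of_isHigh hxv hx
  obtain ⟨-, -, -, -, -, hc', hh', -⟩ := hS.of_isHigh hyv hy
  have hm2 : 2 * (m / 2) = m := Nat.two_mul_div_two_of_even he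
  have ht1 : topLine m S ≠ 1 := by omega
  have h1 : classTerm m S x y (.line 1) = highKer m S x y := by
    obtain ⟨hx1, hx2⟩ := hS.greenVal_high hxv hx _ hS.refl
    obtain ⟨hy1, hy2⟩ := hS.greenVal_high hyv hy _ hS.refl
    rw [if_pos rfl] at hx1 hx2 hy1 hy2
    rw [classTerm, hx1, hx2, hy1, hy2, classKer, if_pos ⟨hx, hy⟩, Lab.pos]
    field_simp
  have h2 : classTerm m S x y (.line (topLine m S)) =
      q ^ (m + 2 * threshold m S - (x.pos m + y.pos m)) := by
    obtain ⟨hx1, hx2⟩ := hS.greenVal_high hxv hx _ hS.top_mem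
    obtain ⟨hy1, hy2⟩ := hS.greenVal_high hyv hy _ hS.top_mem
    rw [if_neg ht1, if_pos rfl] at hx1 hx2 hy1 hy2
    rw [classTerm, hx1, hx2, hy1, hy2, Lab.pos,
      classKer_of_not_isHigh hS.not_isHigh_threshold hS.not_isHigh_threshold,
      lowKer_of_le le_rfl, hS.gapTerm_of_exactlyOne hs hs' (by omega), zero_mul, sub_zero,
      inv_mul_eq_div, div_mul_eq_mul_div, div_eq_iff (pow_ne_zero _ hq)]
    simp only [← pow_add]
    congr 1
    omega
  rw [hS.classSum_of_isHigh hxv hx (fun s h => hy.1), h1, h2]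
  cases x with
  | sgn => exact absurd hx hS.not_isHigh_sgn
  | line i =>
    have hi : 2 * i < m := hxv
    cases y with
    | sgn => exact absurd hy hS.not_isHigh_sgn
    | line j =>
      have hj : 2 * j < m := hyv
      rw [if_pos (by simp only [Lab.pos]; omega)]
      simp only [Lab.pos, highKer, Ker]
      ring
    | mid u =>
      simp only [highKer]
      rw [if_neg (by simp [Lab.pos])]
      ring
  | mid u =>
    have : highKer m S (.mid u) y = Ker m (.mid u) y -
      q ^ (m + 2 * threshold m S - ((Lab.mid u).pos m + y.pos m)) := by cases y <;> rfl
    rw [this, if_neg (by simp [Lab.pos])]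
    ring

theorem isHigh_mid_of_isHigh {x : Lab} (hxv : x.Valid m) (hx : IsHigh m S x) {u : Bool}
    (hu : Lab.mid u ∉ S) : IsHigh m S (.mid u) := by
  obtain ⟨-, -, -, -, -, hc, hh, -⟩ := hS.of_isHigh hxv hx
  refine ⟨hu, ?_⟩
  simp only [Lab.pos]
  omega

/-- The classes other than that of the sign character make up the kernel. -/
theorem classSum_eq {x y : Lab} (hx : x.Valid m) (hy : y.Valid m) :
    classSum m S x y = Ker m x y := by
  by_cases hxs : x = .sgn
  · rw [hxs, classSum_comm, Ker_comm, hS.classSum_sgn, Ker_sgn]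
  by_cases hys : y = .sgn
  · rw [hys, hS.classSum_sgn, Ker_sgn]
  by_cases hxm : ∃ s, x = .mid s ∧ x ∈ S
  · obtain ⟨s, rfl, hs⟩ := hxm
    rw [classSum_comm, Ker_comm, hS.classSum_mid hy hs]
  by_cases hym : ∃ s, y = .mid s ∧ y ∈ S
  · obtain ⟨s, rfl, hs⟩ := hym
    exact hS.classSum_mid hx hs
  push Not at hxm hym
  by_cases hxh : IsHigh m S x
  · by_cases hyh : IsHigh m S y
    · exact hS.classSum_high_high hx hxh hy hyh
    · cases y with
      | line j => exact hS.classSum_high_low hx hxh hy hyh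
      | mid u => exact absurd (hS.isHigh_mid_of_isHigh hx hxh (hym u rfl)) hyh
      | sgn => exact absurd rfl hys
  · by_cases hyh : IsHigh m S y
    · rw [classSum_comm, Ker_comm]
      cases x with
      | line j => exact hS.classSum_high_low hy hyh hx hxh
      | mid u => exact absurd (hS.isHigh_mid_of_isHigh hy hyh (hxm u rfl)) hxh
      | sgn => exact absurd rfl hxs
    · cases y with
      | sgn => exact absurd rfl hys
      | mid u => exact hS.classSum_low_mid hx hxh hxs hxm hy hyh (hym u rfl)
      | line j =>
        cases x with
        | sgn => exact absurd rfl hxs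
        | mid u =>
          rw [classSum_comm, Ker_comm]
          exact hS.classSum_low_mid hy hyh (by simp) (by simp) hx hxh (hxm u rfl)
        | line i =>
          rcases le_total i j with h | h
          · exact hS.classSum_low_lines h hy hxh hyh
          · rw [classSum_comm, Ker_comm]
            exact hS.classSum_low_lines h hx hyh hxh

end IsBase

end

/-! ### The system of Green functions -/

section

variable (m) (S : Set Lab)

open Classical in
/-- The matrix `P` of the system of Green functions. -/
def greenP (x μ : Lab) : RatFunc ℂ :=
  if greenCol m S x (springerRep m S μ) = μ then greenVal m S x (springerRep m S μ) else 0

open Classical in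
/-- The matrix `Λ` of the system of Green functions. -/
def greenL (μ ν : Lab) : RatFunc ℂ :=
  if springerRep m S μ = springerRep m S ν then
    if springerRep m S μ = .sgn then 1
    else (q ^ m - 1) * ((q ^ (2 * (springerRep m S μ).pos m))⁻¹ * classKer m S μ ν)
  else 0

end

section

variable {S : Set Lab}

section sums

open Classical in
/-- The labels which occur for `I₂(m)`. -/
def validLabels (m : ℕ) : Finset Lab :=
  ((Finset.range ((m + 1) / 2)).image Lab.line ∪
    (if Even m then Finset.univ.image Lab.mid else ∅)) ∪ {.sgn}

theorem mem_validLabels {x : Lab} : x ∈ validLabels m ↔ x.Valid m := by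
  unfold validLabels
  cases x with
  | line j =>
    have : (Lab.line j).Valid m ↔ 2 * j < m := Iff.rfl
    rw [this]
    split_ifs <;> simp <;> omega
  | mid s =>
    have : (Lab.mid s).Valid m ↔ Even m := Iff.rfl
    rw [this]
    split_ifs <;> simp_all
  | sgn =>
    have : (Lab.sgn).Valid m := trivial
    simp [this]

theorem sum_validLabels {M : Type*} [AddCommMonoid M] (f : Lab → M) :
    ∑ x ∈ validLabels m, f x = ∑ a ∈ Finset.range ((m + 1) / 2), f (.line a) +
      (∑ s : Bool, open Classical in if Even m then f (.mid s) else 0) + f .sgn := by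
  classical
  unfold validLabels
  rw [Finset.sum_union, Finset.sum_union, Finset.sum_singleton, Finset.sum_image]
  · congr 2
    split_ifs
    · rw [Finset.sum_image (by intro a _ b _ h; simpa using h)]
    · simp
  · intro a _ b _ h; simpa using h
  · rw [Finset.disjoint_left]
    intro x hx
    obtain ⟨a, -, rfl⟩ := Finset.mem_image.1 hx
    split_ifs <;> simp
  · rw [Finset.disjoint_left]
    intro x hx
    split_ifs at hx <;> aesop

theorem sum_irr (hm : 3 ≤ m) {M : Type*} [AddCommMonoid M] (f : Lab → M) :
    ∑ χ : Irr m, f (lab m χ) = ∑ x ∈ validLabels m, f x :=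
  Finset.sum_bij' (fun χ _ => lab m χ) (fun x _ => irr m x)
    (fun χ _ => mem_validLabels.2 (lab_valid χ)) (fun _ _ => Finset.mem_univ _)
    (fun χ _ => irr_lab χ) (fun _ hx => lab_irr hm (mem_validLabels.1 hx)) (fun _ _ => rfl)

end sums

namespace IsBase

variable (hS : IsBase m S)
include hS

theorem greenCol_valid {x σ : Lab} (hx : x.Valid m) (hσ : σ ∈ S) :
    (greenCol m S x σ).Valid m := by
  unfold greenCol
  split_ifs with h1 h2
  · exact hx
  · obtain ⟨he, -, -, -, -, h3, h4, -⟩ := hS.of_isHigh hx h2.1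
    change 2 * threshold m S < m
    omega
  · exact hS.valid _ hσ

theorem springerRep_greenCol {x σ : Lab} (hx : x.Valid m) (hσ : σ ∈ S) :
    springerRep m S (greenCol m S x σ) = σ := by
  unfold greenCol
  split_ifs with h1 h2
  · exact h1
  · rw [h2.2]
    exact (hS.of_isHigh hx h2.1).2.2.2.2.2.2.2
  · exact hS.springerRep_of_mem hσ

/-- A row has at most one nonzero entry in each class, so sums over columns become sums over
classes. -/
theorem sum_greenP {x : Lab} (hx : x.Valid m) (g : Lab → RatFunc ℂ) :
    ∑ μ ∈ validLabels m, greenP m S x μ * g μ =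
    ∑ σ ∈ validLabels m, open Classical in
      if σ ∈ S then greenVal m S x σ * g (greenCol m S x σ) else 0 := by
  classical
  simp only [greenP, ite_mul, zero_mul]
  rw [← Finset.sum_filter, ← Finset.sum_filter]
  refine Finset.sum_bij' (fun μ _ => springerRep m S μ) (fun σ _ => greenCol m S x σ) ?_ ?_ ?_ ?_ ?_
  · intro μ _
    rw [Finset.mem_filter, mem_validLabels]
    exact ⟨hS.valid _ (hS.springerRep_mem μ), hS.springerRep_mem μ⟩
  · intro σ hσ
    have hσ := (Finset.mem_filter.1 hσ).2
    rw [Finset.mem_filter, mem_validLabels]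
    exact ⟨hS.greenCol_valid hx hσ, by rw [hS.springerRep_greenCol hx hσ]⟩
  · exact fun μ hμ => (Finset.mem_filter.1 hμ).2
  · exact fun σ hσ => hS.springerRep_greenCol hx (Finset.mem_filter.1 hσ).2
  · intro μ hμ
    rw [(Finset.mem_filter.1 hμ).2]

theorem greenL_greenCol {x y σ τ : Lab} (hx : x.Valid m) (hy : y.Valid m) (hσ : σ ∈ S)
    (hτ : τ ∈ S) : greenL m S (greenCol m S x σ) (greenCol m S y τ) =
      if σ = τ then if σ = .sgn then 1 else
        (q ^ m - 1) * ((q ^ (2 * σ.pos m))⁻¹ *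
          classKer m S (greenCol m S x σ) (greenCol m S y τ)) else 0 := by
  rw [greenL, hS.springerRep_greenCol hx hσ, hS.springerRep_greenCol hy hτ]

theorem greenVal_sgn_right (x : Lab) : greenVal m S x .sgn = Rdeg m x := by
  rw [greenVal]
  split_ifs with h1 h2
  · have hx : x = .sgn := by
      unfold springerRep at h1
      split_ifs at h1
      exact h1
    rw [hx]
    rfl
  · rfl
  all_goals exact absurd rfl h2

/-- The defining equation of the Green functions in terms of labels. -/
theorem green_equation {x y : Lab} (hx : x.Valid m) (hy : y.Valid m) :
    ∑ μ ∈ validLabels m, greenP m S x μ * ∑ ν ∈ validLabels m, greenP m S y ν * greenL m S μ ν =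
      Rdeg m x * Rdeg m y + (q ^ m - 1) * Ker m x y := by
  classical
  rw [hS.sum_greenP hx fun μ => ∑ ν ∈ validLabels m, greenP m S y ν * greenL m S μ ν]
  have h : ∀ σ ∈ validLabels m, (if σ ∈ S then greenVal m S x σ *
      ∑ ν ∈ validLabels m, greenP m S y ν * greenL m S (greenCol m S x σ) ν else 0) =
      if σ ∈ S then if σ = .sgn then Rdeg m x * Rdeg m y else
        (q ^ m - 1) * classTerm m S x y σ else 0 := by
    intro σ hσv
    by_cases hσ : σ ∈ S
    · rw [if_pos hσ, if_pos hσ, hS.sum_greenP hy fun ν => greenL m S (greenCol m S x σ) ν,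
        Finset.sum_eq_single σ, if_pos hσ, hS.greenL_greenCol hx hy hσ hσ, if_pos rfl]
      · split_ifs with h
        · rw [h, hS.greenVal_sgn_right, hS.greenVal_sgn_right, mul_one]
        · rw [classTerm]
          ring
      · intro τ _ hτ
        split_ifs with hτS
        · rw [hS.greenL_greenCol hx hy hσ hτS, if_neg hτ.symm, mul_zero]
        · rfl
      · exact fun h => absurd hσv h
    · rw [if_neg hσ, if_neg hσ]
  rw [Finset.sum_congr rfl h, sum_validLabels, if_pos hS.sgn, if_pos rfl, ← hS.classSum_eq hx hy,
    classSum, mul_add, Finset.mul_sum, Finset.mul_sum, add_comm]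
  congr 2
  · refine Finset.sum_congr rfl fun a _ => ?_
    rw [mul_ite, mul_zero]
    simp
  · refine Finset.sum_congr rfl fun s _ => ?_
    by_cases hs : Lab.mid s ∈ S
    · have he : Even m := hS.valid _ hs
      simp [hs, he]
    · simp [hs]

end IsBase

/-! ### Integrality of the Green functions -/

/-- The polynomials with integer coefficients. -/
def intPoly : Subring (RatFunc ℂ) :=
  ((algebraMap ℂ[X] (RatFunc ℂ)).comp (mapRingHom (Int.castRingHom ℂ))).range

theorem exists_of_mem_intPoly {f : RatFunc ℂ} (h : f ∈ intPoly) :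
    ∃ p : ℤ[X], f = ofPoly (p.map (Int.castRingHom ℂ)) := by
  obtain ⟨p, rfl⟩ := h
  exact ⟨p, rfl⟩

theorem q_mem_intPoly : q ∈ intPoly := ⟨X, by simp [q]⟩

/-- The multiples of `q ^ n` among the polynomials with integer coefficients. -/
def IsIntMultiple (n : ℕ) (f : RatFunc ℂ) : Prop := ∃ g ∈ intPoly, f = q ^ n * g

theorem IsIntMultiple.sub {n : ℕ} {f g : RatFunc ℂ} (hf : IsIntMultiple n f)
    (hg : IsIntMultiple n g) : IsIntMultiple n (f - g) := by
  obtain ⟨u, hu, rfl⟩ := hf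
  obtain ⟨v, hv, rfl⟩ := hg
  exact ⟨u - v, intPoly.sub_mem hu hv, by ring⟩

theorem isIntMultiple_mul_pow {n k : ℕ} (h : n ≤ k) {c : RatFunc ℂ} (hc : c ∈ intPoly) :
    IsIntMultiple n (c * q ^ k) := by
  refine ⟨c * q ^ (k - n), intPoly.mul_mem hc (intPoly.pow_mem q_mem_intPoly _), ?_⟩
  rw [mul_left_comm, ← pow_add, Nat.add_sub_cancel' h]

theorem isIntMultiple_pow {n k : ℕ} (h : n ≤ k) : IsIntMultiple n (q ^ k) := by
  simpa using isIntMultiple_mul_pow h intPoly.one_mem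

theorem isIntMultiple_zero (n : ℕ) : IsIntMultiple n 0 := ⟨0, intPoly.zero_mem, by simp⟩

theorem gapTerm_mem_intPoly (n : ℕ) : gapTerm m S n ∈ intPoly := by
  unfold gapTerm
  split_ifs
  · exact intPoly.pow_mem q_mem_intPoly _
  all_goals
    refine intPoly.sub_mem (intPoly.add_mem ?_ ?_) intPoly.one_mem <;>
    first | exact intPoly.one_mem | exact intPoly.zero_mem

/-- The multiples of `q ^ n` among the polynomials with nonnegative integer coefficients. -/
def IsNatMultiple (n : ℕ) (f : RatFunc ℂ) : Prop :=
  ∃ p : ℕ[X], f = ofPoly (p.map (Nat.castRingHom ℂ)) ∧ X ^ n ∣ p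

theorem isNatMultiple_pow {n k : ℕ} (h : n ≤ k) : IsNatMultiple n (q ^ k) :=
  ⟨X ^ k, by simp [ofPoly_pow, ofPoly_X], pow_dvd_pow _ h⟩

theorem isNatMultiple_zero (n : ℕ) : IsNatMultiple n 0 :=
  ⟨0, by simp [ofPoly], dvd_zero _⟩

theorem IsNatMultiple.add {n : ℕ} {f g : RatFunc ℂ} (hf : IsNatMultiple n f)
    (hg : IsNatMultiple n g) : IsNatMultiple n (f + g) := by
  obtain ⟨u, rfl, hu⟩ := hf
  obtain ⟨v, rfl, hv⟩ := hg
  exact ⟨u + v, by rw [Polynomial.map_add, ofPoly_add], dvd_add hu hv⟩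

theorem isNatMultiple_Rdeg {x : Lab} (hx : x.Valid m) {n : ℕ} (h : n ≤ x.pos m) :
    IsNatMultiple n (Rdeg m x) := by
  cases x with
  | line j =>
    have hj : 2 * j < m := hx
    simp only [Lab.pos] at h
    simp only [Rdeg]
    split_ifs with h0
    · simpa using isNatMultiple_pow (n := n) (k := 0) (by omega)
    · exact (isNatMultiple_pow h).add (isNatMultiple_pow (by omega))
  | mid s => exact isNatMultiple_pow h
  | sgn => exact isNatMultiple_pow h

namespace IsBase

variable (hS : IsBase m S)
include hS

theorem pos_springerRep_le_pos {x : Lab} (hx : x.Valid m) :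
    (springerRep m S x).pos m ≤ x.pos m := by
  by_cases h : x ∈ S
  · rw [hS.springerRep_of_mem h]
  · exact (hS.pos_springerRep_lt hx h).le

theorem isNatMultiple_greenP {x : Lab} (hx : x.Valid m) (μ : Lab) :
    IsNatMultiple ((springerRep m S x).pos m) (greenP m S x μ) := by
  have hle := hS.pos_springerRep_le_pos hx
  unfold greenP greenVal
  split_ifs with h1 h2 h3 h4
  · rw [h2]
    exact isNatMultiple_pow le_rfl
  · exact isNatMultiple_Rdeg hx hle
  -- The exponent is at least 1 because the top line and the threshold add up to at least m/2 + 1;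
  -- this is what the definition of the threshold ensures.
  · rw [hS.springerRep_of_isHigh h4.1]
    obtain ⟨-, -, -, -, h5, -, h6, -⟩ := hS.of_isHigh hx h4.1
    exact isNatMultiple_pow (by simp only [Lab.pos] at *; omega)
  · exact isNatMultiple_pow hle
  · exact isNatMultiple_zero _
  · exact isNatMultiple_zero _

theorem isIntMultiple_Ker {x y : Lab} (hx : x.Valid m) (hy : y.Valid m)
    (h : (∃ s, x = .mid s) ∨ (∃ s, y = .mid s)) {n : ℕ} (hnm : n ≤ m) (hnx : n ≤ 2 * x.pos m)
    (hny : n ≤ 2 * y.pos m) : IsIntMultiple n (Ker m x y) := by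
  have key : ∀ {i : ℕ} {s : Bool}, n ≤ 2 * (Lab.line i).pos m → n ≤ 2 * (Lab.mid s).pos m →
      IsIntMultiple n (q ^ (i + m / 2)) := fun h1 h2 =>
    isIntMultiple_pow (by simp only [Lab.pos] at h1 h2; omega)
  cases x <;> cases y <;> simp only [Ker] <;>
  first
  | exact isIntMultiple_zero _
  | exact key hnx hny
  | exact key hny hnx
  | (split_ifs
     · exact isIntMultiple_pow hnm
     · exact isIntMultiple_zero _)
  | simp at h

/-- Needed to cancel the factor q^(-2n) in Λ, with n the position of the Springer representation.
The members of its class have positions at least n and at most m/2, which bounds every exponent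
below by 2n. -/
theorem isIntMultiple_classKer {x y : Lab} (hx : x.Valid m) (hy : y.Valid m)
    (hxy : springerRep m S x = springerRep m S y) (hsgn : springerRep m S x ≠ .sgn) :
    IsIntMultiple (2 * (springerRep m S x).pos m) (classKer m S x y) := by
  have hlx := hS.pos_springerRep_le_pos hx
  have hly := hS.pos_springerRep_le_pos hy
  rw [← hxy] at hly
  have hxs : x ≠ .sgn := by
    rintro rfl
    exact hsgn (hS.springerRep_of_mem hS.sgn)
  have hys : y ≠ .sgn := by
    rintro rfl
    exact hsgn (hxy.trans (hS.springerRep_of_mem hS.sgn))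
  have hpm : ∀ z : Lab, z.Valid m → z ≠ .sgn → 2 * z.pos m ≤ m := by
    intro z hz hzs
    cases z with
    | line j => have : 2 * j < m := hz; simp only [Lab.pos]; omega
    | mid s => simp only [Lab.pos]; omega
    | sgn => exact absurd rfl hzs
  have hxm := hpm x hx hxs
  have hym := hpm y hy hys
  obtain ⟨n, hn⟩ : ∃ n, n = (springerRep m S x).pos m := ⟨_, rfl⟩
  rw [← hn] at hlx hly ⊢
  have hker : ((∃ s, x = .mid s) ∨ (∃ s, y = .mid s)) → IsIntMultiple (2 * n) (Ker m x y) :=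
    fun h => hS.isIntMultiple_Ker hx hy h (by omega) (by omega) (by omega)
  unfold classKer
  split_ifs with h1 h2
  · obtain ⟨-, -, h3, h4, -, h5, h6, -⟩ := hS.of_isHigh hx h1.1
    rw [hS.springerRep_of_isHigh h1.1] at hn
    simp only [Lab.pos] at hn
    cases x with
    | sgn => exact absurd rfl hxs
    | line i =>
      cases y with
      | sgn => exact absurd rfl hys
      | line j =>
        simp only [Lab.pos] at hxm hym hlx hly
        exact (isIntMultiple_pow (by omega)).sub (isIntMultiple_pow (by omega))
      | mid t => exact (hker (by simp)).sub (isIntMultiple_pow (by omega))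
    | mid s =>
      have h7 := (hker (by simp)).sub
        (isIntMultiple_pow (k := m + 2 * threshold m S - ((Lab.mid s).pos m + y.pos m)) (by omega))
      cases y with
      | sgn => exact absurd rfl hys
      | line j => exact h7
      | mid t => exact h7
  · exact isIntMultiple_zero _
  · cases x with
    | sgn => exact absurd rfl hxs
    | line i =>
      cases y with
      | sgn => exact absurd rfl hys
      | line j =>
        simp only [Lab.pos] at hxm hym hlx hly
        exact (isIntMultiple_pow (by omega)).sub
          (isIntMultiple_mul_pow (by omega) (gapTerm_mem_intPoly _))
      | mid t => exact hker (by simp)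
    | mid s =>
      have h7 := hker (by simp)
      cases y with
      | sgn => exact absurd rfl hys
      | line j => exact h7
      | mid t => exact h7

theorem greenL_mem_intPoly {x y : Lab} (hx : x.Valid m) (hy : y.Valid m) :
    greenL m S x y ∈ intPoly := by
  unfold greenL
  split_ifs with h1 h2
  · exact intPoly.one_mem
  · obtain ⟨g, hg, h⟩ := hS.isIntMultiple_classKer hx hy h1 h2
    rw [h, inv_mul_cancel_left₀ (pow_ne_zero _ q_ne_zero)]
    exact intPoly.mul_mem
      (intPoly.sub_mem (intPoly.pow_mem q_mem_intPoly _) intPoly.one_mem) hg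
  · exact intPoly.zero_mem

/-- The matrix `P` is triangular. -/
theorem greenP_eq_zero {x μ : Lab} (hx : x.Valid m) (hne : x ≠ μ)
    (hle : (springerRep m S μ).pos m ≤ (springerRep m S x).pos m) : greenP m S x μ = 0 := by
  unfold greenP greenVal
  have hle' := hS.pos_springerRep_le_pos hx
  have hxh : ∀ h : IsHigh m S x, (springerRep m S x).pos m = 1 := fun h => by
    rw [hS.springerRep_of_isHigh h]
    rfl
  split_ifs with h1 h2 h3 h4 h5
  · rw [greenCol, if_pos h2] at h1
    exact absurd h1 hne
  · rw [h3] at hle h2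
    cases x with
    | sgn => exact absurd (hS.springerRep_of_mem hS.sgn) h2
    | line i =>
      have : 2 * i < m := hx
      simp only [Lab.pos] at *
      omega
    | mid s =>
      have := hS.three_le
      simp only [Lab.pos] at *
      omega
  · have := hxh h4.1
    obtain ⟨-, -, h3, -⟩ := hS.of_isHigh hx h4.1
    rw [h4.2, this] at hle
    simp only [Lab.pos] at hle
    omega
  · omega
  · rfl
  · rfl

theorem greenP_self {x : Lab} : greenP m S x x = q ^ (springerRep m S x).pos m := by
  rw [greenP, if_pos (show greenCol m S x _ = x from if_pos rfl), greenVal, if_pos rfl]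

end IsBase

end

/-! ### The trivial character is special -/

/-- The index representation over `ℂ[q]`. -/
def indexRep (m : ℕ) : HeckeRep m 1 :=
  heckeLift X m (fun _ => algebraMap ℂ[X] _ X)
    (by intro i; rw [← map_mul, ← map_mul, ← map_add]; congr 1; ring)
    (by simp only [altProd, List.map_const', List.prod_replicate, length_altWord])

theorem trace_indexRep (w : DihedralGroup m) :
    (indexRep m (heckeT X w)).trace = X ^ (redWord m w).length := by
  rw [map_heckeT]
  simp only [indexRep, heckeLift_heckeGen]
  rw [List.map_const', List.prod_replicate, ← map_pow, Algebra.algebraMap_eq_smul_one,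
    Matrix.trace_smul, Matrix.trace_one]
  simp

/-- T_w acts by q^ℓ(w), so the Schur element is the sum of q^ℓ(w), nonzero at q = 0. The trivial
character must be known to be special because its class lies above that of χ_1. -/
theorem isSpecial_trivChar (hm : 3 ≤ m) : IsSpecial (chr m (.line 0)) := by
  refine ⟨1, indexRep m, fun w => by rw [trace_indexRep]; simp [chr, trivChar], ?_⟩
  rw [b_chr hm (show Lab.Valid m (.line 0) by simp only [Lab.Valid]; omega)]
  have hs : schurElement (indexRep m) =
      ofPoly (∑ w : DihedralGroup m, X ^ (redWord m w).length) := by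
    rw [schurElement, Nat.cast_one, inv_one, one_mul]
    have h : ofPoly (∑ w : DihedralGroup m, X ^ (redWord m w).length) =
        ∑ w : DihedralGroup m, q ^ (redWord m w).length := by
      rw [← ofPoly_X]
      simp only [ofPoly, map_sum, map_pow]
    rw [h]
    refine Finset.sum_congr rfl fun w _ => ?_
    rw [trace_indexRep, trace_indexRep, length_redWord_inv, ofPoly_pow, ofPoly_X,
      inv_mul_cancel_left₀ (pow_ne_zero _ q_ne_zero)]
  have hc := coeff_zero_poincare hm
  rw [genericDegree, hs, poincare_eq, qOrder_div_eq]
  · rw [natTrailingDegree_eq_zero.2 (Or.inr (by rw [hc]; exact one_ne_zero))]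
    rfl
  · intro h
    rw [h] at hc
    simp at hc
  · rw [coeff_zero_eq_eval_zero, eval_finsetSum]
    have h : ∀ w : DihedralGroup m, eval 0 (X ^ (redWord m w).length : ℂ[X]) =
        ((if (redWord m w).length = 0 then 1 else 0 : ℕ) : ℂ) := by
      intro w
      rw [eval_pow, eval_X, zero_pow_eq]
      push_cast
      rfl
    rw [Finset.sum_congr rfl fun w _ => h w, ← Nat.cast_sum, Nat.cast_ne_zero]
    refine (Finset.sum_pos' (fun _ _ => Nat.zero_le _) ⟨1, Finset.mem_univ _, ?_⟩).ne'
    rw [redWord_one]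
    simp

/-! ### The maximal Springer correspondence -/

section

variable (m) (S : Set Lab)

/-- The class with Springer representation `σ`. -/
def classOf (σ : Lab) : Set (DihedralGroup m → ℂ) :=
  {χ | ∃ x, x.Valid m ∧ springerRep m S x = σ ∧ chr m x = χ}

/-- The order of the classes. -/
def repLt (σ τ : Lab) : Prop := τ.pos m < σ.pos m ∨ (σ = .mid true ∧ τ = .mid false)

end

/-- A matrix given in terms of labels. -/
def irrMatrix (f : Lab → Lab → RatFunc ℂ) : Matrix (Irr m) (Irr m) (RatFunc ℂ) :=
  fun χ χ' => f (lab m χ) (lab m χ')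

theorem irrMatrix_apply (f : Lab → Lab → RatFunc ℂ) (χ χ' : Irr m) :
    irrMatrix f χ χ' = f (lab m χ) (lab m χ') := rfl

/-- A class contains only one Springer representation. -/
theorem LSDatum.IsSpringerFor.eq_of_mem_supp {D : LSDatum m} {S : Set (DihedralGroup m → ℂ)}
    (hD : D.IsSpringerFor S) {χ σ : DihedralGroup m → ℂ} (hχ : χ ∈ S) (hσ : σ ∈ S)
    (h : σ ∈ D.supp χ) : σ = χ := by
  rw [← hD.2] at hχ hσ
  have hs := D.supp_eq_supp hχ.1 h
  obtain ⟨ρ, hρ, -, hmin⟩ := hD.1.min_b _ (D.supp_mem_parts hχ.1)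
  have h1 : σ = ρ := by
    by_contra hne
    exact absurd (hσ.2 ρ (hs ▸ hρ)) (not_le.2 (hmin σ h hne))
  have h2 : χ = ρ := by
    by_contra hne
    exact absurd (hχ.2 ρ hρ) (not_le.2 (hmin χ (D.mem_supp_self hχ.1) hne))
  rw [h1, h2]

section

variable {S : Set Lab}

/-- Lines lie strictly before m/2 and ε at m, so positions determine labels up to interchanging the
middle characters. -/
theorem IsBase.pos_injective (hS : IsBase m S) {σ τ : Lab} (hσ : σ ∈ S) (hτ : τ ∈ S)
    (h : σ.pos m = τ.pos m) : σ = τ ∨ ∃ s, σ = .mid s ∧ τ = .mid !s := by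
  have hm := hS.three_le
  have h1 := hS.valid _ hσ
  have h2 := hS.valid _ hτ
  have key : ∀ {i : ℕ} {s : Bool}, (Lab.line i).Valid m → (Lab.mid s).Valid m → i ≠ m / 2 := by
    intro i s (h1 : 2 * i < m) (h2 : Even m)
    have := Nat.even_iff.1 h2
    omega
  have key' : ∀ {i : ℕ}, (Lab.line i).Valid m → i ≠ m := by
    intro i (h1 : 2 * i < m)
    omega
  cases σ <;> cases τ <;> simp only [Lab.pos] at h
  · exact Or.inl (by rw [h])
  · exact absurd h (key h1 h2)
  · exact absurd h (key' h1)
  · exact absurd h.symm (key h2 h1)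
  · rename_i s t
    rcases Bool.eq_or_eq_not s t with rfl | rfl
    · exact Or.inl rfl
    · exact Or.inr ⟨!t, rfl, by simp⟩
  · omega
  · exact absurd h.symm (key' h2)
  · omega
  · exact Or.inl rfl

namespace IsBase

variable (hS : IsBase m S)
include hS

theorem chr_mem_classOf {x σ : Lab} (hx : x.Valid m) :
    chr m x ∈ classOf m S σ ↔ springerRep m S x = σ := by
  constructor
  · rintro ⟨y, hy, rfl, h⟩
    rw [chr_injective hS.three_le hy hx h]
  · exact fun h => ⟨x, hx, h, rfl⟩

theorem classOf_injective {σ τ : Lab} (hσ : σ ∈ S) (h : classOf m S σ = classOf m S τ) :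
    σ = τ := by
  have h1 := (hS.chr_mem_classOf (hS.valid _ hσ)).2 (hS.springerRep_of_mem hσ)
  rw [h, hS.chr_mem_classOf (hS.valid _ hσ), hS.springerRep_of_mem hσ] at h1
  exact h1

/-- The maximal Springer correspondence with given set of Springer representations. -/
def datum : LSDatum m where
  parts := classOf m S '' S
  nonempty := by
    rintro _ ⟨σ, hσ, rfl⟩
    exact ⟨_, (hS.chr_mem_classOf (hS.valid _ hσ)).2 (hS.springerRep_of_mem hσ)⟩
  sUnion_parts := by
    ext χ
    constructor
    · rintro ⟨_, ⟨σ, -, rfl⟩, x, hx, -, rfl⟩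
      exact chr_mem_Irr hx
    · intro hχ
      obtain ⟨x, hx, rfl⟩ := exists_label hχ
      exact ⟨_, ⟨_, hS.springerRep_mem x, rfl⟩, x, hx, rfl, rfl⟩
  disjoint := by
    rintro _ ⟨σ, hσ, rfl⟩ _ ⟨τ, hτ, rfl⟩ hne
    rw [Function.onFun, Set.disjoint_left]
    rintro _ ⟨x, hx, rfl, rfl⟩ h
    exact hne (by rw [(hS.chr_mem_classOf hx).1 h])
  lt C C' := ∃ σ ∈ S, ∃ τ ∈ S, C = classOf m S σ ∧ C' = classOf m S τ ∧ repLt m σ τ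
  lt_irrefl := by
    rintro _ - ⟨σ, hσ, τ, hτ, h1, h2, h3⟩
    have := hS.classOf_injective hσ (h1.symm.trans h2)
    subst this
    rcases h3 with h | ⟨h, h'⟩
    · exact lt_irrefl _ h
    · exact absurd (h.symm.trans h') (by simp)
  lt_trans := by
    rintro _ - _ - _ - ⟨σ, hσ, τ, hτ, h1, h2, h3⟩ ⟨τ', hτ', υ, hυ, h4, h5, h6⟩
    have := hS.classOf_injective hτ (h2.symm.trans h4)
    subst this
    refine ⟨σ, hσ, υ, hυ, h1, h5, ?_⟩
    rcases h3 with h | ⟨h, h'⟩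
    · rcases h6 with h7 | ⟨h7, h8⟩
      · exact Or.inl (h7.trans h)
      · subst h7 h8
        exact Or.inl h
    · subst h h'
      rcases h6 with h7 | ⟨h7, h8⟩
      · exact Or.inl h7
      · simp at h7
  lt_total := by
    rintro _ ⟨σ, hσ, rfl⟩ _ ⟨τ, hτ, rfl⟩ hne
    have key : repLt m σ τ ∨ repLt m τ σ := by
      rcases lt_trichotomy (σ.pos m) (τ.pos m) with h | h | h
      · exact Or.inr (Or.inl h)
      · rcases hS.pos_injective hσ hτ h with rfl | ⟨s, rfl, rfl⟩
        · exact absurd rfl hne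
        · cases s
          · exact Or.inr (Or.inr ⟨rfl, rfl⟩)
          · exact Or.inl (Or.inr ⟨rfl, rfl⟩)
      · exact Or.inl (Or.inl h)
    exact key.imp (fun h => ⟨σ, hσ, τ, hτ, rfl, rfl, h⟩) fun h => ⟨τ, hτ, σ, hσ, rfl, rfl, h⟩
  -- On a class this is the infimum of a singleton, because distinct elements of S have distinct
  -- classes; it merely extends the position to a function on all sets.
  a C := sInf {n | ∃ σ ∈ S, C = classOf m S σ ∧ n = σ.pos m}
  a_antitone := by
    rintro _ - _ - ⟨σ, hσ, τ, hτ, rfl, rfl, h⟩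
    have key : ∀ σ ∈ S, {n | ∃ τ ∈ S, classOf m S σ = classOf m S τ ∧ n = τ.pos m} =
        {σ.pos m} := by
      intro σ hσ
      ext n
      constructor
      · rintro ⟨τ, -, h, rfl⟩
        rw [hS.classOf_injective hσ h]
        rfl
      · rintro rfl
        exact ⟨σ, hσ, rfl, rfl⟩
    rw [key σ hσ, key τ hτ, csInf_singleton, csInf_singleton]
    rcases h with h | ⟨rfl, rfl⟩
    · exact h.le
    · exact le_rfl

theorem datum_supp {x : Lab} (hx : x.Valid m) :
    hS.datum.supp (chr m x) = classOf m S (springerRep m S x) :=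
  hS.datum.supp_eq ⟨_, hS.springerRep_mem x, rfl⟩ ((hS.chr_mem_classOf hx).2 rfl)

theorem datum_a {σ : Lab} (hσ : σ ∈ S) : hS.datum.a (classOf m S σ) = σ.pos m := by
  have key : {n | ∃ τ ∈ S, classOf m S σ = classOf m S τ ∧ n = τ.pos m} = {σ.pos m} := by
    ext n
    constructor
    · rintro ⟨τ, -, h, rfl⟩
      rw [hS.classOf_injective hσ h]
      rfl
    · rintro rfl
      exact ⟨σ, hσ, rfl, rfl⟩
  change sInf _ = _
  rw [key, csInf_singleton]

theorem datum_lt {σ τ : Lab} (hσ : σ ∈ S) (hτ : τ ∈ S) :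
    hS.datum.lt (classOf m S σ) (classOf m S τ) ↔ repLt m σ τ := by
  constructor
  · rintro ⟨σ', hσ', τ', hτ', h1, h2, h3⟩
    rwa [hS.classOf_injective hσ h1, hS.classOf_injective hτ h2]
  · exact fun h => ⟨σ, hσ, τ, hτ, rfl, rfl, h⟩

theorem datum_springerReps : hS.datum.springerReps = chr m '' S := by
  have hm := hS.three_le
  ext χ
  constructor
  · rintro ⟨hχ, hmin⟩
    obtain ⟨x, hx, rfl⟩ := exists_label hχ
    rw [hS.datum_supp hx] at hmin
    by_contra hxS
    replace hxS : x ∉ S := fun h => hxS ⟨x, h, rfl⟩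
    have hσ := hS.springerRep_mem x
    have h1 := hmin _ ((hS.chr_mem_classOf (hS.valid _ hσ)).2 (hS.springerRep_of_mem hσ))
    rw [b_chr hm hx, b_chr hm (hS.valid _ hσ)] at h1
    exact absurd (hS.pos_springerRep_lt hx hxS) (not_lt.2 h1)
  · rintro ⟨σ, hσ, rfl⟩
    have hσv := hS.valid _ hσ
    refine ⟨chr_mem_Irr hσv, ?_⟩
    rw [hS.datum_supp hσv, hS.springerRep_of_mem hσ]
    rintro _ ⟨y, hy, rfl, rfl⟩
    rw [b_chr hm hσv, b_chr hm hy]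
    exact hS.pos_springerRep_le_pos hy

theorem datum_isGreenSystem : IsGreenSystem hS.datum
    (irrMatrix (greenP m S)) (irrMatrix (greenL m S)) := by
  have hm := hS.three_le
  have hsupp : ∀ χ : Irr m, hS.datum.supp χ.1 = classOf m S (springerRep m S (lab m χ)) := by
    intro χ
    rw [← chr_lab χ, hS.datum_supp (lab_valid χ)]
  constructor
  · intro χ χ'
    obtain ⟨p, hp, -⟩ := hS.isNatMultiple_greenP (lab_valid χ) (lab m χ')
    refine ⟨p.map (Nat.castRingHom ℤ), 1, one_ne_zero, ?_⟩
    rw [irrMatrix_apply, hp, Polynomial.map_one, ofPoly_one, div_one, Polynomial.map_map]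
    congr 2
  · intro χ χ'
    obtain ⟨p, hp⟩ := exists_of_mem_intPoly (hS.greenL_mem_intPoly (lab_valid χ) (lab_valid χ'))
    exact ⟨p, 1, one_ne_zero, by
      rw [irrMatrix_apply, hp, Polynomial.map_one, ofPoly_one, div_one]⟩
  · ext χ χ'
    have h := hS.green_equation (lab_valid χ) (lab_valid χ')
    rw [← Omega_irr hm (lab_valid χ) (lab_valid χ'), irr_lab, irr_lab] at h
    rw [← h, ← sum_irr hm fun μ => greenP m S (lab m χ) μ *
      ∑ ν ∈ validLabels m, greenP m S (lab m χ') ν * greenL m S μ ν, Matrix.mul_assoc,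
      Matrix.mul_apply]
    refine Finset.sum_congr rfl fun μ _ => ?_
    rw [← sum_irr hm fun ν => greenP m S (lab m χ') ν * greenL m S (lab m μ) ν, Matrix.mul_apply]
    congr 1
    exact Finset.sum_congr rfl fun ν _ => mul_comm _ _
  · intro χ χ' h
    rw [hsupp, hsupp, hS.datum_lt (hS.springerRep_mem _) (hS.springerRep_mem _)] at h
    refine hS.greenP_eq_zero (lab_valid χ) ?_ ?_
    · intro h'
      rw [h'] at h
      rcases h with h | ⟨h, h1⟩
      · exact lt_irrefl _ h
      · exact absurd (h.symm.trans h1) (by simp)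
    · rcases h with h | ⟨h, h1⟩
      · exact h.le
      · rw [h, h1]
        exact le_rfl
  · intro χ
    rw [hsupp, hS.datum_a (hS.springerRep_mem _), irrMatrix_apply, hS.greenP_self]
  · intro χ χ' hne h
    rw [hsupp, hsupp] at h
    refine hS.greenP_eq_zero (lab_valid χ) ?_ ?_
    · intro h'
      exact hne (by rw [← irr_lab χ, h', irr_lab])
    · rw [hS.classOf_injective (hS.springerRep_mem _) h]
  · intro χ χ' hne
    rw [irrMatrix_apply, greenL, if_neg]
    intro h
    exact hne (by rw [hsupp, hsupp, h])

/-- The class of the trivial character is a singleton. -/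
theorem eq_line_zero {x : Lab} (hx : x.Valid m) (h : springerRep m S x = .line 0) :
    x = .line 0 := by
  have hm := hS.three_le
  by_cases hxS : x ∈ S
  · rwa [hS.springerRep_of_mem hxS] at h
  · have hlt := hS.pos_springerRep_lt hx hxS
    have hh : ¬ IsHigh m S x := fun h' => by
      rw [hS.springerRep_of_isHigh h'] at h
      simp at h
    rw [springerRep, if_neg hxS, if_neg hh] at h
    have h1 : x.pos m ≠ 1 := by
      intro h1
      cases x with
      | line j =>
        simp only [Lab.pos] at h1
        rw [h1] at hxS
        exact hxS hS.refl
      | mid s =>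
        have := Nat.even_iff.1 (show Even m from hx)
        simp only [Lab.pos] at h1
        omega
      | sgn => exact hxS hS.sgn
    have h2 : 1 ≤ prevLine S (x.pos m) := le_prevLine (by omega) hS.refl
    rw [Lab.line.injEq] at h
    omega

theorem datum_isSpringer : hS.datum.IsSpringer := by
  have hm := hS.three_le
  have hspecial : ∀ x : Lab, x.Valid m → IsSpecial (chr m x) →
      x = .line 0 ∨ x = .line 1 ∨ x = .sgn := by
    intro x hx h
    cases x with
    | sgn => simp
    | mid s => exact absurd h (not_isSpecial_mid hm hx s)
    | line j =>
      by_contra h'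
      simp only [Lab.line.injEq, not_or] at h'
      exact not_isSpecial_line hm (by omega) hx h
  constructor
  · rintro _ ⟨σ, hσ, rfl⟩
    have hσv := hS.valid _ hσ
    refine ⟨chr m σ, (hS.chr_mem_classOf hσv).2 (hS.springerRep_of_mem hσ), ?_, ?_⟩
    · rw [hS.datum_a hσ, b_chr hm hσv]
    · rintro _ ⟨x, hx, rfl, rfl⟩ hne
      rw [b_chr hm hσv, b_chr hm hx]
      refine hS.pos_springerRep_lt hx fun hxS => hne ?_
      rw [hS.springerRep_of_mem hxS]
  · intro χ hχ h
    obtain ⟨x, hx, rfl⟩ := exists_label hχ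
    rw [hS.datum_springerReps]
    refine ⟨x, ?_, rfl⟩
    rcases hspecial x hx h with rfl | rfl | rfl
    · exact hS.triv
    · exact hS.refl
    · exact hS.sgn
  · intro χ hχ χ' hχ' h h' hf
    obtain ⟨x, hx, rfl⟩ := exists_label hχ
    obtain ⟨y, hy, rfl⟩ := exists_label hχ'
    have key : ∀ k, Lab.line k ∈ S → k ≤ (springerRep m S y).pos m →
        hS.datum.le (hS.datum.supp (chr m y)) (hS.datum.supp (chr m (.line k))) := by
      intro k hk hle
      rw [hS.datum_supp hy, hS.datum_supp (hS.valid _ hk), hS.springerRep_of_mem hk]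
      rcases hle.eq_or_lt with h1 | h1
      · rcases hS.pos_injective hk (hS.springerRep_mem y) h1 with h2 | ⟨s, h2, -⟩
        · exact Or.inl (by rw [← h2])
        · simp at h2
      · exact Or.inr ((hS.datum_lt (hS.springerRep_mem y) hk).2 (Or.inl h1))
    rcases hspecial x hx h with rfl | rfl | rfl
    · exact key 0 hS.triv (Nat.zero_le _)
    -- Only the trivial character is supported above χ_1, and it is special, so the family condition
    -- does not apply to it.
    · refine key 1 hS.refl (Nat.one_le_iff_ne_zero.2 fun h0 => ?_)
      rcases hS.pos_injective (hS.springerRep_mem y) hS.triv h0 with h2 | ⟨s, -, h2⟩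
      · have := hS.eq_line_zero hy h2
        rw [this] at h'
        exact h' (isSpecial_trivChar hm)
      · simp at h2
    · have := not_sameFamily_sgn hm hy hf
      rw [this] at h'
      exact absurd h h'
  · refine ⟨_, _, hS.datum_isGreenSystem, ?_, ?_⟩
    · exact fun χ χ' =>
        exists_of_mem_intPoly (hS.greenL_mem_intPoly (lab_valid χ) (lab_valid χ'))
    · intro χ χ'
      have h := hS.isNatMultiple_greenP (lab_valid χ) (lab m χ')
      rwa [← hS.datum_a (hS.springerRep_mem _), ← hS.datum_supp (lab_valid χ), chr_lab] at h

/-- In every Springer correspondence the a-value of the support of x is at least the position of the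
candidate's Springer representation, and smaller positions are larger classes. Equal positions leave
only the middle characters, whose classes are singletons. -/
theorem datum_isMaximalFor : hS.datum.IsMaximalFor (chr m '' S) := by
  have hm := hS.three_le
  refine ⟨⟨hS.datum_isSpringer, hS.datum_springerReps⟩, ?_⟩
  rintro D hD χ hχ _ ⟨σ, hσ, rfl⟩ hmem
  obtain ⟨x, hx, rfl⟩ := exists_label hχ
  have hσv := hS.valid _ hσ
  obtain ⟨P, hP⟩ := hD.isLabSystem hm hS.valid
  have h1 : (springerRep m S x).pos m ≤ D.a (D.supp (chr m x)) := hS.pos_springerRep_le hP hx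
  have h2 : D.a (D.supp (chr m σ)) = σ.pos m := hP.a_eq hσv hσ
  rw [← D.supp_eq_supp hχ hmem, h2] at h1
  rw [hS.datum_supp hσv, hS.datum_supp hx, hS.springerRep_of_mem hσ]
  rcases h1.eq_or_lt with h3 | h3
  · rcases hS.pos_injective (hS.springerRep_mem x) hσ h3 with h4 | ⟨s, h4, h5⟩
    · exact Or.inl (by rw [h4])
    · have hxS : x ∈ S := by
        by_contra hxS
        unfold springerRep at h4
        rw [if_neg hxS] at h4
        split_ifs at h4
      have h6 := chr_injective hm hσv hx (hD.eq_of_mem_supp ⟨x, hxS, rfl⟩ ⟨σ, hσ, rfl⟩ hmem)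
      rw [h6, hS.springerRep_of_mem hxS]
      exact Or.inl rfl
  · exact Or.inr ((hS.datum_lt hσ (hS.springerRep_mem x)).2 (Or.inl h3))

end IsBase

end

section

variable {S : Set Lab}

/-! ### Uniqueness -/

namespace IsBase

variable (hS : IsBase m S)
include hS

theorem eq_of_springerRep_mid {x : Lab} {s : Bool} (h : springerRep m S x = .mid s) :
    x = .mid s ∧ x ∈ S := by
  unfold springerRep at h
  split_ifs at h with hx
  exact ⟨h, hx⟩

variable {D : LSDatum m} (hD : D.IsMaximalFor (chr m '' S))
include hD

/-- Maximality of D against the candidate bounds a(supp x) above, and the general estimate bounds it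
below by the same position. The position determines the Springer representation unless x is itself a
middle character in S. -/
theorem springerRep_mem_supp {x : Lab} (hx : x.Valid m) :
    chr m (springerRep m S x) ∈ D.supp (chr m x) := by
  have hm := hS.three_le
  have hχ := chr_mem_Irr hx
  have hρ := hS.springerRep_mem x
  have hρv := hS.valid _ hρ
  obtain ⟨_, ⟨σ, hσ, rfl⟩, hσi, hσx, hs, ha, -, hmem⟩ := hD.1.exists_rep hχ
  have hσv := hS.valid _ hσ
  suffices h : σ = springerRep m S x by rwa [← h]
  obtain ⟨P, hP⟩ := hD.1.isLabSystem hm hS.valid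
  have h1 : (springerRep m S x).pos m ≤ D.a (D.supp (chr m x)) := hS.pos_springerRep_le hP hx
  have h2 : D.a (D.supp (chr m (springerRep m S x))) = (springerRep m S x).pos m :=
    hP.a_eq hρv hρ
  have h3 := D.a_le_of_le (D.supp_mem_parts (chr_mem_Irr hρv)) (D.supp_mem_parts hχ)
    (hD.2 hS.datum hS.datum_isMaximalFor.1 _ hχ _ ⟨_, hρ, rfl⟩ (by
      rw [hS.datum_supp hx]
      exact (hS.chr_mem_classOf hρv).2 (hS.springerRep_of_mem hρ)))
  rw [b_chr hm hσv] at ha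
  rcases hS.pos_injective hσ hρ (by omega) with h4 | ⟨s, -, h4⟩
  · exact h4
  · have hxS := (hS.eq_of_springerRep_mid h4).2
    rw [hS.springerRep_of_mem hxS]
    exact (chr_injective hm hx hσv (hmem ⟨x, hxS, rfl⟩)).symm

theorem supp_eq_classOf {x : Lab} (hx : x.Valid m) :
    D.supp (chr m x) = classOf m S (springerRep m S x) := by
  have hm := hS.three_le
  have hsupp : ∀ {y : Lab}, y.Valid m →
      D.supp (chr m (springerRep m S y)) = D.supp (chr m y) := fun hy =>
    D.supp_eq_supp (chr_mem_Irr hy) (hS.springerRep_mem_supp hD hy)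
  ext χ
  constructor
  · intro hχ
    obtain ⟨y, hy, rfl⟩ := exists_label
      (D.mem_Irr_of_mem (D.supp_mem_parts (chr_mem_Irr hx)) hχ)
    refine ⟨y, hy, ?_, rfl⟩
    have h1 := D.supp_eq_supp (chr_mem_Irr hx) hχ
    have h2 := hS.springerRep_mem_supp hD hy
    rw [h1, ← hsupp hx] at h2
    exact chr_injective hm (hS.valid _ (hS.springerRep_mem y)) (hS.valid _ (hS.springerRep_mem x))
      (hD.1.eq_of_mem_supp ⟨_, hS.springerRep_mem x, rfl⟩ ⟨_, hS.springerRep_mem y, rfl⟩ h2)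
  · rintro ⟨y, hy, hyx, rfl⟩
    rw [← hsupp hx, ← hyx, hsupp hy]
    exact D.mem_supp_self (chr_mem_Irr hy)

theorem parts_eq : D.parts = classOf m S '' S := by
  ext C
  constructor
  · intro hC
    obtain ⟨χ, hχ⟩ := D.nonempty C hC
    obtain ⟨x, hx, rfl⟩ := exists_label (D.mem_Irr_of_mem hC hχ)
    exact ⟨_, hS.springerRep_mem x, by rw [← hS.supp_eq_classOf hD hx, D.supp_eq hC hχ]⟩
  · rintro ⟨σ, hσ, rfl⟩
    have h := hS.supp_eq_classOf hD (hS.valid _ hσ)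
    rw [hS.springerRep_of_mem hσ] at h
    rw [← h]
    exact D.supp_mem_parts (chr_mem_Irr (hS.valid _ hσ))

theorem a_eq_pos {σ : Lab} (hσ : σ ∈ S) : D.a (classOf m S σ) = σ.pos m := by
  obtain ⟨P, hP⟩ := hD.1.isLabSystem hS.three_le hS.valid
  have h : D.a (D.supp (chr m σ)) = σ.pos m := hP.a_eq (hS.valid _ hσ) hσ
  rwa [hS.supp_eq_classOf hD (hS.valid _ hσ), hS.springerRep_of_mem hσ] at h

theorem lt_iff_of_pos_ne {σ τ : Lab} (hσ : σ ∈ S) (hτ : τ ∈ S) (hne : σ.pos m ≠ τ.pos m) :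
    D.lt (classOf m S σ) (classOf m S τ) ↔ τ.pos m < σ.pos m := by
  have hσp : classOf m S σ ∈ D.parts := hS.parts_eq hD ▸ ⟨σ, hσ, rfl⟩
  have hτp : classOf m S τ ∈ D.parts := hS.parts_eq hD ▸ ⟨τ, hτ, rfl⟩
  have h1 : ∀ {σ τ : Lab}, σ ∈ S → τ ∈ S → classOf m S σ ∈ D.parts → classOf m S τ ∈ D.parts →
      D.lt (classOf m S σ) (classOf m S τ) → τ.pos m ≤ σ.pos m := by
    intro σ τ hσ hτ hσp hτp h
    have := D.a_antitone _ hσp _ hτp h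
    rwa [hS.a_eq_pos hD hσ, hS.a_eq_pos hD hτ] at this
  constructor
  · exact fun h => lt_of_le_of_ne (h1 hσ hτ hσp hτp h) hne.symm
  · intro h
    refine (D.lt_total _ hσp _ hτp fun h' => ?_).resolve_right fun h' => ?_
    · rw [hS.classOf_injective hσ h'] at h
      exact lt_irrefl _ h
    · exact absurd (h1 hτ hσ hτp hσp h') (not_le.2 h)

omit hD in
theorem classOf_mid {s : Bool} (hs : Lab.mid s ∈ S) : classOf m S (.mid s) = {chr m (.mid s)} := by
  ext χ
  constructor
  · rintro ⟨x, -, hx, rfl⟩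
    rw [(hS.eq_of_springerRep_mid hx).1]
    rfl
  · rintro rfl
    exact (hS.chr_mem_classOf (hS.valid _ hs)).2 (hS.springerRep_of_mem hs)

/-- Since a reverses the order, classes with different a are ordered by it. Equal a on distinct
classes occurs only for the two singletons of middle characters, the excluded pair. -/
theorem maximal_unique {D' : LSDatum m} (hD' : D'.IsMaximalFor (chr m '' S)) :
    D.parts = D'.parts ∧ (∀ C ∈ D.parts, D.a C = D'.a C) ∧
      ∀ C ∈ D.parts, ∀ C' ∈ D.parts,
        ({C, C'} : Set (Set (DihedralGroup m → ℂ))) ≠ {{chiR m}, {chiR' m}} →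
          (D.lt C C' ↔ D'.lt C C') := by
  refine ⟨(hS.parts_eq hD).trans (hS.parts_eq hD').symm, ?_, ?_⟩
  · rw [hS.parts_eq hD]
    rintro _ ⟨σ, hσ, rfl⟩
    rw [hS.a_eq_pos hD hσ, hS.a_eq_pos hD' hσ]
  · intro C hC C' hC' hne
    have hCp := hC
    have hCp' := hC
    rw [hS.parts_eq hD] at hC hC'
    rw [hS.parts_eq hD, ← hS.parts_eq hD'] at hCp'
    obtain ⟨σ, hσ, rfl⟩ := hC
    obtain ⟨τ, hτ, rfl⟩ := hC'
    by_cases hp : σ.pos m = τ.pos m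
    · rcases hS.pos_injective hσ hτ hp with rfl | ⟨s, rfl, rfl⟩
      · exact iff_of_false (D.lt_irrefl _ hCp) (D'.lt_irrefl _ hCp')
      · refine absurd ?_ hne
        rw [hS.classOf_mid hσ, hS.classOf_mid hτ]
        cases s
        · exact Set.pair_comm _ _
        · rfl
    · rw [hS.lt_iff_of_pos_ne hD hσ hτ hp, hS.lt_iff_of_pos_ne hD' hσ hτ hp]

end IsBase

end

/-- The labels of a set of irreducible characters. -/
def labelsOf (m : ℕ) [NeZero m] (S : Set (DihedralGroup m → ℂ)) : Set Lab :=
  {x | x.Valid m ∧ chr m x ∈ S}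

theorem chr_image_labelsOf {S : Set (DihedralGroup m → ℂ)} (hS : S ⊆ Irr m) :
    chr m '' labelsOf m S = S := by
  ext χ
  constructor
  · rintro ⟨x, hx, rfl⟩
    exact hx.2
  · intro hχ
    obtain ⟨x, hx, rfl⟩ := exists_label (hS hχ)
    exact ⟨x, ⟨hx, hχ⟩, rfl⟩

theorem isBase_labelsOf (hm : 3 ≤ m) {S : Set (DihedralGroup m → ℂ)} (h0 : trivChar m ∈ S)
    (h1 : reflChar m ∈ S) (hε : detChar m ∈ S) : IsBase m (labelsOf m S) where
  three_le := hm
  valid _ hx := hx.1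
  triv := ⟨show 2 * 0 < m by omega, by simpa [chr] using h0⟩
  refl := ⟨show 2 * 1 < m by omega, by
    rw [reflChar_eq_dih] at h1
    simpa [chr] using h1⟩
  sgn := ⟨trivial, hε⟩

end

end DihedralSpringer

theorem theorem3p3 (m : ℕ) [NeZero m] (hm : 3 ≤ m) (S : Set (DihedralGroup m → ℂ))
    (hS : S ⊆ Irr m) (h0 : trivChar m ∈ S) (h1 : reflChar m ∈ S) (hε : detChar m ∈ S) :
    (∃ D : LSDatum m, D.IsMaximalFor S) ∧
    ∀ D D' : LSDatum m, D.IsMaximalFor S → D'.IsMaximalFor S →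
      D.parts = D'.parts ∧ (∀ C ∈ D.parts, D.a C = D'.a C) ∧
      ∀ C ∈ D.parts, ∀ C' ∈ D.parts,
        ({C, C'} : Set (Set (DihedralGroup m → ℂ))) ≠ {{chiR m}, {chiR' m}} →
          (D.lt C C' ↔ D'.lt C C') := by
  have hB := isBase_labelsOf hm h0 h1 hε
  rw [← chr_image_labelsOf hS]
  exact ⟨⟨hB.datum, hB.datum_isMaximalFor⟩, fun D D' hD hD' => hB.maximal_unique hD hD'⟩
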